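/- A finite game (in explicit form, with rational payoffs) $\Gamma=(\mathcal N,(A^i)_{i\in\mathcal N},(u^i)_{i\in\mathcal N})$ consists of a finite set $\mathcal N$ of players, a finite nonempty action set $A^i$ for each player $i$, and payoffs $u^i:\prod_j A^j\to\mathbb Q$; it is encoded by listing its action sets and its full payoff table, with payoffs written in binary. A symmetry of $\Gamma$ is a bijection $\phi$ of the disjoint union $\bigsqcup_i A^i$ onto itself, together with the permutation $\pi$ of $\mathcal N$ that it induces, such that $\phi(A^i)\subseteq A^{\pi(i)}$ for every $i$ and $u^i(\mathbf a)=u^{\pi(i)}(\phi(\mathbf a))$ for every player $i$ and every action profile $\mathbf a$, where $\phi(\mathbf a)_j=\phi(\mathbf a_{\pi^{-1}(j)})$. The symmetry is player-separable if $\pi$ is the identity. A decision problem is GI-hard if the graph isomorphism problem (given two finite simple graphs, are they isomorphic?) reduces to it by a polynomial-time many-one reduction, and GI-complete if in addition it reduces to the graph isomorphism problem by a polynomial-time many-one reduction. Theorem. The problem of deciding whether a given game has a symmetry that is not player-separable is GI-complete. It is GI-hard already when restricted to two-player zero-sum games: there is a polynomial-time computable map that sends every pair of finite simple graphs $(G_1,G_2)$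 to a two-player zero-sum game that has a symmetry which is not player-separable if and only if $G_1\cong G_2$. -/

import Mathlib

namespace GameSym

open Computability

/-! ### Prefix codes -/

/-- A code whose codewords can be split off the front of a string without ambiguity. -/
def IsPrefixCode {α Γ : Type} (c : α → List Γ) : Prop :=
  ∀ x y s t, c x ++ s = c y ++ t → x = y ∧ s = t

theorem IsPrefixCode.injective {α Γ : Type} {c : α → List Γ} (h : IsPrefixCode c) :
    Function.Injective c := fun x y hxy => (h x y [] [] (by rw [hxy])).1

open Classical in
/-- An injective encoding function, as an `Encoding`. -/
noncomputable def encodingOfInjective {α Γ : Type} (c : α → List Γ)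
    (h : Function.Injective c) : Encoding α Γ where
  encode := c
  decode l := if hl : ∃ x, c x = l then some hl.choose else none
  decode_encode x := by
    have hx : ∃ y, c y = c x := ⟨x, rfl⟩
    rw [dif_pos hx]
    exact congrArg some (h hx.choose_spec)

/-- The bits of a word, followed by a comma. -/
def encodeBits (l : List Bool) : List Γ' := l.map Γ'.bit ++ [Γ'.comma]

theorem encodeBits_prefix : IsPrefixCode encodeBits := by
  intro x
  induction x with
  | nil =>
    intro y s t h
    cases y with
    | nil => simpa [encodeBits] using h
    | cons b y => simp [encodeBits] at h
  | cons a x ih =>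
    intro y s t h
    cases y with
    | nil => simp [encodeBits] at h
    | cons b y =>
      simp only [encodeBits, List.map_cons, List.cons_append, List.cons.injEq,
        Γ'.bit.injEq] at h
      obtain ⟨h1, h2⟩ := ih y s t (by simpa [encodeBits] using h.2)
      exact ⟨by rw [h.1, h1], h2⟩

/-- A natural number in unary, followed by a comma. -/
def encodeUnary (n : ℕ) : List Γ' := encodeBits (List.replicate n true)

theorem encodeUnary_prefix : IsPrefixCode encodeUnary := by
  intro x y s t h
  obtain ⟨h1, h2⟩ := encodeBits_prefix _ _ _ _ h
  exact ⟨by simpa using congrArg List.length h1, h2⟩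

/-- A rational number: a sign bit, then the absolute value of the numerator and the denominator
(in lowest terms), both in binary. -/
def encodeRat (q : ℚ) : List Γ' :=
  Γ'.bit (decide (q.num < 0)) :: (encodeBits (encodeNat q.num.natAbs) ++ encodeBits (encodeNat q.den))

theorem encodeRat_prefix : IsPrefixCode encodeRat := by
  intro x y s t h
  simp only [encodeRat, List.cons_append, List.append_assoc, List.cons.injEq, Γ'.bit.injEq] at h
  obtain ⟨hs, h⟩ := h
  obtain ⟨hn, h⟩ := encodeBits_prefix _ _ _ _ h
  obtain ⟨hd, h⟩ := encodeBits_prefix _ _ _ _ h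
  have hn' := encodingNatBool.encode_injective hn
  have hd' := encodingNatBool.encode_injective hd
  refine ⟨Rat.ext ?_ hd', h⟩
  have hs' : x.num < 0 ↔ y.num < 0 := by simpa using hs
  omega

theorem flatMap_cancel {ι Γ : Type} {c d : ι → List Γ} {P : ι → Prop}
    (h : ∀ i s t, c i ++ s = d i ++ t → P i ∧ s = t) (l : List ι) (s t : List Γ)
    (hl : l.flatMap c ++ s = l.flatMap d ++ t) : (∀ i ∈ l, P i) ∧ s = t := by
  induction l with
  | nil => simpa using hl
  | cons a l ih =>
    simp only [List.flatMap_cons, List.append_assoc] at hl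
    obtain ⟨h1, h2⟩ := h a _ _ hl
    obtain ⟨h3, h4⟩ := ih h2
    exact ⟨by simpa using ⟨h1, h3⟩, h4⟩

/-! ### Graphs -/

/-- A finite simple graph with vertex set `{0, …, n-1}`. -/
structure FinGraph where
  n : ℕ
  graph : SimpleGraph (Fin n)

open Classical in
/-- The adjacency matrix of a graph, row by row, each row followed by a comma. -/
noncomputable def FinGraph.encode (G : FinGraph) : List Γ' :=
  (List.finRange G.n).flatMap fun v =>
    encodeBits ((List.finRange G.n).map fun w => decide (G.graph.Adj v w))

theorem FinGraph.encode_injective : Function.Injective FinGraph.encode := by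
  have hc : ∀ G : FinGraph, G.encode.count Γ'.comma = G.n := by
    intro G
    have : ∀ l : List Bool, (encodeBits l).count Γ'.comma = 1 := by
      intro l; simp [encodeBits, List.count_eq_zero]
    simp [FinGraph.encode, List.count_flatMap, Function.comp_def, this]
  intro G H h
  have hn : G.n = H.n := by rw [← hc G, ← hc H, h]
  obtain ⟨n, G⟩ := G
  obtain ⟨n', H⟩ := H
  obtain rfl : n = n' := hn
  congr 1
  have := (flatMap_cancel (P := fun v => ∀ w, G.Adj v w ↔ H.Adj v w) (fun v s t hst => by
    obtain ⟨h1, h2⟩ := encodeBits_prefix _ _ _ _ hst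
    refine ⟨fun w => ?_, h2⟩
    simpa using (List.map_inj_left.1 h1) w (List.mem_finRange w)) _ [] []
    (congrArg (· ++ []) h)).1
  ext v w
  exact this v (List.mem_finRange v) w

/-! ### Games and their symmetries -/

/-- A finite game in explicit form with rational payoffs: the players are `0, …, N-1`, player `i`
has the nonempty action set `{0, …, m i - 1}`, and `u i a` is the payoff of player `i` at the action
profile `a`. -/
structure Game where
  N : ℕ
  m : Fin N → ℕ
  m_pos : ∀ i, 0 < m i
  u : Fin N → (∀ i, Fin (m i)) → ℚ

/-- Action profiles. -/
abbrev Game.Profile (Γ : Game) : Type := ∀ i, Fin (Γ.m i)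

/-- The disjoint union of the action sets of all players. -/
abbrev Game.Action (Γ : Game) : Type := Σ i, Fin (Γ.m i)

/-- A game symmetry: a bijection `φ` of the disjoint union of the action sets that maps the actions
of player `i` to actions of player `π i`, and that leaves payoffs invariant:
`u i a = u (π i) (φ a)`, where `φ a` is the profile whose `j`-th entry is `φ (a (π⁻¹ j))`. -/
structure Game.Symmetry (Γ : Game) where
  φ : Equiv.Perm Γ.Action
  π : Equiv.Perm (Fin Γ.N)
  map_player : ∀ a : Γ.Action, (φ a).1 = π a.1
  map_payoff : ∀ (i : Fin Γ.N) (a : Γ.Profile),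
    Γ.u i a = Γ.u (π i) fun j =>
      Fin.cast (congrArg Γ.m ((map_player _).trans (π.apply_symm_apply j)))
        (φ ⟨π.symm j, a (π.symm j)⟩).2

/-- A symmetry is player-separable if it maps every player to itself. -/
def Game.Symmetry.PlayerSeparable {Γ : Game} (S : Γ.Symmetry) : Prop := S.π = 1

/-- Two players, whose payoffs always sum to zero. -/
def Game.IsTwoPlayerZeroSum (Γ : Game) : Prop :=
  Γ.N = 2 ∧ ∀ a : Γ.Profile, ∑ i, Γ.u i a = 0

/-- All action profiles, in lexicographic order. -/
def profiles : (N : ℕ) → (m : Fin N → ℕ) → List (∀ i, Fin (m i))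
  | 0, _ => [fun i => i.elim0]
  | N + 1, m => (List.finRange (m 0)).flatMap fun a =>
      (profiles N fun i => m i.succ).map fun b =>
        Fin.cons (α := fun i => Fin (m i)) a b

theorem mem_profiles : ∀ (N : ℕ) (m : Fin N → ℕ) (a : ∀ i, Fin (m i)), a ∈ profiles N m
  | 0, _, a => by
    simp only [profiles, List.mem_singleton]
    exact funext fun i => i.elim0
  | N + 1, m, a => by
    simp only [profiles, List.mem_flatMap, List.mem_map]
    exact ⟨a 0, List.mem_finRange _, fun i => a i.succ, mem_profiles N _ _,
      Fin.cons_self_tail a⟩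

/-- The row of the payoff table for the profile `a`: the actions in `a`, then the payoffs of all
players at `a`, then an end marker. -/
def Game.encodeRow (Γ : Game) (a : Γ.Profile) : List Γ' :=
  (List.finRange Γ.N).flatMap (fun i => encodeUnary (a i)) ++
    ((List.finRange Γ.N).flatMap (fun i => encodeRat (Γ.u i a)) ++ [Γ'.ket])

/-- The explicit form of a game: the sizes of the action sets and an end marker, followed by
the payoff table. -/
def Game.encode (Γ : Game) : List Γ' :=
  (List.ofFn Γ.m).flatMap encodeUnary ++
    ([Γ'.ket] ++ (profiles Γ.N Γ.m).flatMap Γ.encodeRow)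

theorem sizes_prefix :
    IsPrefixCode fun l : List ℕ => l.flatMap encodeUnary ++ [Γ'.ket] := by
  have key : ∀ (n : ℕ) (s t : List Γ'), encodeUnary n ++ s ≠ Γ'.ket :: t := by
    intro n s t h
    cases n <;> simp [encodeUnary, encodeBits, List.replicate_succ] at h
  intro x
  induction x with
  | nil =>
    intro y s t h
    cases y with
    | nil => simpa using h
    | cons b y =>
      simp only [List.flatMap_nil, List.nil_append, List.flatMap_cons, List.append_assoc,
        List.singleton_append] at h
      exact absurd h.symm (key _ _ _)
  | cons a x ih =>
    intro y s t h
    cases y with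
    | nil =>
      simp only [List.flatMap_nil, List.nil_append, List.flatMap_cons, List.append_assoc,
        List.singleton_append] at h
      exact absurd h (key _ _ _)
    | cons b y =>
      simp only [List.flatMap_cons, List.append_assoc] at h
      obtain ⟨h1, h2⟩ := encodeUnary_prefix _ _ _ _ h
      obtain ⟨h3, h4⟩ := ih y s t (by simpa using h2)
      exact ⟨by rw [h1, h3], h4⟩

theorem Game.encode_injective : Function.Injective Game.encode := by
  intro A B h
  obtain ⟨h1, h2⟩ := sizes_prefix (List.ofFn A.m) (List.ofFn B.m) _ _
    (by simpa only [Game.encode, List.append_assoc] using h)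
  obtain ⟨N, m, p, u⟩ := A
  obtain ⟨N', m', p', u'⟩ := B
  obtain rfl : N = N' := by simpa using congrArg List.length h1
  obtain rfl : m = m' := List.ofFn_injective h1
  congr 1
  have := (flatMap_cancel (P := fun a => ∀ i, u i a = u' i a) (fun a s t hst => by
    simp only [Game.encodeRow, List.append_assoc] at hst
    have hst := List.append_cancel_left hst
    obtain ⟨h3, h4⟩ := flatMap_cancel (P := fun i => u i a = u' i a)
      (fun i s t hi => encodeRat_prefix _ _ _ _ hi) _ _ _ hst
    exact ⟨fun i => h3 i (List.mem_finRange i), List.append_cancel_left h4⟩) _ [] []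
    (congrArg (· ++ []) h2)).1
  funext i a
  exact this a (mem_profiles _ _ a) i

/-! ### Decision problems and polynomial-time reductions -/

/-- A decision problem: a type of instances encoded as strings over a finite alphabet, and the
yes-instances. -/
structure DecisionProblem where
  Inst : Type
  Alphabet : Type
  alphabetFintype : Fintype Alphabet
  encoding : Encoding Inst Alphabet
  Yes : Inst → Prop

open Classical in
/-- The same problem for the instances in `S` only. -/
noncomputable def DecisionProblem.restrict (P : DecisionProblem) (S : P.Inst → Prop) :
    DecisionProblem where
  Inst := {x : P.Inst // S x}
  Alphabet := P.Alphabet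
  alphabetFintype := P.alphabetFintype
  encoding :=
    { encode := fun x => P.encoding.encode x.1
      decode := fun l => (P.encoding.decode l).bind fun x => if h : S x then some ⟨x, h⟩ else none
      decode_encode := fun x => by simp [x.2] }
  Yes x := P.Yes x.1

/-- Polynomial-time many-one reducibility: some map on instances, computed by a Turing machine
in polynomial time, preserves the answer. -/
def DecisionProblem.PolyReduces (P Q : DecisionProblem) : Prop :=
  ∃ f : P.Inst → Q.Inst,
    Nonempty (Turing.TM2ComputableInPolyTime P.encoding.encode Q.encoding.encode f) ∧
      ∀ x, P.Yes x ↔ Q.Yes (f x)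

/-- The graph isomorphism problem. -/
noncomputable def graphIsomorphism : DecisionProblem where
  Inst := FinGraph × FinGraph
  Alphabet := Γ' ⊕ Γ'
  alphabetFintype := inferInstance
  encoding := encodingProd (encodingOfInjective FinGraph.encode FinGraph.encode_injective)
    (encodingOfInjective FinGraph.encode FinGraph.encode_injective)
  Yes x := Nonempty (x.1.graph ≃g x.2.graph)

/-- Membership in the class GI. -/
def DecisionProblem.InGI (P : DecisionProblem) : Prop := P.PolyReduces graphIsomorphism

/-- GI-hardness. -/
def DecisionProblem.GIHard (P : DecisionProblem) : Prop := graphIsomorphism.PolyReduces P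

/-- GI-completeness. -/
def DecisionProblem.GIComplete (P : DecisionProblem) : Prop := P.InGI ∧ P.GIHard

/-- Given a game, decide whether it has a symmetry that is not player-separable. -/
noncomputable def nonPlayerSeparableSymmetry : DecisionProblem where
  Inst := Game
  Alphabet := Γ'
  alphabetFintype := inferInstance
  encoding := encodingOfInjective Game.encode Game.encode_injective
  Yes Γ := ∃ S : Γ.Symmetry, ¬ S.PlayerSeparable

end GameSym

/-! Hardness. The two graphs are written into the diagonal blocks of the payoff matrix of a zero-sum
game, the second one with the opposite sign. A symmetry that exchanges the players satisfies `v a b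
= -v (g b) (f a)`, where `f` and `g` are its maps on the two action sets. The diagonal entries 3 and
-3 force `f` and `g` to agree on the first block and to map it onto the second; the entries 2 and -2
then say that this common map is a graph isomorphism (`iso_of_swapGame_symmetry`). Conversely an
isomorphism and its inverse exchange the blocks (`swapGame_symmetry_of_iso`).

Membership. Symmetries of a game correspond to label-preserving automorphisms of a graph on its
actions and payoff entries. A symmetry that is not player-separable moves some player `i` to some `j
≠ i`, and for a fixed pair this asks for an isomorphism between two markings of that graph
(`exists_graph_iso_of_symmetry`, `exists_symmetry_of_graph_iso`). What remains is to merge a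
disjunction over `N * N` pairs into one question. This is done by a ladder with two nodes on each
level and, between consecutive levels, four copies of the graph: the copies that stay on one side
carry one marking of the pair, the copies that change sides carry the other. An isomorphism has to
fix the side of the bottom nodes and exchange that of the top nodes. It therefore changes sides at
some level, and there it induces an isomorphism between the two markings; conversely an isomorphism
at a single level is enough (`exists_of_ladder_iso`, `exists_ladder_iso`). Finally labels are
eliminated: each label becomes a hub whose number of pendant leaves identifies it by its degree
(`hubGraph_iso_iff`).

Polynomial time. Both reductions must be run by stack machines. A small language of bounded sums,
symbol tests and bounded repetition is compiled to such machines; nesting composes polynomial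
bounds, so every program is polynomial (`Expr.poly`, `Gen.poly`, `Gen.computable`). Functions on
codes are then shown to be definable by closure properties (`PF`, `PP`, `PG`, `PL`). For membership
the vertices are coded by 6-tuples of numbers, on which adjacency is a definable relation, and the
adjacency matrix is printed by nested loops over tuples. -/

namespace GameSym

open Computability Turing

/-! ### Program fragments for stack machines -/

section Machine

/-- The stacks: the unread input, the part of the input already read (reversed), the output
collected so far (reversed), the output, and unary counters. -/
inductive Stk (B : ℕ)
  | inp | pre | acc | out
  | reg (i : Fin (B + 1))
  deriving DecidableEq, Fintype

/-- The stack alphabets. -/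
abbrev Stk.Sym (α β : Type) {B : ℕ} : Stk B → Type
  | .inp => α
  | .pre => α
  | .acc => β
  | .out => β
  | .reg _ => Unit

/-- The finite memory: the last input or output symbol popped, and whether a stack was nonempty. -/
abbrev Mem (α β : Type) : Type := Option α × Option β × Bool

/-- Statements of the machines considered here. -/
abbrev MStmt (α β : Type) (B : ℕ) (Λ : Type) : Type :=
  TM2.Stmt (Stk.Sym α β (B := B)) Λ (Mem α β)

/-- Configurations of the machines considered here. -/
abbrev MCfg (α β : Type) (B : ℕ) (Λ : Type) : Type :=
  TM2.Cfg (Stk.Sym α β (B := B)) Λ (Mem α β)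

/-- The contents of all stacks. -/
structure St (α β : Type) where
  reg : ℕ → ℕ
  pre : List α
  suf : List α
  acc : List β
  out : List β

variable {α β : Type} {B : ℕ}

/-- The stacks represented by a state. -/
def St.stk (s : St α β) : ∀ k : Stk B, List (Stk.Sym α β k)
  | .inp => s.suf
  | .pre => s.pre
  | .acc => s.acc
  | .out => s.out
  | .reg i => List.replicate (s.reg i) ()

/-- Reachability in at most `t` steps. -/
def ReachIn {Λ : Type} (M : Λ → MStmt α β B Λ) (t : ℕ) (c c' : MCfg α β B Λ) : Prop :=
  ∃ n ≤ t, (flip bind (TM2.step M))^[n] (some c) = some c'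

theorem ReachIn.mono {Λ : Type} {M : Λ → MStmt α β B Λ} {c c' : MCfg α β B Λ} {t t' : ℕ}
    (h : ReachIn M t c c') (ht : t ≤ t') : ReachIn M t' c c' := by
  obtain ⟨n, hn, h⟩ := h
  exact ⟨n, hn.trans ht, h⟩

theorem ReachIn.trans {Λ : Type} {M : Λ → MStmt α β B Λ} {c c' c'' : MCfg α β B Λ} {t t' : ℕ}
    (h : ReachIn M t c c') (h' : ReachIn M t' c' c'') : ReachIn M (t + t') c c'' := by
  obtain ⟨n, hn, h⟩ := h
  obtain ⟨n', hn', h'⟩ := h'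
  refine ⟨n' + n, by omega, ?_⟩
  rw [Function.iterate_add_apply, h, h']

theorem ReachIn.step {Λ : Type} {M : Λ → MStmt α β B Λ} {l : Λ} {v : Mem α β}
    {S : ∀ k : Stk B, List (Stk.Sym α β k)} {c : MCfg α β B Λ}
    (h : TM2.stepAux (M l) v S = c) : ReachIn M 1 ⟨some l, v, S⟩ c :=
  ⟨1, le_rfl, by simp [flip, h]⟩

/-- A piece of a program. Its code is given relative to an embedding of its labels into those of
the whole program and to the label at which to continue. -/
structure Frag (α β : Type) (B : ℕ) where
  Lab : Type
  fin : Fintype Lab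
  entry : Lab
  code : ∀ {Λ : Type}, (Lab → Λ) → Λ → Lab → MStmt α β B Λ

/-- Started in the state `s`, the fragment terminates in the state `s'` in at most `t` steps. -/
def Frag.Runs (F : Frag α β B) (s s' : St α β) (t : ℕ) : Prop :=
  ∀ (Λ : Type) (M : Λ → MStmt α β B Λ) (emb : F.Lab → Λ) (exit : Λ),
    (∀ l, M (emb l) = F.code emb exit l) → ∀ v, ∃ v',
      ReachIn M t ⟨some (emb F.entry), v, s.stk⟩ ⟨some exit, v', s'.stk⟩

theorem Frag.Runs.mono {F : Frag α β B} {s s' : St α β} {t t' : ℕ} (h : F.Runs s s' t)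
    (ht : t ≤ t') : F.Runs s s' t' := fun Λ M emb exit hM v =>
  (h Λ M emb exit hM v).imp fun _ h => h.mono ht

/-- Sequential composition. -/
def Frag.seq (F G : Frag α β B) : Frag α β B where
  Lab := F.Lab ⊕ G.Lab
  fin := by
    haveI := F.fin
    haveI := G.fin
    exact inferInstance
  entry := .inl F.entry
  code emb exit
    | .inl l => F.code (emb ∘ .inl) (emb (.inr G.entry)) l
    | .inr l => G.code (emb ∘ .inr) exit l

/-- Since `Frag.Runs` quantifies over every host program that contains the fragment, composition
only needs a choice of embeddings and of the exit label. -/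
theorem Frag.Runs.seq {F G : Frag α β B} {s s' s'' : St α β} {t t' : ℕ} (h : F.Runs s s' t)
    (h' : G.Runs s' s'' t') : (F.seq G).Runs s s'' (t + t') := by
  intro Λ M emb exit hM v
  obtain ⟨v', h1⟩ := h Λ M (emb ∘ .inl) (emb (.inr G.entry)) (fun l => hM (.inl l)) v
  obtain ⟨v'', h2⟩ := h' Λ M (emb ∘ .inr) exit (fun l => hM (.inr l)) v'
  exact ⟨v'', h1.trans h2⟩

/-- A fragment with a single label. -/
def Frag.single (c : ∀ {Λ : Type}, Λ → Λ → MStmt α β B Λ) : Frag α β B where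
  Lab := Unit
  fin := inferInstance
  entry := ()
  code emb exit _ := c (emb ()) exit

theorem Frag.Runs.single {c : ∀ {Λ : Type}, Λ → Λ → MStmt α β B Λ} {s s' : St α β}
    (h : ∀ (Λ : Type) (self exit : Λ) (v : Mem α β), ∃ v',
      TM2.stepAux (c self exit) v s.stk = ⟨some exit, v', s'.stk⟩) :
    (Frag.single c).Runs s s' 1 := by
  intro Λ M emb exit hM v
  obtain ⟨v', h⟩ := h Λ (emb ()) exit v
  exact ⟨v', ReachIn.step ((congrArg (fun q => TM2.stepAux q v s.stk) (hM ())).trans h)⟩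

theorem Frag.Runs.single_again {c : ∀ {Λ : Type}, Λ → Λ → MStmt α β B Λ} {s s' s'' : St α β}
    {t : ℕ} (h : ∀ (Λ : Type) (self exit : Λ) (v : Mem α β), ∃ v',
      TM2.stepAux (c self exit) v s.stk = ⟨some self, v', s'.stk⟩)
    (h' : (Frag.single c).Runs s' s'' t) : (Frag.single c).Runs s s'' (1 + t) := by
  intro Λ M emb exit hM v
  obtain ⟨v', h⟩ := h Λ (emb ()) exit v
  obtain ⟨v'', h'⟩ := h' Λ M emb exit hM v'
  exact ⟨v'', (ReachIn.step
    ((congrArg (fun q => TM2.stepAux q v s.stk) (hM ())).trans h)).trans h'⟩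

/-- The counter number `i`. -/
abbrev rg (B i : ℕ) : Stk B := .reg (Fin.ofNat (B + 1) i)

/-- Counter numbers are reduced modulo `B + 1`. The bound `i ≤ B`, carried along from here on,
prevents two counters from sharing a stack. -/
theorem rg_val {i : ℕ} (h : i ≤ B) : ((Fin.ofNat (B + 1) i : Fin (B + 1)) : ℕ) = i :=
  Nat.mod_eq_of_lt (by omega)

/-- The state after setting a counter. -/
def St.set (s : St α β) (i n : ℕ) : St α β := { s with reg := Function.update s.reg i n }

theorem St.stk_set (s : St α β) {i : ℕ} (h : i ≤ B) (n : ℕ) :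
    (s.set i n).stk = Function.update (s.stk (B := B)) (rg B i) (List.replicate n ()) := by
  funext k
  cases k with
  | reg j =>
    by_cases hj : j = Fin.ofNat (B + 1) i
    · subst hj
      simp only [St.stk, St.set, rg_val h, Function.update_self]
    · have hne : (j : ℕ) ≠ i := fun e => hj (Fin.ext (by rw [rg_val h, e]))
      rw [Function.update_of_ne (by simpa [-Fin.ofNat_eq_cast] using hj)]
      simp [St.stk, St.set, Function.update_of_ne hne]
  | _ => rw [Function.update_of_ne (by simp)]; rfl

theorem St.stk_rg (s : St α β) {i : ℕ} (h : i ≤ B) :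
    s.stk (rg B i) = List.replicate (s.reg i) () := by
  simp only [St.stk, rg_val h]

/-- Increment a counter. -/
def Frag.inc (i : ℕ) : Frag α β B :=
  .single fun _ exit => .push (rg B i) (fun _ => ()) (.goto fun _ => exit)

theorem Frag.Runs.inc {i : ℕ} (h : i ≤ B) (s : St α β) :
    (Frag.inc i : Frag α β B).Runs s (s.set i (s.reg i + 1)) 1 := by
  refine .single fun Λ self exit v => ⟨v, ?_⟩
  simp only [TM2.stepAux, s.stk_set h, s.stk_rg h, List.replicate_succ]

/-- Decrement a counter. -/
def Frag.dec (i : ℕ) : Frag α β B :=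
  .single fun _ exit => .pop (rg B i) (fun v _ => v) (.goto fun _ => exit)

theorem Frag.Runs.dec {i : ℕ} (h : i ≤ B) (s : St α β) :
    (Frag.dec i : Frag α β B).Runs s (s.set i (s.reg i - 1)) 1 := by
  refine .single fun Λ self exit v => ⟨v, ?_⟩
  simp only [TM2.stepAux, s.stk_set h, s.stk_rg h, List.tail_replicate]

/-- Append a symbol to the output collected so far. -/
def Frag.emit (b : β) : Frag α β B :=
  .single fun _ exit => .push .acc (fun _ => b) (.goto fun _ => exit)

theorem Frag.Runs.emit (b : β) (s : St α β) :
    (Frag.emit b : Frag α β B).Runs s { s with acc := b :: s.acc } 1 := by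
  refine .single fun Λ self exit v => ⟨v, ?_⟩
  simp only [TM2.stepAux]
  congr 1
  funext k
  cases k <;> first | rw [Function.update_self]; rfl | rw [Function.update_of_ne (by simp)]; rfl

/-- Do nothing. -/
def Frag.skip : Frag α β B := .single fun _ exit => .goto fun _ => exit

theorem Frag.Runs.skip (s : St α β) : (Frag.skip : Frag α β B).Runs s s 1 :=
  .single fun _ _ _ v => ⟨v, rfl⟩

/-- Move one symbol forward in the input. -/
def Frag.fwd [Inhabited α] : Frag α β B :=
  .single fun _ exit => .pop .inp (fun _ o => (o, none, false))
    (.branch (fun v => v.1.isSome) (.push .pre (fun v => v.1.getD default) (.goto fun _ => exit))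
      (.goto fun _ => exit))

/-- The state after moving one symbol forward in the input. -/
def St.fwd (s : St α β) : St α β :=
  match s.suf with
  | [] => s
  | a :: l => { s with pre := a :: s.pre, suf := l }

theorem Frag.Runs.fwd [Inhabited α] (s : St α β) : (Frag.fwd : Frag α β B).Runs s s.fwd 1 := by
  refine .single fun Λ self exit v => ⟨(s.suf.head?, none, false), ?_⟩
  obtain ⟨reg, pre, suf, acc, out⟩ := s
  cases suf with
  | nil =>
    simp only [TM2.stepAux, St.stk, St.fwd, List.head?_nil, Option.isSome_none, cond_false]
    congr 1
    funext k
    cases k <;> first | rw [Function.update_self]; rfl | rw [Function.update_of_ne (by simp)]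
  | cons a l =>
    simp only [TM2.stepAux, St.stk, St.fwd, List.head?_cons, Option.isSome_some, cond_true,
      List.tail_cons, Option.getD_some]
    congr 1
    funext k
    cases k <;> simp [Function.update, St.stk]

/-- Move back to the beginning of the input. -/
def Frag.rewind [Inhabited α] : Frag α β B :=
  .single fun self exit => .pop .pre (fun _ o => (o, none, false))
    (.branch (fun v => v.1.isSome) (.push .inp (fun v => v.1.getD default) (.goto fun _ => self))
      (.goto fun _ => exit))

theorem Frag.Runs.rewind [Inhabited α] (s : St α β) :
    (Frag.rewind : Frag α β B).Runs s { s with pre := [], suf := s.pre.reverse ++ s.suf }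
      (s.pre.length + 1) := by
  obtain ⟨reg, pre, suf, acc, out⟩ := s
  induction pre generalizing suf with
  | nil =>
    refine .single fun Λ self exit v => ⟨(none, none, false), ?_⟩
    simp only [TM2.stepAux, St.stk, List.head?_nil, Option.isSome_none, cond_false]
    congr 1
    funext k
    cases k <;> simp [Function.update, St.stk]
  | cons a l ih =>
    have := ih (a :: suf)
    refine .mono (.single_again (s' := ⟨reg, l, a :: suf, acc, out⟩)
      (fun Λ self exit v => ⟨(some a, none, false), ?_⟩)
      (by rw [List.reverse_cons, List.append_assoc]; exact this))
      (by simp [add_comm])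
    simp only [TM2.stepAux, St.stk, List.head?_cons, Option.isSome_some, cond_true,
      List.tail_cons, Option.getD_some]
    congr 1
    funext k
    cases k <;> simp [Function.update, St.stk]

/-- Move to the end of the input, and add the number of symbols read to a counter. -/
def Frag.scan [Inhabited α] (i : ℕ) : Frag α β B :=
  .single fun self exit => .pop .inp (fun _ o => (o, none, false))
    (.branch (fun v => v.1.isSome) (.push .pre (fun v => v.1.getD default)
      (.push (rg B i) (fun _ => ()) (.goto fun _ => self))) (.goto fun _ => exit))

theorem Frag.Runs.scan [Inhabited α] {i : ℕ} (h : i ≤ B) (s : St α β) :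
    (Frag.scan i : Frag α β B).Runs s
      (({ s with pre := s.suf.reverse ++ s.pre, suf := [] } : St α β).set i
        (s.reg i + s.suf.length)) (s.suf.length + 1) := by
  obtain ⟨reg, pre, suf, acc, out⟩ := s
  induction suf generalizing pre reg with
  | nil =>
    refine .single fun Λ self exit v => ⟨(none, none, false), ?_⟩
    simp only [TM2.stepAux, St.stk, List.head?_nil, Option.isSome_none, cond_false]
    congr 1
    funext k
    cases k <;> simp [Function.update, St.stk, St.set]
  | cons a l ih =>
    have := ih (Function.update reg i (reg i + 1)) (a :: pre)
    refine .mono (.single_again (s' := (⟨reg, a :: pre, l, acc, out⟩ : St α β).set i (reg i + 1))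
      (fun Λ self exit v => ⟨(some a, none, false), ?_⟩)
      (by
        simp only [Function.update_self, St.set, Function.update_idem] at this
        simp only [St.set, List.reverse_cons, List.append_assoc, List.length_cons]
        rw [show reg i + (l.length + 1) = reg i + 1 + l.length by omega]
        exact this))
      (by simp [add_comm])
    -- The move of the symbol is absorbed into a state first; what remains is an update of the
    -- counter alone, to which `St.stk_set` applies.
    have e : Function.update (Function.update (⟨reg, pre, a :: l, acc, out⟩ : St α β).stk
        Stk.inp l) Stk.pre (a :: pre) = (⟨reg, a :: pre, l, acc, out⟩ : St α β).stk (B := B) := by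
      funext k
      cases k <;> simp [Function.update, St.stk]
    change (⟨some self, (some a, none, false), Function.update (Function.update
      (Function.update (⟨reg, pre, a :: l, acc, out⟩ : St α β).stk Stk.inp l) Stk.pre (a :: pre))
      (rg B i) (() :: Function.update (Function.update
      (⟨reg, pre, a :: l, acc, out⟩ : St α β).stk Stk.inp l) Stk.pre (a :: pre) (rg B i))⟩ :
      MCfg α β B Λ) = _
    rw [e, St.stk_rg _ h, St.stk_set _ h]
    rfl

/-- Erase the input. -/
def Frag.drop : Frag α β B :=
  .single fun self exit => .pop .inp (fun _ o => (none, none, o.isSome))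
    (.branch (fun v => v.2.2) (.goto fun _ => self) (.goto fun _ => exit))

theorem Frag.Runs.drop (s : St α β) :
    (Frag.drop : Frag α β B).Runs s { s with suf := [] } (s.suf.length + 1) := by
  obtain ⟨reg, pre, suf, acc, out⟩ := s
  induction suf with
  | nil =>
    refine .single fun Λ self exit v => ⟨(none, none, false), ?_⟩
    simp only [TM2.stepAux, St.stk, List.head?_nil, Option.isSome_none, cond_false]
    congr 1
    funext k
    cases k <;> simp [Function.update, St.stk]
  | cons a l ih =>
    refine .mono (.single_again (s' := ⟨reg, pre, l, acc, out⟩)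
      (fun Λ self exit v => ⟨(none, none, true), ?_⟩) ih) (by simp [add_comm])
    simp only [TM2.stepAux, St.stk, List.head?_cons, Option.isSome_some, cond_true,
      List.tail_cons]
    congr 1
    funext k
    cases k <;> simp [Function.update, St.stk]

/-- Move the output collected so far to the output stack. -/
def Frag.flush [Inhabited β] : Frag α β B :=
  .single fun self exit => .pop .acc (fun _ o => (none, o, false))
    (.branch (fun v => v.2.1.isSome) (.push .out (fun v => v.2.1.getD default)
      (.goto fun _ => self)) (.goto fun _ => exit))

theorem Frag.Runs.flush [Inhabited β] (s : St α β) :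
    (Frag.flush : Frag α β B).Runs s { s with acc := [], out := s.acc.reverse ++ s.out }
      (s.acc.length + 1) := by
  obtain ⟨reg, pre, suf, acc, out⟩ := s
  induction acc generalizing out with
  | nil =>
    refine .single fun Λ self exit v => ⟨(none, none, false), ?_⟩
    simp only [TM2.stepAux, St.stk, List.head?_nil, Option.isSome_none, cond_false]
    congr 1
    funext k
    cases k <;> simp [Function.update, St.stk]
  | cons a l ih =>
    have := ih (a :: out)
    refine .mono (.single_again (s' := ⟨reg, pre, suf, l, a :: out⟩)
      (fun Λ self exit v => ⟨(none, some a, false), ?_⟩)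
      (by rw [List.reverse_cons, List.append_assoc]; exact this))
      (by simp [add_comm])
    simp only [TM2.stepAux, St.stk, List.head?_cons, Option.isSome_some, cond_true,
      List.tail_cons, Option.getD_some]
    congr 1
    funext k
    cases k <;> simp [Function.update, St.stk]

/-- Repeat a fragment as long as a counter is positive. -/
def Frag.loop (i : ℕ) (F : Frag α β B) : Frag α β B where
  Lab := Option F.Lab
  fin := by
    haveI := F.fin
    exact inferInstance
  entry := none
  code emb exit
    | none => .peek (rg B i) (fun _ o => (none, none, o.isSome))
        (.branch (fun v => v.2.2) (.goto fun _ => emb (some F.entry)) (.goto fun _ => exit))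
    | some l => F.code (emb ∘ some) (emb none) l

theorem Frag.Runs.loop_done {i : ℕ} (h : i ≤ B) (F : Frag α β B) {s : St α β}
    (hs : s.reg i = 0) : (F.loop i).Runs s s 1 := by
  intro Λ M emb exit hM v
  refine ⟨(none, none, false), ReachIn.step ?_⟩
  rw [hM]
  simp [Frag.loop, TM2.stepAux, s.stk_rg h, hs, -Fin.ofNat_eq_cast]

theorem Frag.Runs.loop_step {i : ℕ} (h : i ≤ B) {F : Frag α β B} {s s' s'' : St α β} {t t' : ℕ}
    (hs : s.reg i ≠ 0) (h1 : F.Runs s s' t) (h2 : (F.loop i).Runs s' s'' t') :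
    (F.loop i).Runs s s'' (1 + t + t') := by
  intro Λ M emb exit hM v
  obtain ⟨v', h1⟩ := h1 Λ M (emb ∘ some) (emb none) (fun l => hM (some l)) (none, none, true)
  obtain ⟨v'', h2⟩ := h2 Λ M emb exit hM v'
  refine ⟨v'', ((ReachIn.step ?_).trans h1).trans h2⟩
  rw [hM]
  obtain ⟨n, hn⟩ := Nat.exists_eq_succ_of_ne_zero hs
  simp [Frag.loop, TM2.stepAux, s.stk_rg h, hn, List.replicate_succ, -Fin.ofNat_eq_cast]
  rfl

/-- A loop that runs through the states `s 0, …, s n`, where the counter counts down. -/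
theorem Frag.Runs.loop {i : ℕ} (h : i ≤ B) {F : Frag α β B} (n : ℕ) (s : ℕ → St α β) (t : ℕ)
    (hn : (s n).reg i = 0) (hs : ∀ j < n, (s j).reg i ≠ 0)
    (hF : ∀ j < n, F.Runs (s j) (s (j + 1)) t) :
    (F.loop i).Runs (s 0) (s n) (n * (t + 1) + 1) := by
  induction n generalizing s with
  | zero => simpa using Frag.Runs.loop_done h F hn
  | succ n ih =>
    have := ih (fun j => s (j + 1)) hn (fun j hj => hs _ (by omega)) (fun j hj => hF _ (by omega))
    exact (Frag.Runs.loop_step h (hs 0 (by omega)) (hF 0 (by omega)) this).mono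
      (by ring_nf; omega)

/-- Test the next input symbol. -/
def Frag.ifSym [DecidableEq α] (a : α) (F : Frag α β B) : Frag α β B where
  Lab := Option F.Lab
  fin := by
    haveI := F.fin
    exact inferInstance
  entry := none
  code emb exit
    | none => .peek .inp (fun _ o => (none, none, decide (o = some a)))
        (.branch (fun v => v.2.2) (.goto fun _ => emb (some F.entry)) (.goto fun _ => exit))
    | some l => F.code (emb ∘ some) exit l

theorem Frag.Runs.ifSym_pos [DecidableEq α] {a : α} {F : Frag α β B} {s s' : St α β} {t : ℕ}
    (hs : s.suf.head? = some a) (h : F.Runs s s' t) : (F.ifSym a).Runs s s' (1 + t) := by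
  intro Λ M emb exit hM v
  obtain ⟨v', h⟩ := h Λ M (emb ∘ some) exit (fun l => hM (some l)) (none, none, true)
  refine ⟨v', (ReachIn.step ?_).trans h⟩
  rw [hM]
  simp [Frag.ifSym, TM2.stepAux, St.stk, hs]
  rfl

theorem Frag.Runs.ifSym_neg [DecidableEq α] {a : α} (F : Frag α β B) {s : St α β}
    (hs : s.suf.head? ≠ some a) : (F.ifSym a).Runs s s 1 := by
  intro Λ M emb exit hM v
  refine ⟨(none, none, false), ReachIn.step ?_⟩
  rw [hM]
  simp [Frag.ifSym, TM2.stepAux, St.stk, hs]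

/-- The machine that runs a fragment and halts. -/
def Frag.machine [Fintype α] [Fintype β] (F : Frag α β B) : FinTM2 where
  K := Stk B
  k₀ := .inp
  k₁ := .out
  Γ := Stk.Sym α β
  Λ := Option F.Lab
  main := some F.entry
  ΛFin := by
    haveI := F.fin
    exact inferInstance
  σ := Mem α β
  initialState := (none, none, false)
  Γk₀Fin := inferInstanceAs (Fintype α)
  m
    | some l => F.code some none l
    | none => .load (fun _ => (none, none, false)) .halt

/-- A state in which all stacks except the input are empty. -/
def St.init (w : List α) : St α β := ⟨fun _ => 0, [], w, [], []⟩

/-- A state in which all stacks except the output are empty. -/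
def St.final (w : List β) : St α β := ⟨fun _ => 0, [], [], [], w⟩

/-- The extra step is spent at the halting label, which resets the finite memory, because the
prescribed final configuration contains the initial memory. -/
theorem Frag.machine_outputs [Fintype α] [Fintype β] (F : Frag α β B) {w : List α} {w' : List β}
    {t : ℕ} (h : F.Runs (St.init w) (St.final w') t) :
    Nonempty (TM2OutputsInTime F.machine w (some w') (t + 1)) := by
  obtain ⟨v', h⟩ := h _ F.machine.m some none (fun _ => rfl) (none, none, false)
  obtain ⟨n, hn, h⟩ := h.trans (ReachIn.step
    (c := ⟨none, (none, none, false), (St.final w' : St α β).stk⟩) rfl)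
  refine ⟨⟨⟨n, ?_⟩, hn⟩⟩
  have h1 : initList F.machine w =
      ⟨some (some F.entry), (none, none, false), (St.init w : St α β).stk⟩ := by
    unfold initList
    congr 1
    funext k
    cases k <;> rfl
  have h2 : haltList F.machine w' =
      ⟨none, (none, none, false), (St.final w' : St α β).stk⟩ := by
    unfold haltList
    congr 1
    funext k
    cases k <;> rfl
  change (flip bind (TM2.step F.machine.m))^[n] (some (initList F.machine w)) =
    some (haltList F.machine w')
  exact (congrArg (fun c => (flip bind (TM2.step F.machine.m))^[n] (some c)) h1).trans
    (h.trans (congrArg some h2.symm))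

end Machine

end GameSym

namespace GameSym

open Computability Turing

/-! ### A programming language for polynomial time -/

section Language

variable {α β : Type} {B : ℕ}

/-- Expressions for natural numbers that depend on a word and on variables (numbered from the
innermost binder). They can add, subtract, sum over a range, test a symbol of the word, and
rename variables. -/
inductive Expr (α : Type) : Type
  | one
  | len
  | var (i : ℕ)
  | add (e e' : Expr α)
  | sub (e e' : Expr α)
  | sum (e e' : Expr α)
  | sym (a : α) (e : Expr α)
  | ren (σ : ℕ → ℕ) (e : Expr α)

/-- Extend an environment by the value of a new innermost variable. -/
def consEnv {X : Type} (x : X) (ρ : ℕ → X) : ℕ → X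
  | 0 => x
  | i + 1 => ρ i

/-- The value of an expression. -/
def Expr.eval [DecidableEq α] (w : List α) : Expr α → (ℕ → ℕ) → ℕ
  | one, _ => 1
  | len, _ => w.length
  | var i, ρ => ρ i
  | add e e', ρ => e.eval w ρ + e'.eval w ρ
  | sub e e', ρ => e.eval w ρ - e'.eval w ρ
  | sum e e', ρ => ∑ i ∈ Finset.range (e.eval w ρ), e'.eval w (consEnv i ρ)
  | sym a e, ρ => if w[e.eval w ρ]? = some a then 1 else 0
  | ren σ e, ρ => e.eval w fun i => ρ (σ i)

/-- The number of auxiliary counters used by the compiled expression. -/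
def Expr.height : Expr α → ℕ
  | one => 0
  | len => 0
  | var _ => 1
  | add e e' => max e.height e'.height
  | sub e e' => max e.height e'.height + 2
  | sum e e' => max e.height e'.height + 2
  | sym _ e => e.height + 1
  | ren _ e => e.height

/-- Add counter `i` to counter `j`, and clear counter `i`. -/
def Frag.move (i j : ℕ) : Frag α β B := .loop i ((Frag.dec i).seq (.inc j))

/-- Set counter `i` to zero. -/
def Frag.clear (i : ℕ) : Frag α β B := .loop i (.dec i)

/-- The program that adds the value of an expression to the counter `o`. The value of variable `i`
is in counter `r i`, and the counters from `f` on are free. -/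
def Expr.compile [DecidableEq α] [Inhabited α] : Expr α → (ℕ → ℕ) → ℕ → ℕ → Frag α β B
  | one, _, _, o => .inc o
  | len, _, _, o => (Frag.scan o).seq .rewind
  | var i, r, f, o =>
    (Frag.loop (r i) ((Frag.dec (r i)).seq ((Frag.inc f).seq (.inc o)))).seq (.move f (r i))
  | add e e', r, f, o => (e.compile r f o).seq (e'.compile r f o)
  | sub e e', r, f, o => (e.compile r (f + 2) f).seq ((e'.compile r (f + 2) (f + 1)).seq
      ((Frag.loop (f + 1) ((Frag.dec (f + 1)).seq (.dec f))).seq (.move f o)))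
  | sum e e', r, f, o => (e.compile r (f + 2) f).seq
      ((Frag.loop f ((Frag.dec f).seq ((e'.compile (consEnv (f + 1) r) (f + 2) o).seq
        (.inc (f + 1))))).seq (.clear (f + 1)))
  | sym a e, r, f, o => (e.compile r (f + 1) f).seq ((Frag.loop f ((Frag.dec f).seq .fwd)).seq
      ((Frag.ifSym a (.inc o)).seq .rewind))
  | ren σ e, r, f, o => e.compile (fun i => r (σ i)) f o

/-- The state with other counter values. -/
def St.wr (s : St α β) (ρ : ℕ → ℕ) : St α β := { s with reg := ρ }

theorem Frag.Runs.inc_wr {i : ℕ} (hi : i ≤ B) (s : St α β) {ρ ρ' : ℕ → ℕ}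
    (h : ρ' = Function.update ρ i (ρ i + 1)) :
    (Frag.inc i : Frag α β B).Runs (s.wr ρ) (s.wr ρ') 1 := by
  subst h
  exact Frag.Runs.inc hi (s.wr ρ)

theorem Frag.Runs.dec_wr {i : ℕ} (hi : i ≤ B) (s : St α β) {ρ ρ' : ℕ → ℕ}
    (h : ρ' = Function.update ρ i (ρ i - 1)) :
    (Frag.dec i : Frag α β B).Runs (s.wr ρ) (s.wr ρ') 1 := by
  subst h
  exact Frag.Runs.dec hi (s.wr ρ)

/-- A loop that counts `i` down to zero. -/
theorem Frag.Runs.countdown {i : ℕ} (hi : i ≤ B) {F : Frag α β B} (n : ℕ) (s : ℕ → St α β)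
    (t : ℕ) (hs : ∀ j ≤ n, (s j).reg i = n - j) (hF : ∀ j < n, F.Runs (s j) (s (j + 1)) t) :
    (F.loop i).Runs (s 0) (s n) (n * (t + 1) + 1) :=
  .loop hi n s t (by simp [hs]) (fun j hj => by rw [hs j hj.le]; omega) hF

theorem Frag.Runs.move {i j : ℕ} (hi : i ≤ B) (hj : j ≤ B) (hij : i ≠ j) (s : St α β)
    {ρ ρ' : ℕ → ℕ} (h : ρ' = Function.update (Function.update ρ j (ρ j + ρ i)) i 0) :
    (Frag.move i j : Frag α β B).Runs (s.wr ρ) (s.wr ρ') (ρ i * 3 + 1) := by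
  have := Frag.Runs.countdown (i := i) hi (F := (Frag.dec i).seq (.inc j)) (ρ i)
    (fun k => s.wr (Function.update (Function.update ρ j (ρ j + k)) i (ρ i - k))) 2
    (fun k hk => by simp [St.wr]) (fun k hk => by
      refine (Frag.Runs.dec_wr hi s rfl).seq (Frag.Runs.inc_wr hj s ?_)
      funext l
      grind)
  subst h
  simpa [Frag.move] using this

theorem Frag.Runs.clear {i : ℕ} (hi : i ≤ B) (s : St α β) {ρ ρ' : ℕ → ℕ}
    (h : ρ' = Function.update ρ i 0) :
    (Frag.clear i : Frag α β B).Runs (s.wr ρ) (s.wr ρ') (ρ i * 2 + 1) := by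
  have := Frag.Runs.countdown (i := i) hi (F := Frag.dec i) (ρ i)
    (fun k => s.wr (Function.update ρ i (ρ i - k))) 1 (fun k hk => by simp [St.wr])
    (fun k hk => Frag.Runs.dec_wr hi s (by funext l; grind))
  subst h
  simpa [Frag.clear] using this

theorem St.fwd_iterate (s : St α β) (n : ℕ) (hs : s.pre = []) :
    St.fwd^[n] s = { s with pre := (s.suf.take n).reverse, suf := s.suf.drop n } := by
  obtain ⟨reg, pre, suf, acc, out⟩ := s
  obtain rfl : pre = [] := hs
  induction n with
  | zero => simp
  | succ n ih =>
    rw [Function.iterate_succ_apply', ih]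
    by_cases h : n < suf.length
    · simp only [St.fwd]
      rw [List.drop_eq_getElem_cons h, List.take_succ_eq_append_getElem h, List.reverse_append]
      rfl
    · have h1 : suf.drop n = [] := List.drop_eq_nil_of_le (by omega)
      have h2 : suf.drop (n + 1) = [] := List.drop_eq_nil_of_le (by omega)
      have h3 : suf.take n = suf := List.take_of_length_le (by omega)
      have h4 : suf.take (n + 1) = suf := List.take_of_length_le (by omega)
      simp [St.fwd, h1, h2, h3, h4]

/-- The program for an expression adds its value to the counter `o`, in at most `t` steps, and
changes nothing else. -/
def Expr.CompilesIn [DecidableEq α] [Inhabited α] (β : Type) (w : List α) (e : Expr α)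
    (ρ : ℕ → ℕ) (t : ℕ) : Prop :=
  ∀ (B : ℕ) (s : St α β) (c : ℕ → ℕ) (r : ℕ → ℕ) (f o : ℕ), s.pre = [] → s.suf = w →
    (∀ i, r i < f ∧ r i ≠ o ∧ c (r i) = ρ i) → o < f → (∀ j, f ≤ j → c j = 0) →
    f + e.height ≤ B →
    (e.compile r f o : Frag α β B).Runs (s.wr c)
      (s.wr (Function.update c o (c o + e.eval w ρ))) t

section

variable [DecidableEq α] [Inhabited α] {w : List α} {ρ : ℕ → ℕ} {e e' : Expr α} {t t' : ℕ}

theorem Expr.CompilesIn.one : (Expr.one : Expr α).CompilesIn β w ρ 1 := by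
  intro B s c r f o hpre hsuf hr ho hf hB
  exact Frag.Runs.inc_wr (by omega) s rfl

theorem Expr.CompilesIn.len :
    (Expr.len : Expr α).CompilesIn β w ρ (w.length + 1 + (w.length + 1)) := by
  intro B s c r f o hpre hsuf hr ho hf hB
  have h := (Frag.Runs.scan (B := B) (i := o) (by omega) (s.wr c)).seq (Frag.Runs.rewind _)
  simpa [St.set, St.wr, hpre, hsuf, Expr.eval, Expr.compile] using h

/-- A counter can be read only by emptying it. It is counted down while two copies are made, in `o`
and in the scratch counter `f` (4 steps per unit), and `f` is then moved back (3 steps per unit). -/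
theorem Expr.CompilesIn.var (i : ℕ) :
    (Expr.var i : Expr α).CompilesIn β w ρ (ρ i * 7 + 2) := by
  intro B s c r f o hpre hsuf hr ho hf hB
  simp only [Expr.height] at hB
  obtain ⟨h1, h2, h3⟩ := hr i
  have hf0 := hf f le_rfl
  have := Frag.Runs.countdown (i := r i) (B := B) (by omega)
    (F := (Frag.dec (r i)).seq ((Frag.inc f).seq (.inc o))) (c (r i))
    (fun k => s.wr (Function.update (Function.update (Function.update c o (c o + k)) f k) (r i)
      (c (r i) - k))) 3
    (fun k hk => by simp [St.wr]) (fun k hk => by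
      refine (Frag.Runs.dec_wr (by omega) s rfl).seq ((Frag.Runs.inc_wr (by omega) s rfl).seq
        (Frag.Runs.inc_wr (by omega) s ?_))
      funext l
      grind)
  have h0 : (Function.update (Function.update (Function.update c o (c o + 0)) f 0) (r i)
      (c (r i) - 0)) = c := by
    funext l
    grind
  simp only [h0] at this
  refine (this.seq (Frag.Runs.move (by omega) (by omega) (by omega) s ?_)).mono ?_
  · funext l
    simp only [Expr.eval]
    grind
  · have : f ≠ r i := by omega
    simp only [ne_eq, this, not_false_eq_true, Function.update_of_ne, Function.update_self, h3]
    omega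

theorem Expr.CompilesIn.add (h : e.CompilesIn β w ρ t) (h' : e'.CompilesIn β w ρ t') :
    (Expr.add e e').CompilesIn β w ρ (t + t') := by
  intro B s c r f o hpre hsuf hr ho hf hB
  simp only [Expr.height] at hB
  have h1 := h B s c r f o hpre hsuf hr ho hf (by omega)
  have h2 := h' B s (Function.update c o (c o + e.eval w ρ)) r f o hpre hsuf
    (fun i => by grind) ho (fun j hj => by grind) (by omega)
  refine h1.seq ?_
  convert h2 using 2
  funext l
  simp only [Expr.eval]
  grind

/-- Decrementing an empty counter does nothing, so counting down `f + 1` while decrementing `f`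
computes exactly the truncated difference. -/
theorem Expr.CompilesIn.sub (h : e.CompilesIn β w ρ t) (h' : e'.CompilesIn β w ρ t') :
    (Expr.sub e e').CompilesIn β w ρ
      (t + (t' + ((e'.eval w ρ * 3 + 1) + (e.eval w ρ * 3 + 1)))) := by
  intro B s c r f o hpre hsuf hr ho hf hB
  simp only [Expr.height] at hB
  have hf0 := hf f le_rfl
  have hf1 := hf (f + 1) (by omega)
  have h1 := h B s c r (f + 2) f hpre hsuf (fun i => by grind) (by omega)
    (fun j hj => hf j (by omega)) (by omega)
  have h2 := h' B s (Function.update c f (c f + e.eval w ρ)) r (f + 2) (f + 1) hpre hsuf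
    (fun i => by grind) (by omega) (fun j hj => by grind) (by omega)
  set x := e.eval w ρ
  set y := e'.eval w ρ
  have h3 := Frag.Runs.countdown (i := f + 1) (B := B) (by omega)
    (F := (Frag.dec (f + 1)).seq (.dec f)) y
    (fun k => s.wr (Function.update (Function.update c f (x - k)) (f + 1) (y - k))) 2
    (fun k hk => by simp [St.wr]) (fun k hk => by
      refine (Frag.Runs.dec_wr (by omega) s rfl).seq (Frag.Runs.dec_wr (by omega) s ?_)
      funext l
      grind)
  have e1 : Function.update (Function.update c f (c f + x)) (f + 1)
      (Function.update c f (c f + x) (f + 1) + y) =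
      Function.update (Function.update c f (x - 0)) (f + 1) (y - 0) := by
    funext l
    grind
  rw [e1] at h2
  refine (h1.seq (h2.seq (h3.seq (Frag.Runs.move (by omega) (by omega) (by omega) s ?_)))).mono ?_
  · funext l
    simp only [Expr.eval]
    grind
  · simp

/-- Counter `f` holds the number of remaining rounds and `f + 1` the current index, which the body
sees as its innermost variable; scratch space for the body starts at `f + 2`. -/
theorem Expr.CompilesIn.sum (h : e.CompilesIn β w ρ t)
    (h' : ∀ i < e.eval w ρ, e'.CompilesIn β w (consEnv i ρ) t') :
    (Expr.sum e e').CompilesIn β w ρ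
      (t + ((e.eval w ρ * ((1 + (t' + 1)) + 1) + 1) + (e.eval w ρ * 2 + 1))) := by
  intro B s c r f o hpre hsuf hr ho hf hB
  simp only [Expr.height] at hB
  have hf0 := hf f le_rfl
  have hf1 := hf (f + 1) (by omega)
  have h1 := h B s c r (f + 2) f hpre hsuf (fun i => by grind) (by omega)
    (fun j hj => hf j (by omega)) (by omega)
  set x := e.eval w ρ
  have h3 := Frag.Runs.countdown (i := f) (B := B) (by omega)
    (F := (Frag.dec f).seq ((e'.compile (consEnv (f + 1) r) (f + 2) o).seq (.inc (f + 1)))) x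
    (fun k => s.wr (Function.update (Function.update (Function.update c o
      (c o + ∑ i ∈ Finset.range k, e'.eval w (consEnv i ρ))) (f + 1) k) f (x - k)))
    (1 + (t' + 1))
    (fun k hk => by simp [St.wr]) (fun k hk => by
      refine (Frag.Runs.dec_wr (by omega) s rfl).seq ((h' k hk B s _ (consEnv (f + 1) r) (f + 2) o
        hpre hsuf ?_ (by omega) ?_ (by omega)).seq (Frag.Runs.inc_wr (by omega) s ?_))
      · rintro (_ | i)
        · simp only [consEnv]
          grind
        · simp only [consEnv]
          grind
      · intro j hj
        grind
      · funext l
        rw [Finset.sum_range_succ]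
        grind)
  have e1 : Function.update c f (c f + x) =
      Function.update (Function.update (Function.update c o
        (c o + ∑ i ∈ Finset.range 0, e'.eval w (consEnv i ρ))) (f + 1) 0) f (x - 0) := by
    funext l
    rw [Finset.sum_range_zero]
    grind
  rw [e1] at h1
  refine (h1.seq (h3.seq (Frag.Runs.clear (by omega) s ?_))).mono ?_
  · funext l
    simp only [Expr.eval]
    grind
  · simp

/-- The reading head is advanced as often as the position says, the next symbol is tested, and the
input is rewound. Beyond the end `St.fwd` does nothing and the test fails, as it does for `w[x]? =
none`. -/
theorem Expr.CompilesIn.sym (a : α) (h : e.CompilesIn β w ρ t) :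
    (Expr.sym a e).CompilesIn β w ρ
      (t + ((e.eval w ρ * (2 + 1) + 1) + (2 + (w.length + 1)))) := by
  intro B s c r f o hpre hsuf hr ho hf hB
  simp only [Expr.height] at hB
  have hf0 := hf f le_rfl
  have h1 := h B s c r (f + 1) f hpre hsuf (fun i => by grind) (by omega)
    (fun j hj => hf j (by omega)) (by omega)
  set x := e.eval w ρ with hx
  have hfw : ∀ (s : St α β) c, (s.wr c).fwd = s.fwd.wr c := by
    rintro ⟨reg, pre, suf, acc, out⟩ c
    cases suf <;> rfl
  have h3 := Frag.Runs.countdown (i := f) (B := B) (by omega)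
    (F := (Frag.dec f).seq .fwd) x
    (fun k => (St.fwd^[k] s).wr (Function.update c f (x - k))) 2
    (fun k hk => by simp [St.wr]) (fun k hk => by
      refine (Frag.Runs.dec_wr (i := f) (by omega) _ rfl).seq (t' := 1) ?_
      convert Frag.Runs.fwd _ using 1
      rw [hfw, ← Function.iterate_succ_apply' St.fwd]
      congr 1
      funext l
      grind)
  have e1 : Function.update c f (c f + x) = Function.update c f (x - 0) := by
    funext l
    grind
  have e2 : Function.update c f (x - x) = c := by
    funext l
    grind
  rw [e1] at h1
  simp only [e2] at h3
  refine h1.seq (h3.seq ?_)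
  have h4 := Frag.Runs.rewind (B := B) ((St.fwd^[x] s).wr
    (Function.update c o (c o + (Expr.sym a e).eval w ρ)))
  have e3 : ({ ((St.fwd^[x] s).wr (Function.update c o (c o + (Expr.sym a e).eval w ρ))) with
      pre := [],
      suf := ((St.fwd^[x] s).wr (Function.update c o (c o + (Expr.sym a e).eval w ρ))).pre.reverse
        ++ ((St.fwd^[x] s).wr (Function.update c o (c o + (Expr.sym a e).eval w ρ))).suf } :
        St α β) = s.wr (Function.update c o (c o + (Expr.sym a e).eval w ρ)) := by
    rw [St.fwd_iterate s x hpre]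
    simp [St.wr, hpre]
  rw [e3] at h4
  refine Frag.Runs.mono (Frag.Runs.seq (t := 2) ?_ h4) ?_
  · have hh : ((St.fwd^[x] s).wr c).suf.head? = w[x]? := by
      rw [St.fwd_iterate s x hpre]
      simp [St.wr, hsuf]
    by_cases hw : w[x]? = some a
    · refine Frag.Runs.ifSym_pos (hh.trans hw) (Frag.Runs.inc_wr (by omega) _ ?_)
      simp [Expr.eval, ← hx, hw]
    -- The failing test takes one step; it is padded to the two steps of the other branch so that
    -- one bound covers both.
    · convert (Frag.Runs.ifSym_neg (Frag.inc o) (B := B) (by rw [hh]; exact hw)).mono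
        (Nat.le_succ 1) using 2
      simp [Expr.eval, ← hx, hw]
  · rw [St.fwd_iterate s x hpre]
    simp [St.wr, hsuf]

theorem Expr.CompilesIn.ren (σ : ℕ → ℕ) (h : e.CompilesIn β w (fun i => ρ (σ i)) t) :
    (Expr.ren σ e).CompilesIn β w ρ t := by
  intro B s c r f o hpre hsuf hr ho hf hB
  exact h B s c (fun i => r (σ i)) f o hpre hsuf (fun i => hr (σ i)) ho hf hB

theorem Expr.CompilesIn.mono (h : e.CompilesIn β w ρ t) (ht : t ≤ t') :
    e.CompilesIn β w ρ t' := fun B s c r f o h1 h2 h3 h4 h5 h6 =>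
  (h B s c r f o h1 h2 h3 h4 h5 h6).mono ht

end

end Language

end GameSym

namespace GameSym

open Computability Turing

/-! ### Polynomial bounds, and programs that generate words -/

section Generators

variable {α β : Type} {B : ℕ}

theorem pow_bound_mono {n a d : ℕ} (h : a ≤ d) : (n + 2) ^ a ≤ (n + 2) ^ d :=
  Nat.pow_le_pow_right (by omega) h

/-- The factor 16 absorbs the constants and lower-order terms in the costs of the constructors; it
is paid for by `2 ^ 4 ≤ (n + 2) ^ 4`. -/
theorem pow_bound_sq (n d : ℕ) : 16 * ((n + 2) ^ d * (n + 2) ^ d) ≤ (n + 2) ^ (2 * d + 4) := by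
  have h : 2 ^ 4 ≤ (n + 2) ^ 4 := Nat.pow_le_pow_left (by omega) 4
  calc 16 * ((n + 2) ^ d * (n + 2) ^ d) ≤ (n + 2) ^ 4 * ((n + 2) ^ d * (n + 2) ^ d) :=
        Nat.mul_le_mul_right _ h
    _ = (n + 2) ^ (2 * d + 4) := by ring

theorem le_pow_bound (n d : ℕ) : n + 2 ≤ (n + 2) ^ (d + 1) :=
  Nat.le_self_pow (by omega) _

/-- Composition of bounds: a summation index can be as large as the upper limit, so the bound for
the body is used with a power of `n + 2` in place of `n`. -/
theorem pow_bound_comp (n a b : ℕ) :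
    ((n + 2) ^ (a + 1) + 2) ^ b ≤ (n + 2) ^ ((a + 2) * b) := by
  rw [pow_mul]
  refine Nat.pow_le_pow_left ?_ b
  have := le_pow_bound n a
  calc (n + 2) ^ (a + 1) + 2 ≤ (n + 2) ^ (a + 1) + (n + 2) ^ (a + 1) := by omega
    _ = (n + 2) ^ (a + 1) * 2 := by ring
    _ ≤ (n + 2) ^ (a + 1) * (n + 2) := Nat.mul_le_mul_left _ (by omega)
    _ = (n + 2) ^ (a + 2) := by ring

theorem consEnv_le {n m i : ℕ} {ρ : ℕ → ℕ} (h : ∀ j, ρ j ≤ n) (hn : n ≤ m) (hi : i ≤ m) :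
    ∀ j, consEnv i ρ j ≤ m
  | 0 => hi
  | j + 1 => (h j).trans hn

/-- Every expression is evaluated in polynomial time. -/
theorem Expr.poly [DecidableEq α] [Inhabited α] (β : Type) (e : Expr α) :
    ∃ c, ∀ (w : List α) (ρ : ℕ → ℕ) (n : ℕ), w.length ≤ n → (∀ i, ρ i ≤ n) →
      e.eval w ρ ≤ (n + 2) ^ c ∧ e.CompilesIn β w ρ ((n + 2) ^ c) := by
  induction e with
  | one => exact ⟨0, fun w ρ n hw hρ => ⟨by simp [Expr.eval], .mono .one (by simp)⟩⟩
  | len =>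
    refine ⟨2 * 1 + 4, fun w ρ n hw hρ => ?_⟩
    have h2 := pow_bound_sq n 1
    exact ⟨by simp only [Expr.eval]; nlinarith, .mono .len (by nlinarith)⟩
  | var i =>
    refine ⟨2 * 1 + 4, fun w ρ n hw hρ => ?_⟩
    have h1 := hρ i
    have h2 := pow_bound_sq n 1
    exact ⟨by simp only [Expr.eval]; nlinarith, .mono (.var i) (by nlinarith)⟩
  | add e e' ih ih' =>
    obtain ⟨a, ih⟩ := ih
    obtain ⟨b, ih'⟩ := ih'
    refine ⟨2 * max a b + 4, fun w ρ n hw hρ => ?_⟩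
    obtain ⟨h1, h2⟩ := ih w ρ n hw hρ
    obtain ⟨h1', h2'⟩ := ih' w ρ n hw hρ
    have h3 := pow_bound_mono (n := n) (le_max_left a b)
    have h4 := pow_bound_mono (n := n) (le_max_right a b)
    have h5 := pow_bound_sq n (max a b)
    have h6 := Nat.one_le_pow (max a b) (n + 2) (by omega)
    set P := (n + 2) ^ max a b
    have h7 : P ≤ P * P := Nat.le_mul_of_pos_left _ h6
    exact ⟨by simp only [Expr.eval]; omega, (h2.add h2').mono (by omega)⟩
  | sub e e' ih ih' =>
    obtain ⟨a, ih⟩ := ih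
    obtain ⟨b, ih'⟩ := ih'
    refine ⟨2 * max a b + 4, fun w ρ n hw hρ => ?_⟩
    obtain ⟨h1, h2⟩ := ih w ρ n hw hρ
    obtain ⟨h1', h2'⟩ := ih' w ρ n hw hρ
    have h3 := pow_bound_mono (n := n) (le_max_left a b)
    have h4 := pow_bound_mono (n := n) (le_max_right a b)
    have h5 := pow_bound_sq n (max a b)
    have h6 := Nat.one_le_pow (max a b) (n + 2) (by omega)
    set P := (n + 2) ^ max a b
    have h7 : P ≤ P * P := Nat.le_mul_of_pos_left _ h6
    exact ⟨by simp only [Expr.eval]; omega, (h2.sub h2').mono (by omega)⟩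
  | sum e e' ih ih' =>
    obtain ⟨a, ih⟩ := ih
    obtain ⟨b, ih'⟩ := ih'
    -- The exponent `a + 1` covers the upper limit, and `(a + 2) * b` covers the body evaluated in
    -- the enlarged environment.
    set d := max (a + 1) ((a + 2) * b) with hd
    refine ⟨2 * d + 4, fun w ρ n hw hρ => ?_⟩
    obtain ⟨h1, h2⟩ := ih w ρ n hw hρ
    have hn := le_pow_bound n a
    have ha := pow_bound_mono (n := n) (show a ≤ a + 1 by omega)
    have ih' := fun i (hi : i < e.eval w ρ) => ih' w (consEnv i ρ) ((n + 2) ^ (a + 1)) (by omega)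
      (consEnv_le hρ (by omega) (by omega))
    have h3 := pow_bound_mono (n := n) (le_max_left (a + 1) ((a + 2) * b))
    have h4 := pow_bound_mono (n := n) (le_max_right (a + 1) ((a + 2) * b))
    rw [← hd] at h3 h4
    have h5 := pow_bound_sq n d
    have h6 := Nat.one_le_pow d (n + 2) (by omega)
    have h8 := pow_bound_comp n a b
    set P := (n + 2) ^ d
    have h7 : P ≤ P * P := Nat.le_mul_of_pos_left _ h6
    have h9 : e.eval w ρ ≤ P := by omega
    have h10 : ((n + 2) ^ (a + 1) + 2) ^ b ≤ P := by omega
    refine ⟨?_, (h2.sum fun i hi => (ih' i hi).2.mono h10).mono ?_⟩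
    · simp only [Expr.eval]
      calc ∑ i ∈ Finset.range (e.eval w ρ), e'.eval w (consEnv i ρ)
          ≤ ∑ i ∈ Finset.range (e.eval w ρ), P :=
            Finset.sum_le_sum fun i hi => (ih' i (Finset.mem_range.1 hi)).1.trans h10
        _ = e.eval w ρ * P := by simp
        _ ≤ P * P := Nat.mul_le_mul_right _ h9
        _ ≤ _ := by omega
    · have h11 : e.eval w ρ * P ≤ P * P := Nat.mul_le_mul_right _ h9
      have h12 : e.eval w ρ * (1 + (P + 1) + 1) = e.eval w ρ * P + 3 * e.eval w ρ := by ring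
      omega
  | sym a e ih =>
    obtain ⟨a, ih⟩ := ih
    refine ⟨2 * (a + 1) + 4, fun w ρ n hw hρ => ?_⟩
    obtain ⟨h1, h2⟩ := ih w ρ n hw hρ
    have hn := le_pow_bound n a
    have ha := pow_bound_mono (n := n) (show a ≤ a + 1 by omega)
    have h5 := pow_bound_sq n (a + 1)
    have h6 := Nat.one_le_pow (a + 1) (n + 2) (by omega)
    set P := (n + 2) ^ (a + 1)
    have h7 : P ≤ P * P := Nat.le_mul_of_pos_left _ h6
    refine ⟨?_, (h2.sym _).mono (by omega)⟩
    simp only [Expr.eval]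
    split_ifs <;> omega
  | ren σ e ih =>
    obtain ⟨a, ih⟩ := ih
    refine ⟨a, fun w ρ n hw hρ => ?_⟩
    obtain ⟨h1, h2⟩ := ih w (fun i => ρ (σ i)) n hw fun i => hρ (σ i)
    exact ⟨h1, h2.ren σ⟩

/-- Programs that generate words. -/
inductive Gen (α β : Type) : Type
  | nil
  | emit (b : β)
  | app (g g' : Gen α β)
  | rep (e : Expr α) (g : Gen α β)
  | ren (σ : ℕ → ℕ) (g : Gen α β)

/-- The word generated by a program. -/
def Gen.eval [DecidableEq α] (w : List α) : Gen α β → (ℕ → ℕ) → List β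
  | nil, _ => []
  | emit b, _ => [b]
  | app g g', ρ => g.eval w ρ ++ g'.eval w ρ
  | rep e g, ρ => (List.range (e.eval w ρ)).flatMap fun i => g.eval w (consEnv i ρ)
  | ren σ g, ρ => g.eval w fun i => ρ (σ i)

/-- The number of auxiliary counters used by a compiled program. -/
def Gen.height : Gen α β → ℕ
  | nil => 0
  | emit _ => 0
  | app g g' => max g.height g'.height
  | rep e g => max e.height g.height + 2
  | ren _ g => g.height

/-- The fragment that appends the generated word to the output. -/
def Gen.compile [DecidableEq α] [Inhabited α] : Gen α β → (ℕ → ℕ) → ℕ → Frag α β B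
  | nil, _, _ => .skip
  | emit b, _, _ => .emit b
  | app g g', r, f => (g.compile r f).seq (g'.compile r f)
  | rep e g, r, f => (e.compile r (f + 2) f).seq
      ((Frag.loop f ((Frag.dec f).seq ((g.compile (consEnv (f + 1) r) (f + 2)).seq
        (.inc (f + 1))))).seq (.clear (f + 1)))
  | ren σ g, r, f => g.compile (fun i => r (σ i)) f

/-- The state with another output. -/
def St.wa (s : St α β) (a : List β) : St α β := { s with acc := a }

/-- The fragment for a program appends the generated word to the output, in at most `t` steps,
and changes nothing else. -/
def Gen.CompilesIn [DecidableEq α] [Inhabited α] (w : List α) (g : Gen α β)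
    (ρ : ℕ → ℕ) (t : ℕ) : Prop :=
  ∀ (B : ℕ) (s : St α β) (c : ℕ → ℕ) (r : ℕ → ℕ) (f : ℕ), s.pre = [] → s.suf = w →
    (∀ i, r i < f ∧ c (r i) = ρ i) → (∀ j, f ≤ j → c j = 0) → f + g.height ≤ B →
    (g.compile r f : Frag α β B).Runs (s.wr c)
      ((s.wa ((g.eval w ρ).reverse ++ s.acc)).wr c) t

theorem Gen.CompilesIn.mono [DecidableEq α] [Inhabited α] {w : List α} {g : Gen α β} {ρ : ℕ → ℕ}
    {t t' : ℕ} (h : g.CompilesIn w ρ t) (ht : t ≤ t') :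
    g.CompilesIn w ρ t' := fun B s c r f h1 h2 h3 h4 h5 =>
  (h B s c r f h1 h2 h3 h4 h5).mono ht

/-- Same loop as for sums, with the output stack in place of the counter `o`: `f` counts rounds down
and `f + 1` holds the index. -/
theorem Gen.CompilesIn.rep [DecidableEq α] [Inhabited α] {w : List α} {e : Expr α} {g : Gen α β}
    {ρ : ℕ → ℕ} {t t' : ℕ} (h : e.CompilesIn β w ρ t)
    (h' : ∀ i < e.eval w ρ, g.CompilesIn w (consEnv i ρ) t') :
    (Gen.rep e g).CompilesIn w ρ
      (t + ((e.eval w ρ * ((1 + (t' + 1)) + 1) + 1) + (e.eval w ρ * 2 + 1))) := by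
  intro B s c r f hpre hsuf hr hf hB
  simp only [Gen.height] at hB
  have hf0 := hf f le_rfl
  have hf1 := hf (f + 1) (by omega)
  have h1 := h B s c r (f + 2) f hpre hsuf (fun i => by grind) (by omega)
    (fun j hj => hf j (by omega)) (by omega)
  set x := e.eval w ρ with hx
  have h3 := Frag.Runs.countdown (i := f) (B := B) (by omega)
    (F := (Frag.dec f).seq ((g.compile (consEnv (f + 1) r) (f + 2)).seq (.inc (f + 1)))) x
    (fun k => (s.wa (((List.range k).flatMap fun i => g.eval w (consEnv i ρ)).reverse ++ s.acc)).wr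
      (Function.update (Function.update c (f + 1) k) f (x - k)))
    (1 + (t' + 1))
    (fun k hk => by simp [St.wr]) (fun k hk => by
      refine (Frag.Runs.dec_wr (i := f) (by omega) _ rfl).seq
        (Frag.Runs.seq (h' k hk B _ _ (consEnv (f + 1) r) (f + 2) hpre hsuf ?_ ?_ (by omega)) ?_)
      · rintro (_ | i)
        · simp only [consEnv]
          grind
        · simp only [consEnv]
          grind
      · intro j hj
        grind
      -- The output list is generalized, so that the counters and the associativity of the appended
      -- words are treated separately.
      · have : ∀ l : List β, l = (g.eval w (consEnv k ρ)).reverse ++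
            (((List.range k).flatMap fun i => g.eval w (consEnv i ρ)).reverse ++ s.acc) →
            (Frag.inc (f + 1) : Frag α β B).Runs ((s.wa ((g.eval w (consEnv k ρ)).reverse ++
            (((List.range k).flatMap fun i => g.eval w (consEnv i ρ)).reverse ++ s.acc))).wr
            (Function.update (Function.update (Function.update c (f + 1) k) f (x - k)) f
            (Function.update (Function.update c (f + 1) k) f (x - k) f - 1)))
            ((s.wa l).wr (Function.update (Function.update c (f + 1) (k + 1)) f (x - (k + 1)))) 1
            := by
          rintro l rfl
          refine Frag.Runs.inc_wr (by omega) _ ?_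
          funext l
          grind
        refine this _ ?_
        rw [List.range_succ]
        simp)
  have e1 : Function.update c f (c f + x) =
      Function.update (Function.update c (f + 1) 0) f (x - 0) := by
    funext l
    grind
  rw [e1] at h1
  refine (h1.seq (h3.seq (Frag.Runs.clear (by omega) _ ?_))).mono ?_
  · funext l
    grind
  · simp

/-- Every program runs in polynomial time. -/
theorem Gen.poly [DecidableEq α] [Inhabited α] (g : Gen α β) :
    ∃ c, ∀ (w : List α) (ρ : ℕ → ℕ) (n : ℕ), w.length ≤ n → (∀ i, ρ i ≤ n) →
      (g.eval w ρ).length ≤ (n + 2) ^ c ∧ g.CompilesIn w ρ ((n + 2) ^ c) := by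
  induction g with
  | nil =>
    exact ⟨0, fun w ρ n hw hρ => ⟨by simp [Gen.eval], .mono (t := 1)
      (fun B s c r f _ _ _ _ _ => Frag.Runs.skip _) (by simp)⟩⟩
  | emit b =>
    exact ⟨0, fun w ρ n hw hρ => ⟨by simp [Gen.eval], .mono (t := 1)
      (fun B s c r f _ _ _ _ _ => Frag.Runs.emit _ _) (by simp)⟩⟩
  | app g g' ih ih' =>
    obtain ⟨a, ih⟩ := ih
    obtain ⟨b, ih'⟩ := ih'
    refine ⟨2 * max a b + 4, fun w ρ n hw hρ => ?_⟩
    obtain ⟨h1, h2⟩ := ih w ρ n hw hρ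
    obtain ⟨h1', h2'⟩ := ih' w ρ n hw hρ
    have h3 := pow_bound_mono (n := n) (le_max_left a b)
    have h4 := pow_bound_mono (n := n) (le_max_right a b)
    have h5 := pow_bound_sq n (max a b)
    have h6 := Nat.one_le_pow (max a b) (n + 2) (by omega)
    set P := (n + 2) ^ max a b
    have h7 : P ≤ P * P := Nat.le_mul_of_pos_left _ h6
    refine ⟨by simp only [Gen.eval, List.length_append]; omega, ?_⟩
    refine Gen.CompilesIn.mono (t := (n + 2) ^ a + (n + 2) ^ b) ?_ (by omega)
    intro B s c r f hpre hsuf hr hf hB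
    simp only [Gen.height] at hB
    refine (h2 B s c r f hpre hsuf hr hf (by omega)).seq ?_
    have := h2' B (s.wa ((g.eval w ρ).reverse ++ s.acc)) c r f hpre hsuf hr hf (by omega)
    simpa [Gen.eval, St.wa] using this
  | rep e g ih' =>
    obtain ⟨a, ih⟩ := e.poly β
    obtain ⟨b, ih'⟩ := ih'
    set d := max (a + 1) ((a + 2) * b) with hd
    refine ⟨2 * d + 4, fun w ρ n hw hρ => ?_⟩
    obtain ⟨h1, h2⟩ := ih w ρ n hw hρ
    have hn := le_pow_bound n a
    have ha := pow_bound_mono (n := n) (show a ≤ a + 1 by omega)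
    have ih' := fun i (hi : i < e.eval w ρ) => ih' w (consEnv i ρ) ((n + 2) ^ (a + 1)) (by omega)
      (consEnv_le hρ (by omega) (by omega))
    have h3 := pow_bound_mono (n := n) (le_max_left (a + 1) ((a + 2) * b))
    have h4 := pow_bound_mono (n := n) (le_max_right (a + 1) ((a + 2) * b))
    rw [← hd] at h3 h4
    have h5 := pow_bound_sq n d
    have h6 := Nat.one_le_pow d (n + 2) (by omega)
    have h8 := pow_bound_comp n a b
    set P := (n + 2) ^ d
    have h7 : P ≤ P * P := Nat.le_mul_of_pos_left _ h6
    have h9 : e.eval w ρ ≤ P := by omega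
    have h10 : ((n + 2) ^ (a + 1) + 2) ^ b ≤ P := by omega
    refine ⟨?_, (Gen.CompilesIn.rep h2 fun i hi => (ih' i hi).2.mono h10).mono ?_⟩
    · simp only [Gen.eval, List.length_flatMap]
      calc ((List.range (e.eval w ρ)).map fun i => (g.eval w (consEnv i ρ)).length).sum
          ≤ ((List.range (e.eval w ρ)).map fun i => P).sum :=
            List.sum_le_sum fun i hi => (ih' i (List.mem_range.1 hi)).1.trans h10
        _ = e.eval w ρ * P := by simp
        _ ≤ P * P := Nat.mul_le_mul_right _ h9
        _ ≤ _ := by omega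
    · have h11 : e.eval w ρ * P ≤ P * P := Nat.mul_le_mul_right _ h9
      have h12 : e.eval w ρ * (1 + (P + 1) + 1) = e.eval w ρ * P + 3 * e.eval w ρ := by ring
      omega

  | ren σ g ih =>
    obtain ⟨a, ih⟩ := ih
    refine ⟨a, fun w ρ n hw hρ => ?_⟩
    obtain ⟨h1, h2⟩ := ih w (fun i => ρ (σ i)) n hw fun i => hρ (σ i)
    exact ⟨h1, fun B s c r f hpre hsuf hr hf hB =>
      h2 B s c (fun i => r (σ i)) f hpre hsuf (fun i => hr (σ i)) hf hB⟩

/-- A function between words that is given by a program is computable in polynomial time. -/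
theorem Gen.computable [DecidableEq α] [Inhabited α] [Inhabited β] [Fintype α] [Fintype β]
    (g : Gen α β) {X Y : Type} (ea : X → List α) (eb : Y → List β) (f : X → Y)
    (h : ∀ x, g.eval (ea x) (fun _ => 0) = eb (f x)) :
    Nonempty (TM2ComputableInPolyTime ea eb f) := by
  obtain ⟨c, hc⟩ := g.poly
  -- All variables are read from counter 0, which stays zero, and scratch counters start at 1.
  -- Afterwards the input is erased; the output was collected in reverse, and flushing it restores
  -- the order.
  set F : Frag α β (1 + g.height) := (g.compile (fun _ => 0) 1).seq (Frag.drop.seq Frag.flush)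
  have key : ∀ x, Nonempty (TM2OutputsInTime F.machine (ea x) (some (eb (f x)))
      (((Polynomial.X + 2) ^ c + (Polynomial.X + 1 + ((Polynomial.X + 2) ^ c + 1)) + 1 :
        Polynomial ℕ).eval (ea x).length)) := by
    intro x
    obtain ⟨h1, h2⟩ := hc (ea x) (fun _ => 0) _ le_rfl (fun _ => Nat.zero_le _)
    have h3 := h2 (1 + g.height) (St.init (ea x)) (fun _ => 0) (fun _ => 0) 1 rfl rfl
      (fun i => ⟨one_pos, rfl⟩) (fun _ _ => rfl) le_rfl
    have h4 := h3.seq ((Frag.Runs.drop _).seq (Frag.Runs.flush _))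
    have h5 : F.Runs (St.init (ea x)) (St.final (eb (f x))) (((ea x).length + 2) ^ c +
        ((ea x).length + 1 + (((ea x).length + 2) ^ c + 1))) := by
      refine Frag.Runs.mono ?_ (t := ((ea x).length + 2) ^ c +
        ((ea x).length + 1 + ((g.eval (ea x) (fun _ => 0)).length + 1))) (by omega)
      simpa [St.wr, St.wa, St.init, St.final, h] using h4
    simpa using F.machine_outputs h5
  refine ⟨⟨⟨F.machine, Equiv.refl _, Equiv.refl _⟩,
    (Polynomial.X + 2) ^ c + (Polynomial.X + 1 + ((Polynomial.X + 2) ^ c + 1)) + 1, fun x => ?_⟩⟩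
  have hα : (ea x).map (Equiv.refl α).invFun = ea x := List.map_id _
  have hβ : (eb (f x)).map (Equiv.refl β).invFun = eb (f x) := List.map_id _
  have : ∀ a b, a = ea x → b = eb (f x) → Nonempty (TM2OutputsInTime F.machine a (some b)
      (((Polynomial.X + 2) ^ c + (Polynomial.X + 1 + ((Polynomial.X + 2) ^ c + 1)) + 1 :
        Polynomial ℕ).eval (ea x).length)) := by
    rintro a b rfl rfl
    exact key x
  exact (this _ _ hα hβ).some

end Generators

end GameSym

namespace GameSym

open Computability Turing

/-! ### Functions definable by programs -/

section Definable

/-- A context: a word together with finitely many natural numbers. -/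
class Ctx (α : outParam Type) (X : Type) where
  inp : X → List α
  env : X → ℕ → ℕ

instance (α : Type) : Ctx α (List α) := ⟨id, fun _ _ => 0⟩

instance (α X : Type) [Ctx α X] : Ctx α (X × ℕ) :=
  ⟨fun p => Ctx.inp p.1, fun p => consEnv p.2 (Ctx.env p.1)⟩

open Ctx (inp)

variable {α β X Y : Type} [DecidableEq α] [Ctx α X]

/-- Number-valued functions definable by expressions. -/
def PF (f : X → ℕ) : Prop := ∃ e : Expr α, ∀ x, e.eval (inp x) (Ctx.env x) = f x

/-- Definable predicates. -/
def PP (p : X → Prop) : Prop := ∃ f : X → ℕ, PF f ∧ ∀ x, p x ↔ f x ≠ 0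

/-- Word-valued functions definable by programs. -/
def PG (g : X → List β) : Prop := ∃ e : Gen α β, ∀ x, e.eval (inp x) (Ctx.env x) = g x

theorem PF.congr {f g : X → ℕ} (hf : PF f) (h : ∀ x, g x = f x) : PF g := by
  obtain rfl : g = f := funext h
  exact hf

theorem PP.congr {p q : X → Prop} (hp : PP p) (h : ∀ x, q x ↔ p x) : PP q := by
  obtain rfl : q = p := funext fun x => propext (h x)
  exact hp

theorem PG.congr {f g : X → List β} (hf : PG f) (h : ∀ x, g x = f x) : PG g := by
  obtain rfl : g = f := funext h
  exact hf

theorem PF.add {f g : X → ℕ} (hf : PF f) (hg : PF g) : PF fun x => f x + g x := by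
  obtain ⟨e, he⟩ := hf
  obtain ⟨e', he'⟩ := hg
  exact ⟨.add e e', fun x => by simp only [Expr.eval, he, he']⟩

theorem PF.sub {f g : X → ℕ} (hf : PF f) (hg : PF g) : PF fun x => f x - g x := by
  obtain ⟨e, he⟩ := hf
  obtain ⟨e', he'⟩ := hg
  exact ⟨.sub e e', fun x => by simp only [Expr.eval, he, he']⟩

theorem PF.sum {b : X → ℕ} {f : X → ℕ → ℕ} (hb : PF b) (hf : PF fun y : X × ℕ => f y.1 y.2) :
    PF fun x => ∑ i ∈ Finset.range (b x), f x i := by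
  obtain ⟨e, he⟩ := hb
  obtain ⟨e', he'⟩ := hf
  exact ⟨.sum e e', fun x => by
    simp only [Expr.eval, he]
    exact Finset.sum_congr rfl fun i _ => he' (x, i)⟩

theorem PF.const (n : ℕ) : PF fun _ : X => n := by
  induction n with
  | zero => exact ⟨.sub .one .one, fun x => by simp [Expr.eval]⟩
  | succ n ih => exact ih.add ⟨.one, fun x => rfl⟩

theorem PF.fst {f : X → ℕ} (hf : PF f) : PF fun y : X × ℕ => f y.1 := by
  obtain ⟨e, he⟩ := hf
  exact ⟨.ren (· + 1) e, fun x => he x.1⟩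

theorem PF.snd : PF fun y : X × ℕ => y.2 := ⟨.var 0, fun _ => rfl⟩

theorem PF.mul {f g : X → ℕ} (hf : PF f) (hg : PF g) : PF fun x => f x * g x :=
  (hf.sum (f := fun x _ => g x) hg.fst).congr fun x => by simp

theorem PP.lt {f g : X → ℕ} (hf : PF f) (hg : PF g) : PP fun x => f x < g x :=
  ⟨_, hg.sub hf, fun x => by omega⟩

theorem PP.not {p : X → Prop} (hp : PP p) : PP fun x => ¬p x := by
  obtain ⟨f, hf, h⟩ := hp
  exact ⟨_, (PF.const 1).sub hf, fun x => by simp only [h]; omega⟩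

theorem PP.and {p q : X → Prop} (hp : PP p) (hq : PP q) : PP fun x => p x ∧ q x := by
  obtain ⟨f, hf, h⟩ := hp
  obtain ⟨g, hg, h'⟩ := hq
  exact ⟨_, hf.mul hg, fun x => by simp [h, h']⟩

theorem PP.or {p q : X → Prop} (hp : PP p) (hq : PP q) : PP fun x => p x ∨ q x := by
  obtain ⟨f, hf, h⟩ := hp
  obtain ⟨g, hg, h'⟩ := hq
  exact ⟨_, hf.add hg, fun x => by simp only [h, h']; omega⟩

theorem PP.le {f g : X → ℕ} (hf : PF f) (hg : PF g) : PP fun x => f x ≤ g x :=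
  (PP.lt hg hf).not.congr fun x => by omega

theorem PP.eq {f g : X → ℕ} (hf : PF f) (hg : PF g) : PP fun x => f x = g x :=
  ((PP.le hf hg).and (PP.le hg hf)).congr fun x => by omega

theorem PP.ne {f g : X → ℕ} (hf : PF f) (hg : PF g) : PP fun x => f x ≠ g x := (PP.eq hf hg).not

/-- A bounded existential quantifier is the nonvanishing of a bounded sum of natural numbers. -/
theorem PP.ex {b : X → ℕ} {p : X → ℕ → Prop} (hb : PF b) (hp : PP fun y : X × ℕ => p y.1 y.2) :
    PP fun x => ∃ i < b x, p x i := by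
  obtain ⟨f, hf, h⟩ := hp
  refine ⟨_, hb.sum (f := fun x i => f (x, i)) hf, fun x => ?_⟩
  rw [Ne, Finset.sum_eq_zero_iff]
  push Not
  exact exists_congr fun i => and_congr (by simp) (h (x, i))

theorem PP.const (c : Prop) : PP fun _ : X => c := by
  by_cases h : c
  · exact ⟨_, PF.const 1, fun x => by simp [h]⟩
  · exact ⟨_, PF.const 0, fun x => by simp [h]⟩

theorem PF.ite {p : X → Prop} [DecidablePred p] {f g : X → ℕ} (hp : PP p) (hf : PF f)
    (hg : PF g) : PF fun x => if p x then f x else g x := by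
  obtain ⟨h, hh, e⟩ := hp
  -- With truncated subtraction, `1 - (1 - h)` and `1 - h` are the 0/1 indicators of the condition
  -- and of its negation.
  refine ((((PF.const 1).sub ((PF.const 1).sub hh)).mul hf).add
    (((PF.const 1).sub hh).mul hg)).congr fun x => ?_
  split_ifs with hx
  · have := (e x).1 hx
    have h1 : 1 - h x = 0 := by omega
    simp [h1]
  · have : h x = 0 := by by_contra h; exact hx ((e x).2 h)
    simp [this]

theorem PG.nil : PG fun _ : X => ([] : List β) := ⟨.nil, fun _ => rfl⟩

theorem PG.append {f g : X → List β} (hf : PG f) (hg : PG g) : PG fun x => f x ++ g x := by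
  obtain ⟨e, he⟩ := hf
  obtain ⟨e', he'⟩ := hg
  exact ⟨.app e e', fun x => by simp only [Gen.eval, he, he']⟩

theorem PG.const (l : List β) : PG fun _ : X => l := by
  induction l with
  | nil => exact .nil
  | cons b l ih => exact PG.append (f := fun _ => [b]) ⟨.emit b, fun _ => rfl⟩ ih

theorem PG.flatMap {b : X → ℕ} {g : X → ℕ → List β} (hb : PF b)
    (hg : PG fun y : X × ℕ => g y.1 y.2) : PG fun x => (List.range (b x)).flatMap (g x) := by
  obtain ⟨e, he⟩ := hb
  obtain ⟨e', he'⟩ := hg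
  refine ⟨.rep e e', fun x => ?_⟩
  simp only [Gen.eval, he]
  congr 1
  funext i
  exact he' (x, i)

theorem PG.fst {g : X → List β} (hg : PG g) : PG fun y : X × ℕ => g y.1 := by
  obtain ⟨e, he⟩ := hg
  exact ⟨.ren (· + 1) e, fun y => he y.1⟩

/-- The language has no branching; each alternative is repeated once or not at all. -/
theorem PG.ite {p : X → Prop} [DecidablePred p] {f g : X → List β} (hp : PP p) (hf : PG f)
    (hg : PG g) : PG fun x => if p x then f x else g x := by
  refine (PG.append (PG.flatMap (g := fun x _ => f x) (PF.ite hp (PF.const 1) (PF.const 0)) hf.fst)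
    (PG.flatMap (g := fun x _ => g x) (PF.ite hp (PF.const 0) (PF.const 1)) hg.fst)).congr
    fun x => ?_
  split_ifs <;> simp

theorem PG.map {γ : Type} (h : β → γ) {g : X → List β} (hg : PG g) :
    PG fun x => (g x).map h := by
  obtain ⟨e, he⟩ := hg
  suffices ∃ e' : Gen α γ, ∀ w ρ, e'.eval w ρ = (e.eval w ρ).map h by
    obtain ⟨e', he'⟩ := this
    exact ⟨e', fun x => by rw [he', he]⟩
  clear he
  induction e with
  | nil => exact ⟨.nil, fun _ _ => rfl⟩
  | emit b => exact ⟨.emit (h b), fun _ _ => rfl⟩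
  | app g g' ih ih' =>
    obtain ⟨a, ha⟩ := ih
    obtain ⟨b, hb⟩ := ih'
    exact ⟨.app a b, fun _ _ => by simp only [Gen.eval, ha, hb, List.map_append]⟩
  | rep e g ih =>
    obtain ⟨a, ha⟩ := ih
    exact ⟨.rep e a, fun _ _ => by simp only [Gen.eval, ha, List.map_flatMap]⟩
  | ren σ g ih =>
    obtain ⟨a, ha⟩ := ih
    exact ⟨.ren σ a, fun _ _ => by simp only [Gen.eval, ha]⟩

/-- A definable function between words is computable in polynomial time. -/
theorem PG.computable [Inhabited α] [Inhabited β] [Fintype α] [Fintype β] {F : List α → List β}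
    (hF : PG F) {X Y : Type} (ea : X → List α) (eb : Y → List β) (f : X → Y)
    (h : ∀ x, F (ea x) = eb (f x)) : Nonempty (TM2ComputableInPolyTime ea eb f) := by
  obtain ⟨g, hg⟩ := hF
  exact g.computable ea eb f fun x => (hg (ea x)).trans (h x)

/-! ### Definable lists -/

/-- A word that depends definably on the context: its length and its entries are definable. -/
def PL (l : X → List α) : Prop :=
  PF (fun x => (l x).length) ∧ ∀ a, PP fun y : X × ℕ => (l y.1)[y.2]? = some a

theorem PL.length {l : X → List α} (hl : PL l) : PF fun x => (l x).length := hl.1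

/-- `PL` only provides the entry test at a fresh variable, and expressions have no substitution.
Both are circumvented by a bounded search for an index `i` with `i = f x`. -/
theorem PL.get {l : X → List α} (hl : PL l) {f : X → ℕ} (hf : PF f) (a : α) :
    PP fun x => (l x)[f x]? = some a :=
  (PP.ex hl.1 (p := fun x i => i = f x ∧ (l x)[i]? = some a)
    ((PP.eq PF.snd hf.fst).and (hl.2 a))).congr fun x => by
      constructor
      · intro h
        have := (List.getElem?_eq_some_iff.1 h).1
        exact ⟨_, this, rfl, h⟩
      · rintro ⟨i, _, rfl, h⟩
        exact h

theorem PL.fst {l : X → List α} (hl : PL l) : PL fun y : X × ℕ => l y.1 := by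
  refine ⟨hl.1.fst, fun a => ?_⟩
  obtain ⟨f, ⟨e, he⟩, h⟩ := hl.2 a
  -- The renaming keeps the index as innermost variable and skips variable 1, which is the newly
  -- inserted one.
  refine ⟨fun y => f (y.1.1, y.2), ⟨.ren (fun i => if i = 0 then 0 else i + 1) e, fun y => ?_⟩,
    fun y => h (y.1.1, y.2)⟩
  refine Eq.trans ?_ (he (y.1.1, y.2))
  simp only [Expr.eval]
  congr 1
  funext i
  cases i <;> rfl

theorem PL.inp : PL fun x : X => inp x := by
  refine ⟨⟨.len, fun _ => rfl⟩, fun a => ⟨_, ⟨.sym a (.var 0), fun _ => rfl⟩, fun y => ?_⟩⟩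
  simp only [Expr.eval, Ctx.inp, Ctx.env, consEnv]
  split_ifs with h <;> simp [h]

end Definable

end GameSym

namespace GameSym

open Computability Turing

/-! ### Splitting words at separators, definably -/

section Blocks

variable {α X : Type} [DecidableEq α]

/-- Block number `i` of a word in which every block is followed by the separator `c`. -/
def blk (c : α) : List α → ℕ → List α
  | [], _ => []
  | a :: l, 0 => if a = c then [] else a :: blk c l 0
  | a :: l, i + 1 => if a = c then blk c l i else blk c l (i + 1)

/-- The number of separators before position `q`. -/
def sepCount (c : α) (l : List α) (q : ℕ) : ℕ :=
  ∑ j ∈ Finset.range q, if l[j]? = some c then 1 else 0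

theorem sepCount_zero (c : α) (l : List α) : sepCount c l 0 = 0 := rfl

theorem sepCount_cons (c a : α) (l : List α) (q : ℕ) :
    sepCount c (a :: l) (q + 1) = sepCount c l q + if a = c then 1 else 0 := by
  simp only [sepCount, Finset.sum_range_succ', List.getElem?_cons_succ, List.getElem?_cons_zero,
    Option.some.injEq]

theorem sepCount_length (c : α) (l : List α) : sepCount c l l.length = l.count c := by
  induction l with
  | nil => rfl
  | cons a l ih =>
    rw [List.length_cons, sepCount_cons, ih, List.count_cons]
    simp

/-- The number of occurrences of a symbol. -/
def symCount (c : α) (l : List α) : ℕ := sepCount c l l.length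

theorem symCount_eq (c : α) (l : List α) : symCount c l = l.count c := sepCount_length c l

theorem symCount_append (c : α) (l l' : List α) :
    symCount c (l ++ l') = symCount c l + symCount c l' := by
  rw [symCount_eq, symCount_eq, symCount_eq, List.count_append]

theorem symCount_map {δ : Type} [DecidableEq δ] {h : α → δ} (hh : Function.Injective h) (c : α)
    (l : List α) : symCount (h c) (l.map h) = symCount c l := by
  rw [symCount_eq, symCount_eq, List.count_map_of_injective _ _ hh]

theorem symCount_eq_zero {c : α} {l : List α} (h : c ∉ l) : symCount c l = 0 := by
  rw [symCount_eq, List.count_eq_zero_of_not_mem h]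

/-- The separator that closes a block has the same separator count as the block, but comes after all
its entries. Hence the positions `j < q` with count `i` are exactly the earlier entries of the
block, and their number is the index `t`. The right-hand side uses only symbol tests and bounded
sums, which is what `PL.blk` needs. -/
theorem blk_getElem? (c : α) (l : List α) (i t : ℕ) (a : α) :
    (blk c l i)[t]? = some a ↔ ∃ q < l.length, (l[q]? = some a ∧ a ≠ c) ∧ sepCount c l q = i ∧
      (∑ j ∈ Finset.range q, if sepCount c l j = i then 1 else 0) = t := by
  induction l generalizing i t with
  | nil => simp [blk]
  | cons b l ih =>
    -- The first symbol is split off: either it is the entry in question, or the position lies in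
    -- the tail, where the counts are shifted by its contribution.
    have key : (∃ q < (b :: l).length, ((b :: l)[q]? = some a ∧ a ≠ c) ∧
        sepCount c (b :: l) q = i ∧
        (∑ j ∈ Finset.range q, if sepCount c (b :: l) j = i then 1 else 0) = t) ↔
        (b = a ∧ a ≠ c ∧ i = 0 ∧ t = 0) ∨
        ∃ q < l.length, (l[q]? = some a ∧ a ≠ c) ∧
          (sepCount c l q + if b = c then 1 else 0) = i ∧
          (∑ j ∈ Finset.range q, if (sepCount c l j + if b = c then 1 else 0) = i then 1 else 0) +
            (if i = 0 then 1 else 0) = t := by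
      constructor
      · rintro ⟨_ | q, hq, h1, h2, h3⟩
        · left
          simp only [sepCount_zero, Finset.range_zero, Finset.sum_empty] at h2 h3
          exact ⟨by simpa using h1.1, h1.2, h2.symm, h3.symm⟩
        · right
          rw [sepCount_cons] at h2
          rw [Finset.sum_range_succ'] at h3
          simp only [sepCount_cons, sepCount_zero] at h3
          refine ⟨q, by simpa using hq, by simpa using h1, h2, ?_⟩
          rw [← h3]
          congr 1
          exact if_congr eq_comm rfl rfl
      · rintro (⟨rfl, h1, rfl, rfl⟩ | ⟨q, hq, h1, h2, h3⟩)
        · exact ⟨0, by simp, ⟨rfl, h1⟩, rfl, rfl⟩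
        · refine ⟨q + 1, by simpa using hq, by simpa using h1, by rw [sepCount_cons, h2], ?_⟩
          rw [Finset.sum_range_succ', ← h3]
          simp only [sepCount_cons, sepCount_zero]
          congr 1
          exact if_congr eq_comm rfl rfl
    rw [key]
    by_cases hb : b = c
    · subst hb
      cases i with
      | zero =>
        simp only [blk, if_true]
        constructor
        · simp
        · rintro (⟨rfl, h, -⟩ | ⟨q, -, -, h, -⟩)
          · exact absurd rfl h
          · simp at h
      | succ i =>
        simp only [blk, if_true, ih]
        simp
    · cases i with
      | zero =>
        simp only [blk, hb, if_false]
        cases t with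
        | zero =>
          simp only [List.getElem?_cons_zero, Option.some.injEq]
          constructor
          · rintro rfl
            simp [hb]
          · rintro (⟨rfl, -⟩ | ⟨q, -, -, -, h⟩)
            · rfl
            · simp at h
        | succ t =>
          rw [List.getElem?_cons_succ, ih]
          simp
      | succ i =>
        simp only [blk, hb, if_false, ih]
        simp

theorem blk_length (c : α) (l : List α) (i : ℕ) :
    (blk c l i).length = ∑ q ∈ Finset.range l.length,
      if l[q]? ≠ some c ∧ sepCount c l q = i then 1 else 0 := by
  induction l generalizing i with
  | nil => simp [blk]
  | cons b l ih =>
    rw [List.length_cons, Finset.sum_range_succ']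
    simp only [sepCount_cons, sepCount_zero, List.getElem?_cons_succ, List.getElem?_cons_zero]
    by_cases hb : b = c
    · subst hb
      cases i with
      | zero => simp [blk]
      | succ i => simp [blk, ih]
    · cases i with
      | zero => simp [blk, hb, ih]
      | succ i => simp [blk, hb, ih]

theorem blk_append_zero (c : α) {l : List α} (hl : c ∉ l) (t : List α) :
    blk c (l ++ c :: t) 0 = l := by
  induction l with
  | nil => simp [blk]
  | cons a l ih =>
    have h1 : a ≠ c := fun h => hl (by simp [h])
    have h2 : c ∉ l := fun h => hl (by simp [h])
    simp [blk, h1, ih h2]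

theorem blk_append_succ (c : α) {l : List α} (hl : c ∉ l) (t : List α) (i : ℕ) :
    blk c (l ++ c :: t) (i + 1) = blk c t i := by
  induction l with
  | nil => simp [blk]
  | cons a l ih =>
    have h1 : a ≠ c := fun h => hl (by simp [h])
    have h2 : c ∉ l := fun h => hl (by simp [h])
    simp [blk, h1, ih h2]

theorem blk_flatMap {Y : Type} (c : α) (f : Y → List α) (hf : ∀ y, c ∉ f y) (l : List Y)
    (t : List α) (i : ℕ) :
    blk c (l.flatMap (fun y => f y ++ [c]) ++ t) i =
      if h : i < l.length then f l[i] else blk c t (i - l.length) := by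
  induction l generalizing i with
  | nil => simp
  | cons y l ih =>
    simp only [List.flatMap_cons, List.append_assoc, List.cons_append,
      List.nil_append]
    cases i with
    | zero => simpa using blk_append_zero c (hf y) _
    | succ i =>
      rw [blk_append_succ c (hf y), ih]
      simp

variable [Ctx α X]

theorem PF.sepCount {l : X → List α} (hl : PL l) (c : α) {q : X → ℕ} (hq : PF q) :
    PF fun x => sepCount c (l x) (q x) :=
  PF.sum (f := fun x j => if (l x)[j]? = some c then 1 else 0) hq
    (PF.ite (hl.fst.get PF.snd c) (PF.const 1) (PF.const 0))

theorem PF.symCount {l : X → List α} (hl : PL l) (c : α) : PF fun x => symCount c (l x) :=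
  PF.sepCount hl c hl.length

/-- A block of a definable word is again a definable word, so splitting can be nested: rows first,
then the fields of a row. -/
theorem PL.blk {l : X → List α} (hl : PL l) (c : α) {i : X → ℕ} (hi : PF i) :
    PL fun x => blk c (l x) (i x) := by
  constructor
  · refine PF.congr (PF.sum (f := fun x q =>
      if (l x)[q]? ≠ some c ∧ GameSym.sepCount c (l x) q = i x then 1 else 0) hl.length ?_)
      fun x => blk_length _ _ _
    refine PF.ite (PP.and ?_ ?_) (PF.const 1) (PF.const 0)
    · exact (hl.fst.get PF.snd c).not
    · exact PP.eq (PF.sepCount hl.fst c PF.snd) hi.fst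
  · intro a
    refine PP.congr (PP.ex (p := fun y q => ((l y.1)[q]? = some a ∧ a ≠ c) ∧
      GameSym.sepCount c (l y.1) q = i y.1 ∧
      (∑ j ∈ Finset.range q, if GameSym.sepCount c (l y.1) j = i y.1 then 1 else 0) = y.2)
      hl.length.fst ?_) fun y => blk_getElem? _ _ _ _ _
    refine PP.and (PP.and ?_ (PP.const _)) (PP.and ?_ (PP.eq ?_ ?_))
    · exact hl.fst.fst.get PF.snd a
    · exact PP.eq (PF.sepCount hl.fst.fst c PF.snd) hi.fst.fst
    · refine PF.sum PF.snd ?_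
      refine PF.ite (PP.eq ?_ ?_) (PF.const 1) (PF.const 0)
      · exact PF.sepCount hl.fst.fst.fst c PF.snd
      · exact hi.fst.fst.fst
    · exact PF.snd.fst

theorem PL.drop {l : X → List α} (hl : PL l) {n : X → ℕ} (hn : PF n) :
    PL fun x => (l x).drop (n x) :=
  ⟨(hl.length.sub hn).congr fun x => List.length_drop, fun a =>
    (hl.fst.get (hn.fst.add PF.snd) a).congr fun y => by rw [List.getElem?_drop]⟩

end Blocks

end GameSym

namespace GameSym

open Computability Turing

/-! ### From graph isomorphism to zero-sum games -/

section GraphToGame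

/-- The adjacency relation of a graph, on natural numbers. -/
def FinGraph.AdjN (G : FinGraph) (i j : ℕ) : Prop :=
  ∃ (hi : i < G.n) (hj : j < G.n), G.graph.Adj ⟨i, hi⟩ ⟨j, hj⟩

open Classical in
/-- A block diagonal payoff matrix: the first block describes one graph, and the second block
describes another graph, with the opposite sign. -/
noncomputable def swapPayoff (n₁ n₂ : ℕ) (A₁ A₂ : ℕ → ℕ → Prop) (a b : ℕ) : ℚ :=
  if a < n₁ ∧ b < n₁ then
    if a = b then 3 else if A₁ a b then 2 else 1
  else if (n₁ ≤ a ∧ a < n₁ + n₂) ∧ n₁ ≤ b ∧ b < n₁ + n₂ then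
    if a = b then -3 else if A₂ (a - n₁) (b - n₁) then -2 else -1
  else 0

theorem swapPayoff_eq_three {n₁ n₂ : ℕ} {A₁ A₂ : ℕ → ℕ → Prop} {a b : ℕ} :
    swapPayoff n₁ n₂ A₁ A₂ a b = 3 ↔ a < n₁ ∧ b = a := by
  unfold swapPayoff
  split_ifs <;> norm_num <;> omega

theorem swapPayoff_eq_neg_three {n₁ n₂ : ℕ} {A₁ A₂ : ℕ → ℕ → Prop} {a b : ℕ} :
    swapPayoff n₁ n₂ A₁ A₂ a b = -3 ↔ (n₁ ≤ a ∧ a < n₁ + n₂) ∧ b = a := by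
  unfold swapPayoff
  split_ifs <;> norm_num <;> omega

theorem swapPayoff_eq_two {n₁ n₂ : ℕ} {A₁ A₂ : ℕ → ℕ → Prop} {a b : ℕ} :
    swapPayoff n₁ n₂ A₁ A₂ a b = 2 ↔ (a < n₁ ∧ b < n₁) ∧ a ≠ b ∧ A₁ a b := by
  unfold swapPayoff
  split_ifs <;> norm_num <;> tauto

theorem swapPayoff_eq_neg_two {n₁ n₂ : ℕ} {A₁ A₂ : ℕ → ℕ → Prop} {a b : ℕ} :
    swapPayoff n₁ n₂ A₁ A₂ a b = -2 ↔
      ((n₁ ≤ a ∧ a < n₁ + n₂) ∧ n₁ ≤ b ∧ b < n₁ + n₂) ∧ a ≠ b ∧ A₂ (a - n₁) (b - n₁) := by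
  unfold swapPayoff
  split_ifs <;> norm_num <;> first | tauto | omega

/-- The zero-sum game associated with a pair of graphs. -/
noncomputable def swapGame (G : FinGraph × FinGraph) : Game where
  N := 2
  m _ := G.1.n + G.2.n + 1
  m_pos _ := Nat.succ_pos _
  u i a := if i = 0 then swapPayoff G.1.n G.2.n G.1.AdjN G.2.AdjN (a 0) (a 1)
    else -swapPayoff G.1.n G.2.n G.1.AdjN G.2.AdjN (a 0) (a 1)

theorem swapGame_zeroSum (G : FinGraph × FinGraph) : (swapGame G).IsTwoPlayerZeroSum := by
  refine ⟨rfl, fun a => ?_⟩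
  change ∑ i : Fin 2, _ = _
  rw [Fin.sum_univ_two]
  simp [swapGame]

/-- The player permutation must be the transposition, so the symmetry consists of bijections `f` and
`g` between the two action sets, and invariance reads `v a b = -v (g b) (f a)`. The isomorphism is
the restriction of `f` to the first block, shifted down by the number of vertices of the first
graph. -/
theorem iso_of_swapGame_symmetry {G : FinGraph × FinGraph} (S : (swapGame G).Symmetry)
    (hS : ¬S.PlayerSeparable) : Nonempty (G.1.graph ≃g G.2.graph) := by
  obtain ⟨φ, π, hφ, hu⟩ := S
  set M := G.1.n + G.2.n + 1 with hM
  change Equiv.Perm (Σ _ : Fin 2, Fin M) at φ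
  change Equiv.Perm (Fin 2) at π
  have hπ0 : π 0 = 1 := by
    by_contra h
    refine hS (?_ : π = 1)
    have h0 : π 0 = 0 := by omega
    have h1 : π 1 ≠ π 0 := fun e => absurd (π.injective e) (by decide)
    ext i
    fin_cases i
    · simp [h0]
    · have : π 1 = 1 := by omega
      simp [this]
  have hπ1 : π 1 = 0 := by
    have h1 : π 1 ≠ π 0 := fun e => absurd (π.injective e) (by decide)
    omega
  have hs0 : π.symm 0 = 1 := by rw [Equiv.symm_apply_eq, hπ1]
  have hs1 : π.symm 1 = 0 := by rw [Equiv.symm_apply_eq, hπ0]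
  set f : Fin M → Fin M := fun a => (φ ⟨0, a⟩).2 with hf
  set g : Fin M → Fin M := fun b => (φ ⟨1, b⟩).2 with hg
  have hf' : ∀ a, φ ⟨0, a⟩ = ⟨1, f a⟩ := fun a =>
    Sigma.ext ((hφ (⟨(0 : Fin 2), a⟩ : Σ _ : Fin 2, Fin M)).trans hπ0) HEq.rfl
  have hg' : ∀ b, φ ⟨1, b⟩ = ⟨0, g b⟩ := fun b =>
    Sigma.ext ((hφ (⟨(1 : Fin 2), b⟩ : Σ _ : Fin 2, Fin M)).trans hπ1) HEq.rfl
  have hfi : Function.Injective f := fun a a' h => by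
    have : φ ⟨0, a⟩ = φ ⟨0, a'⟩ := by rw [hf', hf', h]
    simpa using φ.injective this
  have hgi : Function.Injective g := fun a a' h => by
    have : φ ⟨1, a⟩ = φ ⟨1, a'⟩ := by rw [hg', hg', h]
    simpa using φ.injective this
  have hfs := Finite.surjective_of_injective hfi
  have hgs := Finite.surjective_of_injective hgi
  set v := swapPayoff G.1.n G.2.n G.1.AdjN G.2.AdjN with hv
  have key : ∀ a b : Fin M, v a b = -v (g b) (f a) := by
    intro a b
    have h := hu (0 : Fin 2) (![a, b] : Fin 2 → Fin M)
    have e : ∀ i j : Fin 2, π.symm j = i →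
        ((φ ⟨π.symm j, (![a, b] : Fin 2 → Fin M) (π.symm j)⟩).2 : ℕ) =
          ((φ ⟨i, (![a, b] : Fin 2 → Fin M) i⟩).2 : ℕ) := by
      rintro i j rfl
      rfl
    change v a b = if π 0 = 0 then _ else - v _ _ at h
    rw [if_neg (by rw [hπ0]; decide)] at h
    rw [h]
    congr 2
    · exact e 1 0 hs0
    · exact e 0 1 hs1
  -- The value -3 occurs only on the diagonal of the second block, so the image of a diagonal
  -- position of the first block lies there; in particular `g a = f a`.
  have hlt : ∀ a : Fin M, (a : ℕ) < G.1.n →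
      (G.1.n ≤ f a ∧ (f a : ℕ) < G.1.n + G.2.n) ∧ g a = f a := by
    intro a ha
    have h1 : v a a = 3 := swapPayoff_eq_three.2 ⟨ha, rfl⟩
    have h2 : v (g a) (f a) = -3 := by
      have := key a a
      linarith
    obtain ⟨h3, h4⟩ := swapPayoff_eq_neg_three.1 h2
    rw [h4]
    exact ⟨h3, Fin.ext h4.symm⟩
  have hM1 : ∀ i : Fin G.1.n, (i : ℕ) < M := fun i => by omega
  set F : Fin G.1.n → Fin G.2.n := fun i => ⟨f ⟨i, hM1 i⟩ - G.1.n, by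
    have := (hlt ⟨i, hM1 i⟩ i.2).1
    omega⟩ with hF
  have hFv : ∀ i : Fin G.1.n, (f ⟨i, hM1 i⟩ : ℕ) = G.1.n + F i := fun i => by
    have := (hlt ⟨i, hM1 i⟩ i.2).1
    simp only [hF]
    omega
  have hFi : Function.Injective F := fun i j h => by
    have : f ⟨i, hM1 i⟩ = f ⟨j, hM1 j⟩ := Fin.ext (by rw [hFv, hFv, h])
    have := hfi this
    exact Fin.ext (by simpa using this)
  -- A diagonal position of the second block is pulled back along `f` and `g` separately; its payoff
  -- -3 becomes 3, which occurs only on the diagonal of the first block.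
  have hFs : Function.Surjective F := fun c => by
    obtain ⟨a, ha⟩ := hfs ⟨G.1.n + c, by omega⟩
    obtain ⟨b, hb⟩ := hgs ⟨G.1.n + c, by omega⟩
    have h1 : v (g b) (f a) = -3 := by
      rw [ha, hb]
      exact swapPayoff_eq_neg_three.2 ⟨by simp, rfl⟩
    have h2 : v a b = 3 := by rw [key, h1]; norm_num
    obtain ⟨h3, -⟩ := swapPayoff_eq_three.1 h2
    refine ⟨⟨a, h3⟩, Fin.ext ?_⟩
    have := hFv ⟨a, h3⟩
    simp only [ha] at this
    omega
  refine ⟨⟨Equiv.ofBijective F ⟨hFi, hFs⟩, fun {i j} => ?_⟩⟩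
  change G.2.graph.Adj (F i) (F j) ↔ G.1.graph.Adj i j
  have hij := key ⟨i, hM1 i⟩ ⟨j, hM1 j⟩
  -- The two vertices appear in transposed order on the right, which is harmless because adjacency
  -- is symmetric.
  rw [(hlt ⟨j, hM1 j⟩ j.2).2, hFv, hFv] at hij
  simp only at hij
  constructor
  · intro h
    have h1 : v (G.1.n + F j) (G.1.n + F i) = -2 := swapPayoff_eq_neg_two.2
      ⟨by omega, fun e => h.ne (Fin.ext (by omega)), by simpa using ⟨(F j).2, (F i).2, h.symm⟩⟩
    rw [h1, neg_neg] at hij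
    obtain ⟨_, _, _, _, h3⟩ := swapPayoff_eq_two.1 hij
    exact h3
  · intro h
    have h1 : v i j = 2 := swapPayoff_eq_two.2
      ⟨⟨i.2, j.2⟩, fun e => h.ne (Fin.ext e), i.2, j.2, h⟩
    rw [h1] at hij
    have h2 : v (G.1.n + F j) (G.1.n + F i) = -2 := by linarith
    obtain ⟨-, -, h3⟩ := swapPayoff_eq_neg_two.1 h2
    simp only [Nat.add_sub_cancel_left] at h3
    obtain ⟨_, _, h3⟩ := h3
    exact h3.symm

/-- The involution `t` exchanges the two blocks along `e` and `e.symm` and fixes the extra action;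
both players use it, combined with the exchange of the players. The extra action is there only to
keep the action sets nonempty for empty graphs. -/
theorem swapGame_symmetry_of_iso {G : FinGraph × FinGraph} (e : G.1.graph ≃g G.2.graph) :
    ∃ S : (swapGame G).Symmetry, ¬S.PlayerSeparable := by
  obtain ⟨⟨n, G₁⟩, ⟨n', G₂⟩⟩ := G
  obtain rfl : n = n' := by simpa using Fintype.card_congr e.toEquiv
  change G₁ ≃g G₂ at e
  set M := n + n + 1 with hM
  set t : ℕ → ℕ := fun k => if h : k < n then n + e ⟨k, h⟩ else
    if h : k - n < n then e.symm ⟨k - n, h⟩ else k with ht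
  have ht1 : ∀ k (h : k < n), t k = n + e ⟨k, h⟩ := fun k h => by simp [ht, h]
  have ht2 : ∀ k (h : k < n), t (n + k) = e.symm ⟨k, h⟩ := fun k h => by simp [ht, h]
  have ht3 : ∀ k, n + n ≤ k → t k = k := fun k h => by
    rw [ht]
    simp only
    rw [dif_neg (by omega), dif_neg (by omega)]
  have hcase : ∀ k, k < n ∨ (∃ j, j < n ∧ k = n + j) ∨ n + n ≤ k := fun k => by
    by_cases h : k < n
    · exact .inl h
    · by_cases h' : k < n + n
      · exact .inr (.inl ⟨k - n, by omega, by omega⟩)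
      · exact .inr (.inr (by omega))
  have htt : ∀ k, t (t k) = k := by
    intro k
    rcases hcase k with h | ⟨j, h, rfl⟩ | h
    · rw [ht1 k h, ht2 _ (e ⟨k, h⟩).2]
      simp
    · rw [ht2 j h, ht1 _ (e.symm ⟨j, h⟩).2]
      simp
    · rw [ht3 k h, ht3 k h]
  have htM : ∀ k, k < M → t k < M := by
    intro k hk
    rcases hcase k with h | ⟨j, h, rfl⟩ | h
    · rw [ht1 k h]
      omega
    · rw [ht2 j h]
      omega
    · rw [ht3 k h]
      exact hk
  set τ : Fin M → Fin M := fun a => ⟨t a, htM a a.2⟩ with hτ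
  have hττ : Function.Involutive τ := fun a => Fin.ext (htt a)
  set v := swapPayoff n n (FinGraph.AdjN ⟨n, G₁⟩) (FinGraph.AdjN ⟨n, G₂⟩) with hv
  have hv1 : ∀ i j (hi : i < n) (hj : j < n), v (n + e ⟨j, hj⟩) (n + e ⟨i, hi⟩) = -v i j := by
    intro i j hi hj
    have h1 : ((n + e ⟨j, hj⟩ : ℕ) = n + e ⟨i, hi⟩) ↔ i = j := by
      rw [Nat.add_left_cancel_iff, ← Fin.ext_iff, EmbeddingLike.apply_eq_iff_eq, Fin.mk.injEq,
        eq_comm]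
    have h2 : FinGraph.AdjN ⟨n, G₂⟩ (n + e ⟨j, hj⟩ - n) (n + e ⟨i, hi⟩ - n) ↔
        FinGraph.AdjN ⟨n, G₁⟩ i j := by
      simp only [Nat.add_sub_cancel_left]
      constructor
      · rintro ⟨_, _, h⟩
        exact ⟨hi, hj, (e.map_adj_iff.1 h).symm⟩
      · rintro ⟨_, _, h⟩
        exact ⟨(e ⟨j, hj⟩).2, (e ⟨i, hi⟩).2, e.map_adj_iff.2 h.symm⟩
    rw [hv, swapPayoff, swapPayoff, if_neg (by omega), if_pos (by omega), 
      if_pos (c := i < n ∧ j < n) ⟨hi, hj⟩]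
    simp only [h1, h2]
    split_ifs <;> first | (norm_num; done) | tauto
  have hv2 : ∀ a b, v (t b) (t a) = -v a b := by
    intro a b
    have h0 : ∀ a b, ¬(a < n ∧ b < n) →
        ¬((n ≤ a ∧ a < n + n) ∧ n ≤ b ∧ b < n + n) → v a b = 0 := fun a b h h' => by
      rw [hv, swapPayoff, if_neg h, if_neg h']
    rcases hcase a with ha | ⟨i, ha, rfl⟩ | ha <;> rcases hcase b with hb | ⟨j, hb, rfl⟩ | hb
    · rw [ht1 a ha, ht1 b hb, hv1]
    · rw [ht1 a ha, ht2 j hb, h0 a _ (by omega) (by omega), h0 _ _ (by omega) (by omega), neg_zero]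
    · rw [ht1 a ha, ht3 b hb, h0 a _ (by omega) (by omega), h0 _ _ (by omega) (by omega), neg_zero]
    · rw [ht2 i ha, ht1 b hb, h0 _ b (by omega) (by omega), h0 _ _ (by omega) (by omega), neg_zero]
    · rw [ht2 i ha, ht2 j hb]
      -- For a pair in the second block, `hv1` is applied to its preimages under `e`, with the roles
      -- of the two sides interchanged.
      obtain ⟨p, hp⟩ : ∃ p : Fin n, p = e.symm ⟨j, hb⟩ := ⟨_, rfl⟩
      obtain ⟨q, hq⟩ : ∃ q : Fin n, q = e.symm ⟨i, ha⟩ := ⟨_, rfl⟩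
      have := hv1 p q p.2 q.2
      simp only [Fin.eta] at this
      rw [← hp, ← hq]
      rw [hp, hq] at this
      simp only [RelIso.apply_symm_apply] at this
      rw [← hp, ← hq] at this
      rw [this]
      ring
    · rw [ht2 i ha, ht3 b hb, h0 _ b (by omega) (by omega), h0 _ _ (by omega) (by omega), neg_zero]
    · rw [ht3 a ha, ht1 b hb, h0 _ b (by omega) (by omega), h0 _ _ (by omega) (by omega), neg_zero]
    · rw [ht3 a ha, ht2 j hb, h0 a _ (by omega) (by omega), h0 _ _ (by omega) (by omega), neg_zero]
    · rw [ht3 a ha, ht3 b hb, h0 a _ (by omega) (by omega), h0 _ _ (by omega) (by omega), neg_zero]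
  let φ : Equiv.Perm (Σ _ : Fin 2, Fin M) := Function.Involutive.toPerm
    (fun x => ⟨Equiv.swap 0 1 x.1, τ x.2⟩) (fun x => by simp [hττ x.2])
  refine ⟨⟨φ, Equiv.swap (0 : Fin 2) (1 : Fin 2), fun a => rfl, ?_⟩, fun h => ?_⟩
  · intro i a
    change Fin 2 at i
    change Fin 2 → Fin M at a
    change (if i = 0 then v (a 0) (a 1) else -v (a 0) (a 1)) =
      if Equiv.swap (0 : Fin 2) 1 i = 0 then v (t (a 1)) (t (a 0)) else -v (t (a 1)) (t (a 0))
    fin_cases i <;> simp [hv2]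
  · have h1 : (1 : Fin 2) = 0 := congrArg (fun π : Equiv.Perm (Fin 2) => π 0) h
    exact absurd h1 (by decide)

end GraphToGame

end GameSym

namespace GameSym

open Computability Turing

/-! ### Computing the code of the zero-sum game from the code of the graphs -/

section GraphToGameEncoding

open Ctx (inp)

variable {α β X : Type} [DecidableEq α] [Ctx α X]

theorem map_val_finRange (n : ℕ) : (List.finRange n).map Fin.val = List.range n := by
  apply List.ext_getElem <;> simp

theorem flatMap_finRange (n : ℕ) (f : ℕ → List β) :
    (List.finRange n).flatMap (fun i : Fin n => f i.val) = (List.range n).flatMap f := by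
  rw [← map_val_finRange, List.flatMap_map]

theorem encodeUnary_eq (n : ℕ) :
    encodeUnary n = (List.range n).flatMap (fun _ => [Γ'.bit true]) ++ [Γ'.comma] := by
  have : ∀ n : ℕ, (List.range n).flatMap (fun _ => [Γ'.bit true]) =
      List.replicate n (Γ'.bit true) := by
    intro n
    induction n with
    | zero => rfl
    | succ n ih => rw [List.range_succ, List.flatMap_append, ih, List.replicate_succ']; rfl
  simp [encodeUnary, encodeBits, this]

theorem PG.encodeUnary {f : X → ℕ} (hf : PF f) : PG fun x => encodeUnary (f x) :=
  ((PG.flatMap (g := fun _ _ => [Γ'.bit true]) hf (PG.const _)).append (PG.const _)).congr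
    fun _ => encodeUnary_eq _

theorem PG.encodeRat_ite {p : X → Prop} {_ : DecidablePred p} {f g : X → ℚ} (hp : PP p)
    (hf : PG fun x => encodeRat (f x)) (hg : PG fun x => encodeRat (g x)) :
    PG fun x => encodeRat (if p x then f x else g x) :=
  (PG.ite hp hf hg).congr fun x => by split_ifs <;> rfl

theorem PG.encodeRat_neg_ite {p : X → Prop} {_ : DecidablePred p} {f g : X → ℚ} (hp : PP p)
    (hf : PG fun x => encodeRat (-f x)) (hg : PG fun x => encodeRat (-g x)) :
    PG fun x => encodeRat (-if p x then f x else g x) :=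
  (PG.ite hp hf hg).congr fun x => by split_ifs <;> rfl

theorem FinGraph.length_encode (G : FinGraph) : G.encode.length = G.n * (G.n + 1) := by
  simp [FinGraph.encode, encodeBits]

theorem FinGraph.count_comma_encode (G : FinGraph) : G.encode.count Γ'.comma = G.n := by
  have : ∀ l : List Bool, (encodeBits l).count Γ'.comma = 1 := by
    intro l
    simp [encodeBits, List.count_eq_zero]
  simp [FinGraph.encode, List.count_flatMap, Function.comp_def, this]

/-- The code of a pair of graphs. -/
noncomputable def pairCode (G : FinGraph × FinGraph) : List (Γ' ⊕ Γ') :=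
  G.1.encode.map .inl ++ G.2.encode.map .inr

theorem map_encode_eq {δ : Type} (G : FinGraph) (h : Γ' → δ) :
    G.encode.map h = (List.finRange G.n).flatMap fun v =>
      ((List.finRange G.n).map fun w => h (Γ'.bit (@decide (G.graph.Adj v w)
        (Classical.propDecidable _)))) ++ [h .comma] := by
  simp [FinGraph.encode, encodeBits, List.map_flatMap, Function.comp_def]

theorem blk_map_encode {δ : Type} [DecidableEq δ] (G : FinGraph) (h : Γ' → δ)
    (hh : Function.Injective h) (t : List δ) {i j : ℕ} (hi : i < G.n) :
    (blk (h .comma) (G.encode.map h ++ t) i)[j]? = some (h (.bit true)) ↔ G.AdjN i j := by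
  rw [map_encode_eq, blk_flatMap]
  · rw [dif_pos (by simpa using hi)]
    simp only [List.getElem_finRange, List.getElem?_map, Option.map_eq_some_iff]
    constructor
    · rintro ⟨k, hk, h'⟩
      obtain ⟨hj, rfl⟩ := List.getElem?_eq_some_iff.1 hk
      have := hh h'
      simp only [Γ'.bit.injEq, decide_eq_true_eq] at this
      exact ⟨hi, by simpa using hj, by simpa using this⟩
    · rintro ⟨_, hj, h'⟩
      exact ⟨⟨j, hj⟩, by simp [hj], congrArg h (by simpa using h')⟩
  · intro y
    simp only [List.mem_map, not_exists, not_and]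
    intro k _ e
    exact absurd (hh e) (by simp)

theorem blk_pairCode_left (G : FinGraph × FinGraph) {i j : ℕ} (hi : i < G.1.n) :
    (blk (.inl .comma) (pairCode G) i)[j]? = some (.inl (.bit true)) ↔ G.1.AdjN i j :=
  blk_map_encode G.1 _ Sum.inl_injective _ hi

/-- The code of the first graph contains no separator of the second kind and would become part of
block 0, so its `n * (n + 1)` symbols are dropped before splitting. -/
theorem blk_pairCode_right (G : FinGraph × FinGraph) {i j : ℕ} (hi : i < G.2.n) :
    (blk (.inr .comma) ((pairCode G).drop (G.1.n * (G.1.n + 1))) i)[j]? =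
      some (.inr (.bit true)) ↔ G.2.AdjN i j := by
  have := blk_map_encode G.2 (Sum.inr : Γ' → Γ' ⊕ Γ') Sum.inr_injective [] hi (j := j)
  rw [List.append_nil] at this
  rw [pairCode, ← G.1.length_encode, ← List.length_map (f := Sum.inl), List.drop_left, this]

theorem count_pairCode_left (G : FinGraph × FinGraph) :
    symCount (.inl .comma) (pairCode G) = G.1.n := by
  rw [pairCode, symCount_append, symCount_map Sum.inl_injective, symCount_eq,
    G.1.count_comma_encode, symCount_eq_zero (by simp), add_zero]

theorem count_pairCode_right (G : FinGraph × FinGraph) :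
    symCount (.inr .comma) (pairCode G) = G.2.n := by
  rw [pairCode, symCount_append, symCount_map Sum.inr_injective, symCount_eq_zero (by simp),
    zero_add, symCount_eq, G.2.count_comma_encode]

/-- A row of the payoff table of a two-player zero-sum game. -/
def zeroSumRow (v : ℚ) (a b : ℕ) : List Γ' :=
  encodeUnary a ++ (encodeUnary b ++ (encodeRat v ++ (encodeRat (-v) ++ [Γ'.ket])))

/-- The code of a two-player zero-sum game in which both players have `M` actions. -/
def zeroSumCode (M : ℕ) (v : ℕ → ℕ → ℚ) : List Γ' :=
  encodeUnary M ++ (encodeUnary M ++ ([Γ'.ket] ++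
    (List.range M).flatMap fun a => (List.range M).flatMap fun b => zeroSumRow (v a b) a b))

theorem encode_swapGame (G : FinGraph × FinGraph) : (swapGame G).encode =
    zeroSumCode (G.1.n + G.2.n + 1) (swapPayoff G.1.n G.2.n G.1.AdjN G.2.AdjN) := by
  set M := G.1.n + G.2.n + 1 with hM
  set v := swapPayoff G.1.n G.2.n G.1.AdjN G.2.AdjN with hv
  have hrow : ∀ a : Fin 2 → Fin M,
      (swapGame G).encodeRow a = zeroSumRow (v (a 0) (a 1)) (a 0) (a 1) := by
    intro a
    change (List.finRange 2).flatMap (fun i => encodeUnary (a i)) ++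
      ((List.finRange 2).flatMap (fun i => encodeRat (if i = 0 then v (a 0) (a 1)
        else - v (a 0) (a 1))) ++ [Γ'.ket]) = _
    simp [List.finRange_succ, zeroSumRow]
  have hprof : ∀ R : (Fin 2 → Fin M) → List Γ',
      (∀ a, R a = zeroSumRow (v (a 0) (a 1)) (a 0) (a 1)) →
      (profiles 2 fun _ => M).flatMap R = (List.range M).flatMap fun a =>
        (List.range M).flatMap fun b => zeroSumRow (v a b) a b := by
    intro R hR
    simp only [profiles]
    rw [List.flatMap_assoc, ← flatMap_finRange]
    refine congrArg (fun f => (List.finRange M).flatMap f) (funext fun a => ?_)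
    rw [List.flatMap_map, List.flatMap_assoc, ← flatMap_finRange]
    refine congrArg (fun f => (List.finRange M).flatMap f) (funext fun b => ?_)
    simp only [List.map_cons, List.map_nil, List.flatMap_cons, List.flatMap_nil, List.append_nil]
    exact hR _
  refine (congrArg (fun l => (List.ofFn fun _ : Fin 2 => M).flatMap encodeUnary ++ ([Γ'.ket] ++ l))
    (hprof _ hrow)).trans ?_
  simp [zeroSumCode]

theorem zeroSumCode_congr {M : ℕ} {v v' : ℕ → ℕ → ℚ} (h : ∀ a b, v a b = v' a b) :
    zeroSumCode M v = zeroSumCode M v' := by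
  obtain rfl : v = v' := funext fun a => funext (h a)
  rfl

/-- The translation of the code of a pair of graphs into the code of a game. -/
noncomputable def swapGameCode (w : List (Γ' ⊕ Γ')) : List Γ' :=
  zeroSumCode (symCount (.inl .comma) w + symCount (.inr .comma) w + 1)
    (swapPayoff (symCount (.inl .comma) w) (symCount (.inr .comma) w)
      (fun i j => (blk (.inl .comma) w i)[j]? = some (.inl (.bit true)))
      (fun i j => (blk (.inr .comma) (w.drop (symCount (.inl .comma) w *
        (symCount (.inl .comma) w + 1))) i)[j]? = some (.inr (.bit true))))

/-- Reading adjacency off the word is justified only for row numbers in range; the case distinctions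
in `swapPayoff` guarantee this wherever adjacency is consulted. -/
theorem swapGameCode_pairCode (G : FinGraph × FinGraph) :
    swapGameCode (pairCode G) = (swapGame G).encode := by
  rw [encode_swapGame, swapGameCode, count_pairCode_left, count_pairCode_right]
  refine zeroSumCode_congr fun a b => ?_
  unfold swapPayoff
  split_ifs <;> try rfl
  · rename_i h1 _ h3 h4
    exact absurd ((blk_pairCode_left G h1.1).1 h3) h4
  · rename_i h1 _ h3 h4
    exact absurd ((blk_pairCode_left G h1.1).2 h4) h3
  · rename_i _ _ _ h3 h4
    exact absurd ((blk_pairCode_right G (by omega)).1 h3) h4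
  · rename_i _ _ _ h3 h4
    exact absurd ((blk_pairCode_right G (by omega)).2 h4) h3

theorem PG.swapGameCode : PG swapGameCode := by
  have hw : PL fun w : List (Γ' ⊕ Γ') => w := PL.inp
  have h1 := PF.symCount hw (.inl .comma)
  have h2 := PF.symCount hw (.inr .comma)
  have hM := (h1.add h2).add (PF.const 1)
  have ha : PF fun y : (List (Γ' ⊕ Γ') × ℕ) × ℕ => y.1.2 := PF.snd.fst
  have hb : PF fun y : (List (Γ' ⊕ Γ') × ℕ) × ℕ => y.2 := PF.snd
  have hw' := hw.fst.fst
  have h1' := h1.fst.fst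
  have h2' := h2.fst.fst
  have hP : PP fun y : (List (Γ' ⊕ Γ') × ℕ) × ℕ =>
      (blk (.inl .comma) y.1.1 y.1.2)[y.2]? = some (.inl (.bit true)) :=
    (hw'.blk _ ha).get hb _
  have hQ : PP fun y : (List (Γ' ⊕ Γ') × ℕ) × ℕ =>
      (blk (.inr .comma) (y.1.1.drop (symCount (.inl .comma) y.1.1 *
        (symCount (.inl .comma) y.1.1 + 1))) (y.1.2 - symCount (.inl .comma) y.1.1))[y.2 -
          symCount (.inl .comma) y.1.1]? = some (.inr (.bit true)) :=
    ((hw'.drop (h1'.mul (h1'.add (PF.const 1)))).blk _ (ha.sub h1')).get (hb.sub h1') _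
  have hc1 := (PP.lt ha h1').and (PP.lt hb h1')
  have hc2 := ((PP.le h1' ha).and (PP.lt ha (h1'.add h2'))).and
    ((PP.le h1' hb).and (PP.lt hb (h1'.add h2')))
  have hab := PP.eq ha hb
  unfold GameSym.swapGameCode zeroSumCode zeroSumRow swapPayoff
  refine (PG.encodeUnary hM).append ((PG.encodeUnary hM).append ((PG.const _).append
    (PG.flatMap hM (PG.flatMap hM.fst ?_))))
  refine PG.append (PG.encodeUnary ha) (PG.append (PG.encodeUnary hb)
    (PG.append ?_ (PG.append ?_ (PG.const _))))
  · refine PG.encodeRat_ite hc1 ?_ ?_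
    · exact PG.encodeRat_ite hab (PG.const _) (PG.encodeRat_ite hP (PG.const _) (PG.const _))
    · refine PG.encodeRat_ite hc2 ?_ (PG.const _)
      exact PG.encodeRat_ite hab (PG.const _) (PG.encodeRat_ite hQ (PG.const _) (PG.const _))
  · refine PG.encodeRat_neg_ite hc1 ?_ ?_
    · exact PG.encodeRat_neg_ite hab (PG.const _)
        (PG.encodeRat_neg_ite hP (PG.const _) (PG.const _))
    · refine PG.encodeRat_neg_ite hc2 ?_ (PG.const _)
      exact PG.encodeRat_neg_ite hab (PG.const _)
        (PG.encodeRat_neg_ite hQ (PG.const _) (PG.const _))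

instance : Inhabited (Γ' ⊕ Γ') := ⟨.inl .blank⟩

/-- Deciding whether a two-player zero-sum game has a symmetry that is not player-separable is
GI-hard. -/
theorem zeroSum_GIHard :
    (nonPlayerSeparableSymmetry.restrict Game.IsTwoPlayerZeroSum).GIHard := by
  refine ⟨fun G => ⟨swapGame G, swapGame_zeroSum G⟩, ?_, fun G => ?_⟩
  -- The restricted problem encodes its instances as before, so the program for arbitrary games
  -- serves here too.
  · exact PG.swapGameCode.computable _ _ _ swapGameCode_pairCode
  · exact ⟨fun ⟨e⟩ => swapGame_symmetry_of_iso e, fun ⟨S, hS⟩ => iso_of_swapGame_symmetry S hS⟩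

/-- Deciding whether a game has a symmetry that is not player-separable is GI-hard. -/
theorem nonPlayerSeparableSymmetry_GIHard : nonPlayerSeparableSymmetry.GIHard := by
  refine ⟨fun G => swapGame G, ?_, fun G => ?_⟩
  · exact PG.swapGameCode.computable _ _ _ swapGameCode_pairCode
  · exact ⟨fun ⟨e⟩ => swapGame_symmetry_of_iso e, fun ⟨S, hS⟩ => iso_of_swapGame_symmetry S hS⟩

end GraphToGameEncoding

end GameSym

namespace GameSym

open Computability Turing

/-! ### Replacing vertex labels by hubs of distinguishable degree -/

section HubGraph

variable {V : Type} {C D : ℕ}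

/-- The vertices of the hub graph: the vertices of a labelled graph, one hub for each label, and
`(c + 1) * D` leaves at the hub of the label `c`. -/
abbrev HubVertex (V : Type) (C D : ℕ) : Type := V ⊕ Fin C ⊕ Σ c : Fin C, Fin ((c + 1) * D)

/-- The edges of the hub graph, in one direction. -/
def hubRel (G : SimpleGraph V) (Lab : V → ℕ → Prop) : HubVertex V C D → HubVertex V C D → Prop
  | .inl v, .inl w => G.Adj v w
  | .inl v, .inr (.inl c) => Lab v c
  | .inr (.inl c), .inr (.inr l) => c = l.1
  | _, _ => False

/-- A graph that represents a labelled graph: a vertex is adjacent to the hubs of its labels, and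
hubs are recognized by their degrees. -/
def hubGraph (C D : ℕ) (G : SimpleGraph V) (Lab : V → ℕ → Prop) : SimpleGraph (HubVertex V C D) :=
  SimpleGraph.fromRel (hubRel G Lab)

variable {G G' : SimpleGraph V} {Lab Lab' : V → ℕ → Prop}

theorem hubGraph_adj_base {v w : V} :
    (hubGraph C D G Lab).Adj (.inl v) (.inl w) ↔ G.Adj v w := by
  simp only [hubGraph, SimpleGraph.fromRel_adj, hubRel, G.adj_comm w v, or_self, ne_eq,
    Sum.inl.injEq, and_iff_right_iff_imp]
  exact fun h => h.ne

theorem hubGraph_adj_hub {v : V} {c : Fin C} :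
    (hubGraph C D G Lab).Adj (.inl v) (.inr (.inl c)) ↔ Lab v c := by
  simp [hubGraph, SimpleGraph.fromRel_adj, hubRel]

theorem hubGraph_adj_leaf {c : Fin C} {l : Σ c : Fin C, Fin ((c + 1) * D)} :
    (hubGraph C D G Lab).Adj (.inr (.inl c)) (.inr (.inr l)) ↔ c = l.1 := by
  simp [hubGraph, SimpleGraph.fromRel_adj, hubRel]

theorem card_le_of_subset_range {A Z : Type} [Finite Z] {s : Set A} (f : Z → A)
    (h : s ⊆ Set.range f) : Nat.card s ≤ Nat.card Z := by
  choose g hg using fun x : s => h x.2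
  refine Nat.card_le_card_of_injective g fun x y hxy => Subtype.ext ?_
  rw [← hg x, ← hg y, hxy]

theorem hubGraph_card_leaf (l : Σ c : Fin C, Fin ((c + 1) * D)) :
    Nat.card ((hubGraph C D G Lab).neighborSet (.inr (.inr l))) ≤ 1 := by
  refine (card_le_of_subset_range (fun _ : Unit => .inr (.inl l.1)) ?_).trans (by simp)
  rintro (v | c | l') h <;> simp [hubGraph, SimpleGraph.fromRel_adj, hubRel] at h
  simp [h]

variable [Finite V]

/-- The labels 0 and 1, put on every vertex, serve only to give base vertices two neighbours, so
that they cannot be confused with leaves. -/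
theorem hubGraph_le_card_base (hC : 1 < C) (h0 : ∀ v, Lab v 0) (h1 : ∀ v, Lab v 1) (v : V) :
    2 ≤ Nat.card ((hubGraph C D G Lab).neighborSet (.inl v)) := by
  refine le_trans (by simp) (Nat.card_le_card_of_injective (α := Bool) (fun b => ⟨.inr (.inl (if b then ⟨1, hC⟩ else
    ⟨0, by omega⟩)), hubGraph_adj_hub.2 (by cases b <;> simp [h0, h1])⟩) ?_)
  intro b b'
  cases b <;> cases b' <;> simp

theorem hubGraph_card_base_lt (hD : Nat.card V + C < D) (v : V) :
    Nat.card ((hubGraph C D G Lab).neighborSet (.inl v)) < D := by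
  refine lt_of_le_of_lt ?_ hD
  refine (card_le_of_subset_range (Sum.map id .inl : V ⊕ Fin C → HubVertex V C D) ?_).trans
    (by simp [Nat.card_sum])
  rintro (w | c | l) h
  · exact ⟨.inl w, rfl⟩
  · exact ⟨.inr c, rfl⟩
  · simp [hubGraph, SimpleGraph.fromRel_adj, hubRel] at h

theorem hubGraph_le_card_hub (c : Fin C) :
    (c + 1) * D ≤ Nat.card ((hubGraph C D G Lab).neighborSet (.inr (.inl c))) := by
  rw [← Nat.card_fin ((c + 1) * D)]
  refine Nat.card_le_card_of_injective
    (fun t => ⟨.inr (.inr ⟨c, t⟩), hubGraph_adj_leaf.2 rfl⟩) ?_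
  intro t t' h
  simpa using congrArg Subtype.val h

/-- Besides its leaves a hub has at most `Nat.card V < D` neighbours. So its degree lies between `(c
+ 1) * D` and `(c + 2) * D`, and these intervals are disjoint for different labels. -/
theorem hubGraph_card_hub_lt (hD : Nat.card V + C < D) (c : Fin C) :
    Nat.card ((hubGraph C D G Lab).neighborSet (.inr (.inl c))) < (c + 2) * D := by
  refine lt_of_le_of_lt (b := Nat.card V + (c + 1) * D) ?_ (by nlinarith)
  refine (card_le_of_subset_range (Sum.map id (fun t => .inr ⟨c, t⟩) :
    V ⊕ Fin ((c + 1) * D) → HubVertex V C D) ?_).trans (by simp [Nat.card_sum])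
  rintro (w | c' | ⟨c', t⟩) h
  · exact ⟨.inl w, rfl⟩
  · simp [hubGraph, SimpleGraph.fromRel_adj, hubRel] at h
  · obtain rfl : c = c' := hubGraph_adj_leaf.1 h
    exact ⟨.inr t, rfl⟩

/-- Hub graphs are isomorphic if and only if the labelled graphs are. -/
theorem hubGraph_iso_iff (hC : 1 < C) (hD : Nat.card V + C < D) (h0 : ∀ v, Lab v 0)
    (h1 : ∀ v, Lab v 1) :
    Nonempty (hubGraph C D G Lab ≃g hubGraph C D G' Lab') ↔
      ∃ σ : G ≃g G', ∀ v, ∀ c < C, Lab v c ↔ Lab' (σ v) c := by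
  constructor
  · rintro ⟨φ⟩
    have hdeg : ∀ x, Nat.card ((hubGraph C D G' Lab').neighborSet (φ x)) =
        Nat.card ((hubGraph C D G Lab).neighborSet x) :=
      fun x => (Nat.card_congr (φ.mapNeighborSet x)).symm
    -- The image of a hub has degree at least `D`, which excludes base vertices and leaves; the
    -- degree interval then determines the label.
    have hhub : ∀ c, φ (.inr (.inl c)) = .inr (.inl c) := by
      intro c
      have e := hdeg (.inr (.inl c))
      have a1 := hubGraph_le_card_hub (D := D) (G := G) (Lab := Lab) c
      have a2 := hubGraph_card_hub_lt (G := G) (Lab := Lab) hD c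
      have a3 : D ≤ (c + 1) * D := Nat.le_mul_of_pos_left _ (by omega)
      generalize φ (.inr (.inl c)) = y at *
      obtain v | c' | l := y
      · have := hubGraph_card_base_lt (G := G') (Lab := Lab') hD v
        omega
      · have b1 := hubGraph_le_card_hub (D := D) (G := G') (Lab := Lab') c'
        have b2 := hubGraph_card_hub_lt (G := G') (Lab := Lab') hD c'
        rw [e] at b1 b2
        have e1 := Nat.lt_of_mul_lt_mul_right (a1.trans_lt b2)
        have e2 := Nat.lt_of_mul_lt_mul_right (b1.trans_lt a2)
        congr 2
        ext
        omega
      · have := hubGraph_card_leaf (D := D) (G := G') (Lab := Lab') l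
        omega
    -- Base vertices are the vertices of degree at least 2 and less than `D`. The lower bound is
    -- needed only in the source graph, because the image has the same degree.
    have hbase : ∀ v, ∃ w, φ (.inl v) = .inl w := by
      intro v
      have e := hdeg (.inl v)
      have a1 := hubGraph_le_card_base (D := D) (G := G) hC h0 h1 v
      have a2 := hubGraph_card_base_lt (G := G) (Lab := Lab) hD v
      generalize φ (.inl v) = y at *
      obtain w | c' | l := y
      · exact ⟨w, rfl⟩
      · have b1 := hubGraph_le_card_hub (D := D) (G := G') (Lab := Lab') c'
        have a3 : D ≤ (c' + 1) * D := Nat.le_mul_of_pos_left _ (by omega)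
        omega
      · have := hubGraph_card_leaf (D := D) (G := G') (Lab := Lab') l
        omega
    choose σ hσ using hbase
    have hinj : Function.Injective σ := by
      intro v w h
      have : φ (.inl v) = φ (.inl w) := by rw [hσ, hσ, h]
      simpa using this
    refine ⟨⟨Equiv.ofBijective σ (Finite.injective_iff_bijective.1 hinj), ?_⟩, ?_⟩
    · intro v w
      rw [← hubGraph_adj_base (C := C) (D := D) (G := G) (Lab := Lab), ← φ.map_adj_iff, hσ, hσ,
        hubGraph_adj_base]
      rfl
    · intro v c hc
      rw [← hubGraph_adj_hub (C := C) (D := D) (G := G) (Lab := Lab) (c := ⟨c, hc⟩),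
        ← φ.map_adj_iff, hσ, hhub, hubGraph_adj_hub]
      rfl
  · rintro ⟨σ, hσ⟩
    refine ⟨⟨Equiv.sumCongr σ.toEquiv (Equiv.refl _), ?_⟩⟩
    have hrel : ∀ x y : HubVertex V C D, hubRel G' Lab' (Equiv.sumCongr σ.toEquiv (Equiv.refl _) x)
        (Equiv.sumCongr σ.toEquiv (Equiv.refl _) y) ↔ hubRel G Lab x y := by
      rintro (v | c | l) (w | c' | l') <;> simp [hubRel]
      · exact σ.map_adj_iff
      · exact (hσ _ _ (Fin.is_lt _)).symm
    intro x y
    simp only [hubGraph, SimpleGraph.fromRel_adj, hrel, ne_eq, EmbeddingLike.apply_eq_iff_eq]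

end HubGraph

end GameSym

namespace GameSym

open Computability Turing

/-! ### The ladder: a disjunction of isomorphism questions as a single one -/

section Ladder

variable {X : Type} {K M : ℕ}

/-- The vertices of the ladder: two nodes on each of `K + 1` levels, and for each pair of nodes on
consecutive levels a copy of `X`. -/
abbrev LadderVertex (K : ℕ) (X : Type) : Type := (Fin (K + 1) × Bool) ⊕ (Fin K × Bool × Bool × X)

/-- The edges of the ladder, in one direction: every copy of the base graph is joined to its two
nodes. -/
def ladderRel (B : SimpleGraph X) : LadderVertex K X → LadderVertex K X → Prop
  | .inl (k, s), .inr (l, s', t', _) => (k.val = l.val ∧ s = s') ∨ (k.val = l.val + 1 ∧ s = t')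
  | .inr (k, s, t, x), .inr (k', s', t', y) => k = k' ∧ s = s' ∧ t = t' ∧ B.Adj x y
  | _, _ => False

/-- The ladder over a base graph. -/
def ladderGraph (K : ℕ) (B : SimpleGraph X) : SimpleGraph (LadderVertex K X) :=
  SimpleGraph.fromRel (ladderRel B)

/-- The labels of the ladder. The copies between nodes on the same side are marked by `mk k false`,
the copies between nodes on different sides by `mk k true`. -/
def ladderLab (K : ℕ) (mk : ℕ → Bool → X → Prop) (BL : X → ℕ → Prop) (ε : Bool) :
    LadderVertex K X → ℕ → Prop
  | .inl (k, s), c => c = 0 ∨ c = 1 ∨ c = 2 ∨ (c = 3 ∧ k.val = 0 ∧ s = false) ∨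
      (c = 4 ∧ k.val = K ∧ s = ε) ∨ c = 6 + k.val
  | .inr (k, s, t, x), c => c = 0 ∨ c = 1 ∨ (c = 5 ∧ mk k (s != t) x) ∨ c = 6 + k.val ∨
      ∃ d, c = 7 + K + d ∧ BL x d

variable {B : SimpleGraph X} {mk : ℕ → Bool → X → Prop} {BL : X → ℕ → Prop} {ε : Bool}

theorem ladderGraph_adj_node {k : Fin (K + 1)} {s : Bool} {l : Fin K} {s' t' : Bool} {x : X} :
    (ladderGraph K B).Adj (.inl (k, s)) (.inr (l, s', t', x)) ↔
      (k.val = l.val ∧ s = s') ∨ (k.val = l.val + 1 ∧ s = t') := by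
  simp [ladderGraph, SimpleGraph.fromRel_adj, ladderRel]

theorem ladderGraph_adj_copy {k : Fin K} {s t : Bool} {x y : X} :
    (ladderGraph K B).Adj (.inr (k, s, t, x)) (.inr (k, s, t, y)) ↔ B.Adj x y := by
  simp only [ladderGraph, SimpleGraph.fromRel_adj, ladderRel, B.adj_comm y x, or_self, ne_eq,
    Sum.inr.injEq, Prod.mk.injEq, true_and, and_iff_right_iff_imp]
  exact fun h => h.ne

theorem ladderLab_node {v : LadderVertex K X} :
    ladderLab K mk BL ε v 2 ↔ ∃ k s, v = .inl (k, s) := by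
  obtain ⟨k, s⟩ | ⟨k, s, t, x⟩ := v
  · simp [ladderLab]
  · simp only [ladderLab, reduceCtorEq, exists_const, iff_false]
    rintro (h | h | h | h | ⟨d, h, -⟩) <;> omega

theorem ladderLab_start {k : Fin (K + 1)} {s : Bool} :
    ladderLab K mk BL ε (.inl (k, s)) 3 ↔ k.val = 0 ∧ s = false := by
  simp [ladderLab]
  omega

theorem ladderLab_end {k : Fin (K + 1)} {s : Bool} :
    ladderLab K mk BL ε (.inl (k, s)) 4 ↔ k.val = K ∧ s = ε := by
  simp [ladderLab]
  omega

theorem ladderLab_level_node {k : Fin (K + 1)} {s : Bool} {j : ℕ} :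
    ladderLab K mk BL ε (.inl (k, s)) (6 + j) ↔ j = k.val := by
  simp only [ladderLab]
  omega

/-- The bound on `j` keeps level labels below `7 + K`, where the labels of the base graph begin. -/
theorem ladderLab_level_copy {k : Fin K} {s t : Bool} {x : X} {j : ℕ} (hj : j ≤ K) :
    ladderLab K mk BL ε (.inr (k, s, t, x)) (6 + j) ↔ j = k.val := by
  simp only [ladderLab]
  constructor
  · rintro (h | h | h | h | ⟨d, h, -⟩) <;> omega
  · rintro rfl
    tauto

theorem ladderLab_mark {k : Fin K} {s t : Bool} {x : X} :
    ladderLab K mk BL ε (.inr (k, s, t, x)) 5 ↔ mk k (s != t) x := by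
  simp only [ladderLab]
  constructor
  · rintro (h | h | h | h | ⟨d, h, -⟩)
    · omega
    · omega
    · exact h.2
    · omega
    · omega
  · tauto

theorem ladderLab_base {k : Fin K} {s t : Bool} {x : X} {d : ℕ} :
    ladderLab K mk BL ε (.inr (k, s, t, x)) (7 + K + d) ↔ BL x d := by
  simp only [ladderLab]
  constructor
  · rintro (h | h | h | h | ⟨d', h, h'⟩)
    · omega
    · omega
    · omega
    · omega
    · obtain rfl : d = d' := by omega
      exact h'
  · exact fun h => .inr (.inr (.inr (.inr ⟨d, rfl, h⟩)))

/-- Labels force `σ` to preserve nodes and levels, to fix the bottom node on the side `false`, and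
to move the top node of that side to the other side. Somewhere in between two consecutive nodes
behave differently, and the copy between them is mapped to a copy with the other marking. -/
theorem exists_of_ladder_iso [Finite X]
    (σ : ladderGraph K B ≃g ladderGraph K B)
    (hσ : ∀ v, ∀ c < 7 + K + M, ladderLab K mk BL false v c ↔ ladderLab K mk BL true (σ v) c) :
    ∃ k < K, ∃ τ : B ≃g B, (∀ x, ∀ d < M, BL x d ↔ BL (τ x) d) ∧
      ∀ x, mk k false x ↔ mk k true (τ x) := by
  have hnode : ∀ (k : Fin (K + 1)) (s : Bool), ∃ s', σ (.inl (k, s)) = .inl (k, s') := by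
    intro k s
    obtain ⟨k', s', h⟩ := ladderLab_node.1 ((hσ (.inl (k, s)) 2 (by omega)).1
      (ladderLab_node.2 ⟨k, s, rfl⟩))
    have h2 := (hσ (.inl (k, s)) (6 + k) (by omega)).1 (ladderLab_level_node.2 rfl)
    rw [h, ladderLab_level_node] at h2
    obtain rfl : k = k' := Fin.ext h2
    exact ⟨s', h⟩
  choose g hg using hnode
  have h0 : g 0 false = false := by
    have h := (hσ (.inl (0, false)) 3 (by omega)).1 (ladderLab_start.2 ⟨rfl, rfl⟩)
    rw [hg] at h
    exact (ladderLab_start.1 h).2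
  have hK : g (Fin.last K) false = true := by
    have h := (hσ (.inl (Fin.last K, false)) 4 (by omega)).1 (ladderLab_end.2 ⟨rfl, rfl⟩)
    rw [hg] at h
    exact (ladderLab_end.1 h).2
  -- If sides never changed, induction from the bottom would give `false` at the top. For `K = 0`
  -- the two end conditions already contradict each other.
  obtain ⟨k, hk1, hk2⟩ : ∃ k : Fin K, g k.castSucc false = false ∧ g k.succ false = true := by
    by_contra! hcon
    have : ∀ k : Fin (K + 1), g k false = false := by
      intro k
      induction k using Fin.induction with
      | zero => exact h0
      | succ i ih => simpa using hcon i ih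
    rw [this] at hK
    exact absurd hK (by decide)
  -- The level label gives the level of the image, and adjacency to the images of the two end nodes
  -- gives its two sides.
  have hcopy : ∀ x, ∃ y, σ (.inr (k, false, false, x)) = .inr (k, false, true, y) := by
    intro x
    have e2 := (hσ (.inr (k, false, false, x)) 2 (by omega)).not.1
      (by rw [ladderLab_node]; simp)
    have e6 := (hσ (.inr (k, false, false, x)) (6 + k) (by omega)).1
      ((ladderLab_level_copy (by omega)).2 rfl)
    have a1 := (σ.map_adj_iff (v := .inl (k.castSucc, false))
      (w := .inr (k, false, false, x))).2 (ladderGraph_adj_node.2 (.inl ⟨rfl, rfl⟩))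
    have a2 := (σ.map_adj_iff (v := .inl (k.succ, false))
      (w := .inr (k, false, false, x))).2 (ladderGraph_adj_node.2 (.inr ⟨rfl, rfl⟩))
    rw [hg, hk1] at a1
    rw [hg, hk2] at a2
    generalize σ (.inr (k, false, false, x)) = z at e2 e6 a1 a2 ⊢
    obtain ⟨k', s'⟩ | ⟨k', s', t', y⟩ := z
    · exact absurd (ladderLab_node.2 ⟨_, _, rfl⟩) e2
    · rw [ladderLab_level_copy (by omega)] at e6
      obtain rfl : k = k' := Fin.ext e6
      rw [ladderGraph_adj_node] at a1 a2
      simp at a1 a2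
      exact ⟨y, by rw [← a1, ← a2]⟩
  choose τ hτ using hcopy
  have hinj : Function.Injective τ := by
    intro x y h
    have : σ (.inr (k, false, false, x)) = σ (.inr (k, false, false, y)) := by rw [hτ, hτ, h]
    simpa using this
  refine ⟨k, k.2, ⟨Equiv.ofBijective τ (Finite.injective_iff_bijective.1 hinj), ?_⟩, ?_, ?_⟩
  · intro x y
    have := σ.map_adj_iff (v := .inr (k, false, false, x)) (w := .inr (k, false, false, y))
    rwa [hτ, hτ, ladderGraph_adj_copy, ladderGraph_adj_copy] at this
  · intro x d hd
    have := hσ (.inr (k, false, false, x)) (7 + K + d) (by omega)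
    rwa [hτ, ladderLab_base, ladderLab_base] at this
  · intro x
    have := hσ (.inr (k, false, false, x)) 5 (by omega)
    rwa [hτ, ladderLab_mark, ladderLab_mark] at this

/-- The vertex map of the ladder that exchanges the two sides above level `k`, where `τ` and its
inverse describe the map on the copies above level `k`. -/
def ladderFlip (k : ℕ) (τ : X ≃ X) : LadderVertex K X → LadderVertex K X
  | .inl (j, s) => .inl (j, s ^^ decide (k < j.val))
  | .inr (j, s, t, x) => .inr (j, s ^^ decide (k < j.val), t ^^ decide (k < j.val + 1),
      if j.val = k then (if s = t then τ x else τ.symm x) else x)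

/-- At level `k` only the upper side is flipped, so the cases `s = t` and `s ≠ t` alternate and `τ`
is followed by `τ.symm`; elsewhere both sides are flipped or neither is. -/
theorem ladderFlip_ladderFlip (k : ℕ) (τ : X ≃ X) (v : LadderVertex K X) :
    ladderFlip k τ (ladderFlip k τ v) = v := by
  obtain ⟨j, s⟩ | ⟨j, s, t, x⟩ := v
  · simp [ladderFlip]
  · by_cases h : j.val = k
    · subst h
      cases s <;> cases t <;> simp [ladderFlip]
    · simp [ladderFlip, h]

/-- Below level `k` nothing moves, and above it both sides are exchanged, so markings, which depend
only on whether `s = t`, are preserved there. Only at level `k` do the markings switch, and `τ` or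
its inverse compensates for that. -/
theorem exists_ladder_iso {k : ℕ} (hk : k < K) (τ : B ≃g B)
    (hB : ∀ x, ∀ d < M, BL x d ↔ BL (τ x) d) (hm : ∀ x, mk k false x ↔ mk k true (τ x)) :
    ∃ σ : ladderGraph K B ≃g ladderGraph K B, ∀ v, ∀ c < 7 + K + M,
      ladderLab K mk BL false v c ↔ ladderLab K mk BL true (σ v) c := by
  set f : LadderVertex K X → LadderVertex K X := ladderFlip k τ.toEquiv with hf
  have hff : ∀ v, f (f v) = v := ladderFlip_ladderFlip k τ.toEquiv
  have hrel : ∀ v w, ladderRel B v w → ladderRel B (f v) (f w) := by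
    rintro (⟨j, s⟩ | ⟨j, s, t, x⟩) (⟨j', s'⟩ | ⟨j', s', t', y⟩) h
    · exact h
    · rcases h with ⟨h, rfl⟩ | ⟨h, rfl⟩
      · exact .inl ⟨h, by rw [h]⟩
      · exact .inr ⟨h, by rw [h]⟩
    · exact h
    · obtain ⟨rfl, rfl, rfl, h⟩ := h
      refine ⟨rfl, rfl, rfl, ?_⟩
      split_ifs
      · exact τ.map_adj_iff.2 h
      · exact τ.symm.map_adj_iff.2 h
      · exact h
  have hB' : ∀ x, ∀ d < M, BL x d ↔ BL (τ.symm x) d := fun x d hd => by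
    rw [hB (τ.symm x) d hd, τ.apply_symm_apply]
  have hm' : ∀ x, mk k true x ↔ mk k false (τ.symm x) := fun x => by
    rw [hm (τ.symm x), τ.apply_symm_apply]
  refine ⟨⟨⟨f, f, hff, hff⟩, ?_⟩, ?_⟩
  · intro v w
    have hrel' : ∀ v w, ladderRel B (f v) (f w) ↔ ladderRel B v w := fun v w =>
      ⟨fun h => by simpa only [hff] using hrel _ _ h, hrel v w⟩
    simp only [ladderGraph, SimpleGraph.fromRel_adj, Equiv.coe_fn_mk, hrel', ne_eq,
      (Function.LeftInverse.injective hff).eq_iff]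
  · rintro (⟨j, s⟩ | ⟨j, s, t, x⟩) c hc
    · change ladderLab K mk BL false _ c ↔
        ladderLab K mk BL true (.inl (j, s ^^ decide (k < j.val))) c
      simp only [ladderLab]
      have e1 : (j.val = 0 ∧ s = false) ↔ (j.val = 0 ∧ (s ^^ decide (k < j.val)) = false) := by
        refine and_congr_right fun h => ?_
        simp [h]
      have e2 : (j.val = K ∧ s = false) ↔ (j.val = K ∧ (s ^^ decide (k < j.val)) = true) := by
        refine and_congr_right fun h => ?_
        simp [h, hk]
      rw [e1, e2]
    · change ladderLab K mk BL false _ c ↔ ladderLab K mk BL true (.inr (j, s ^^ decide (k < j.val),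
        t ^^ decide (k < j.val + 1),
        if j.val = k then (if s = t then τ x else τ.symm x) else x)) c
      simp only [ladderLab]
      have e1 : mk j (s != t) x ↔ mk j ((s ^^ decide (k < j.val)) != (t ^^ decide (k < j.val + 1)))
          (if j.val = k then (if s = t then τ x else τ.symm x) else x) := by
        by_cases h : j.val = k
        · rw [h]
          cases s <;> cases t <;> first | simpa using hm x | simpa using hm' x
        · have : k < j.val + 1 ↔ k < j.val := by omega
          simp only [h, this, if_false]
          cases s <;> cases t <;> cases decide (k < j.val) <;> rfl
      have e2 : (∃ d, c = 7 + K + d ∧ BL x d) ↔ ∃ d, c = 7 + K + d ∧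
          BL (if j.val = k then (if s = t then τ x else τ.symm x) else x) d := by
        refine exists_congr fun d => and_congr_right fun h => ?_
        split_ifs
        · exact hB x d (by omega)
        · exact hB' x d (by omega)
        · rfl
      rw [e1, e2]

end Ladder

end GameSym

namespace GameSym

open Computability Turing

/-! ### The labelled graph of a game and its automorphisms -/

section GameGraph

variable {Γ : Game}

/-- The vertices of the graph of a game: the actions, and one entry for each player in each row of
the payoff table. -/
abbrev Game.Vertex (Γ : Game) : Type := Γ.Action ⊕ (Γ.Profile × Fin Γ.N)

/-- The adjacency relation of the graph of a game. -/
def Game.Adj (Γ : Game) : Γ.Vertex → Γ.Vertex → Prop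
  | .inl a, .inl b => a.1 = b.1 ∧ a ≠ b
  | .inl a, .inr e => a = ⟨e.2, e.1 e.2⟩
  | .inr e, .inl a => a = ⟨e.2, e.1 e.2⟩
  | .inr e, .inr e' => e.1 = e'.1 ∧ e.2 ≠ e'.2

/-- The graph of a game: the actions of a player form a clique, the entries of a row form a clique,
and every entry is adjacent to the action that its player takes in its row. -/
def Game.graph (Γ : Game) : SimpleGraph Γ.Vertex where
  Adj := Γ.Adj
  symm := ⟨by
    rintro (a | e) (b | e') h
    · exact ⟨h.1.symm, h.2.symm⟩
    · exact h
    · exact h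
    · exact ⟨h.1.symm, h.2.symm⟩⟩
  loopless := ⟨by
    rintro (a | e) h
    · exact h.2 rfl
    · exact h.2 rfl⟩

/-- The labels of the graph of a game: actions have the label `0`, and entries have labels that
describe their payoffs. -/
def Game.label (Q : Γ.Profile × Fin Γ.N → ℕ → Prop) : Γ.Vertex → ℕ → Prop
  | .inl _, d => d = 0
  | .inr e, d => ∃ q, d = q + 1 ∧ Q e q

/-- For `k = i * N + j`, the actions of player `i`, or the actions of player `j` if `j ≠ i`. -/
def Game.mark (k : ℕ) : Bool → Γ.Vertex → Prop
  | false, .inl a => ∃ j < Γ.N, k = a.1 * Γ.N + j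
  | true, .inl a => ∃ i < Γ.N, k = i * Γ.N + a.1 ∧ i ≠ a.1
  | _, .inr _ => False

theorem mul_add_inj {N i j i' j' : ℕ} (hj : j < N) (hj' : j' < N)
    (h : i * N + j = i' * N + j') : i = i' ∧ j = j' := by
  have h1 : i = i' := by
    have e : ∀ a b, b < N → (a * N + b) / N = a := fun a b hb => by
      rw [Nat.mul_comm, Nat.mul_add_div (by omega), Nat.div_eq_of_lt hb, add_zero]
    rw [← e i j hj, h, e i' j' hj']
  subst h1
  exact ⟨rfl, by omega⟩

theorem sigma_fin_val {N : ℕ} {m : Fin N → ℕ} {x : Σ i, Fin (m i)} {j : Fin N} {y : Fin (m j)}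
    (h : x = ⟨j, y⟩) : x.2.val = y.val := by
  subst h
  rfl

instance : Finite Γ.Vertex := by unfold Game.Vertex Game.Action Game.Profile; infer_instance

variable {Q : Γ.Profile × Fin Γ.N → ℕ → Prop} {M : ℕ}

/-- A symmetry acts on actions by `φ` and on entries by its action on profiles together with `π`;
labels are preserved because payoffs are. The index `k = i * N + π i` records one player `i` that is
moved. -/
theorem exists_graph_iso_of_symmetry
    (hQ : ∀ e e', (∀ q < M, Q e q ↔ Q e' q) ↔ Γ.u e.2 e.1 = Γ.u e'.2 e'.1)
    (S : Γ.Symmetry) (hS : ¬S.PlayerSeparable) :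
    ∃ k < Γ.N * Γ.N, ∃ τ : Γ.graph ≃g Γ.graph,
      (∀ x, ∀ d < M + 1, Game.label Q x d ↔ Game.label Q (τ x) d) ∧
        ∀ x, Game.mark k false x ↔ Game.mark k true (τ x) := by
  obtain ⟨φ, π, hφ, hu⟩ := S
  obtain ⟨i, hi⟩ : ∃ i, π i ≠ i := by
    by_contra! h
    exact hS (Equiv.ext h)
  set ρ : Γ.Profile → Γ.Profile := fun a j =>
    Fin.cast (congrArg Γ.m ((hφ _).trans (π.apply_symm_apply j))) (φ ⟨π.symm j, a (π.symm j)⟩).2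
    with hρ
  have hsig : ∀ (x : Γ.Action) (j : Fin Γ.N) (h : x.1 = j),
      x = ⟨j, Fin.cast (congrArg Γ.m h) x.2⟩ := by
    rintro x j rfl
    rfl
  -- Stated for any `j` equal to `π k`, so that after substitution only `π.symm (π k)` has to be
  -- replaced by `k` beneath the cast.
  have key : ∀ a j k, π k = j → φ ⟨k, a k⟩ = ⟨j, ρ a j⟩ := by
    rintro a _ k rfl
    obtain ⟨l, hl⟩ : ∃ l, l = π.symm (π k) := ⟨_, rfl⟩
    have h2 := hsig (φ ⟨π.symm (π k), a (π.symm (π k))⟩) (π k) (by rw [hφ, π.apply_symm_apply])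
    refine Eq.trans ?_ h2
    rw [← hl]
    obtain rfl : l = k := by rw [hl, π.symm_apply_apply]
    rfl
  have hinj : Function.Injective ρ := by
    intro a b h
    funext k
    have h1 := key a _ k rfl
    rw [h, ← key b _ k rfl] at h1
    simpa using h1
  have hfin : Finite Γ.Profile := by unfold Game.Profile; infer_instance
  let ρ' : Equiv.Perm Γ.Profile := Equiv.ofBijective ρ (Finite.injective_iff_bijective.1 hinj)
  let τ : Equiv.Perm Γ.Vertex := Equiv.sumCongr φ (Equiv.prodCongr ρ' π)
  have hent : ∀ (a : Γ.Action) (e : Γ.Profile × Fin Γ.N), φ a = ⟨π e.2, ρ e.1 (π e.2)⟩ ↔ a = ⟨e.2, e.1 e.2⟩ := by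
    intro a e
    rw [← key e.1 _ e.2 rfl, φ.apply_eq_iff_eq]
  refine ⟨i * Γ.N + π i, ?_, ⟨τ, ?_⟩, ?_, ?_⟩
  · have := i.2
    have := (π i).2
    nlinarith
  · rintro (a | e) (b | e')
    · change (φ a).1 = (φ b).1 ∧ φ a ≠ φ b ↔ a.1 = b.1 ∧ a ≠ b
      rw [hφ, hφ, π.apply_eq_iff_eq, Ne, φ.apply_eq_iff_eq]
    · exact hent a e'
    · exact hent b e
    · change ρ' e.1 = ρ' e'.1 ∧ π e.2 ≠ π e'.2 ↔ e.1 = e'.1 ∧ e.2 ≠ e'.2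
      rw [ρ'.apply_eq_iff_eq, Ne, π.apply_eq_iff_eq]
  · rintro (a | e) d hd
    · rfl
    · refine exists_congr fun q => and_congr_right fun h => ?_
      exact (hQ e (ρ e.1, π e.2)).2 (hu e.2 e.1) q (by omega)
  · rintro (a | e)
    · change (∃ j < Γ.N, i * Γ.N + (π i).val = a.1 * Γ.N + j) ↔
        ∃ l < Γ.N, i * Γ.N + (π i).val = l * Γ.N + (φ a).1 ∧ l ≠ (φ a).1
      rw [hφ]
      constructor
      · rintro ⟨j, hj, h⟩
        have h1 := (mul_add_inj (π i).2 hj h).1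
        have h2 : i = a.1 := Fin.ext h1
        exact ⟨i, i.2, by rw [h2], by rw [← h2]; exact fun h => hi (Fin.ext h.symm)⟩
      · rintro ⟨l, hl, h, -⟩
        have h1 := (mul_add_inj (π i).2 (π a.1).2 h).2
        have h2 : i = a.1 := π.injective (Fin.ext h1)
        exact ⟨π i, (π i).2, by rw [h2]⟩
    · rfl

/-- The label 0 separates actions from entries, the cliques of actions yield the player permutation,
and the cliques of entries make rows go to rows. The edges between entries and actions determine the
image row, and the payoff labels give invariance. -/
theorem exists_symmetry_of_graph_iso
    (hQ : ∀ e e', (∀ q < M, Q e q ↔ Q e' q) ↔ Γ.u e.2 e.1 = Γ.u e'.2 e'.1)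
    {k : ℕ} (hk : k < Γ.N * Γ.N) (τ : Γ.graph ≃g Γ.graph)
    (hlab : ∀ x, ∀ d < M + 1, Game.label Q x d ↔ Game.label Q (τ x) d)
    (hmark : ∀ x, Game.mark k false x ↔ Game.mark k true (τ x)) :
    ∃ S : Γ.Symmetry, ¬S.PlayerSeparable := by
  have hact : ∀ a, ∃ b, τ (.inl a) = .inl b := by
    intro a
    have := (hlab (.inl a) 0 (by omega)).1 rfl
    generalize τ (.inl a) = z at this
    obtain b | e := z
    · exact ⟨b, rfl⟩
    · obtain ⟨q, h, -⟩ := this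
      omega
  have hent : ∀ e, ∃ e', τ (.inr e) = .inr e' := by
    intro e
    have := (hlab (.inr e) 0 (by omega)).2
    generalize τ (.inr e) = z at this
    obtain b | e' := z
    · obtain ⟨q, h, -⟩ := this rfl
      omega
    · exact ⟨e', rfl⟩
  choose φ hφ using hact
  choose ψ hψ using hent
  have hinj : Function.Injective φ := by
    intro a b h
    have : τ (.inl a) = τ (.inl b) := by rw [hφ, hφ, h]
    simpa using this
  have hadj : ∀ a b, ((φ a).1 = (φ b).1 ∧ φ a ≠ φ b) ↔ (a.1 = b.1 ∧ a ≠ b) := by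
    intro a b
    have := τ.map_adj_iff (v := .inl a) (w := .inl b)
    rwa [hφ, hφ] at this
  -- The permutation is read off the action 0 of each player, which exists because action sets are
  -- nonempty.
  set π : Fin Γ.N → Fin Γ.N := fun i => (φ ⟨i, ⟨0, Γ.m_pos i⟩⟩).1 with hπ
  have hpl : ∀ a, (φ a).1 = π a.1 := by
    intro a
    by_cases h : a = ⟨a.1, ⟨0, Γ.m_pos a.1⟩⟩
    · exact congrArg (fun x => (φ x).1) h
    · exact ((hadj a ⟨a.1, ⟨0, Γ.m_pos a.1⟩⟩).2 ⟨rfl, h⟩).1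
  have hπinj : Function.Injective π := by
    intro i j h
    by_contra hij
    have hne : φ ⟨i, ⟨0, Γ.m_pos i⟩⟩ ≠ φ ⟨j, ⟨0, Γ.m_pos j⟩⟩ := fun e =>
      hij (congrArg Sigma.fst (hinj e))
    exact hij ((hadj _ _).1 ⟨h, hne⟩).1
  have hψ1 : ∀ e, φ ⟨e.2, e.1 e.2⟩ = ⟨(ψ e).2, (ψ e).1 (ψ e).2⟩ := by
    intro e
    have := τ.map_adj_iff (v := .inl ⟨e.2, e.1 e.2⟩) (w := .inr e)
    rw [hφ, hψ] at this
    exact this.2 rfl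
  have hψ2 : ∀ e, (ψ e).2 = π e.2 := fun e => by
    rw [← hpl ⟨e.2, e.1 e.2⟩, hψ1]
  have hψ3 : ∀ r i j, (ψ (r, i)).1 = (ψ (r, j)).1 := by
    intro r i j
    by_cases h : i = j
    · rw [h]
    · have := τ.map_adj_iff (v := .inr (r, i)) (w := .inr (r, j))
      rw [hψ, hψ] at this
      exact (this.2 ⟨rfl, h⟩).1
  have hfin : Finite Γ.Action := by unfold Game.Action; infer_instance
  let φ' : Equiv.Perm Γ.Action := Equiv.ofBijective φ (Finite.injective_iff_bijective.1 hinj)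
  let π' : Equiv.Perm (Fin Γ.N) := Equiv.ofBijective π (Finite.injective_iff_bijective.1 hπinj)
  -- The image row does not depend on the entry used to find it, so each of its components is the
  -- image of an action of `r`.
  have hrow : ∀ r i l j, π l = j → φ ⟨l, r l⟩ = ⟨j, (ψ (r, i)).1 j⟩ := by
    rintro r i l _ rfl
    have := hψ1 (r, l)
    rw [hψ3 r i l]
    have h2 := hψ2 (r, l)
    generalize ψ (r, l) = e at *
    obtain ⟨e1, e2⟩ := e
    subst h2
    exact this
  refine ⟨⟨φ', π', hpl, fun i a => ?_⟩, fun hsep => ?_⟩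
  · have hpay : Γ.u i a = Γ.u (ψ (a, i)).2 (ψ (a, i)).1 := by
      refine (hQ (a, i) (ψ (a, i))).1 fun q hq => ?_
      have := hlab (.inr (a, i)) (q + 1) (by omega)
      rw [hψ] at this
      simpa [Game.label] using this
    have hprof : (ψ (a, i)).1 = fun j => Fin.cast
        (congrArg Γ.m ((show (φ' _).1 = π' _ from hpl _).trans (π'.apply_symm_apply j)))
        (φ' ⟨π'.symm j, a (π'.symm j)⟩).2 := by
      funext j
      exact Fin.ext (sigma_fin_val (hrow a i _ j (π'.apply_symm_apply j))).symm
    rw [hpay, hprof, hψ2]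
    rfl
  · have hN : 0 < Γ.N := by
      by_contra h
      obtain h : Γ.N = 0 := by omega
      simp [h] at hk
    -- The index encodes the pair `(k / N, k % N)`. If `π` were the identity, an action of player `k
    -- / N` would be mapped to an action of the same player bearing the `true` mark; that mark
    -- requires the two players to differ.
    have hk' : k = k / Γ.N * Γ.N + k % Γ.N := (Nat.div_add_mod' k Γ.N).symm
    set i : Fin Γ.N := ⟨k / Γ.N, Nat.div_lt_of_lt_mul hk⟩ with hi
    obtain ⟨l, hl, h, hne⟩ : Game.mark k true (Sum.inl (φ ⟨i, ⟨0, Γ.m_pos i⟩⟩) : Γ.Vertex) := by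
      rw [← hφ, ← hmark]
      exact ⟨k % Γ.N, Nat.mod_lt _ hN, hk'⟩
    have hπi : (φ ⟨i, ⟨0, Γ.m_pos i⟩⟩).1 = i := (hpl _).trans (congrArg (fun p => p i) hsep)
    rw [hπi] at h hne
    rw [hk'] at h
    exact hne (mul_add_inj (Nat.mod_lt _ hN) i.2 h).1.symm

end GameGraph

end GameSym

namespace GameSym

open Computability Turing

/-! ### Reading a game off its code -/

section GameWords

/-- The sign and the binary digits of the numerator of a rational number. -/
def numWord (q : ℚ) : List Γ' :=
  Γ'.bit (decide (q.num < 0)) :: (encodeNat q.num.natAbs).map Γ'.bit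

/-- The binary digits of the denominator of a rational number. -/
def denWord (q : ℚ) : List Γ' := (encodeNat q.den).map Γ'.bit

theorem encodeRat_eq (q : ℚ) :
    encodeRat q = numWord q ++ [Γ'.comma] ++ (denWord q ++ [Γ'.comma]) := by
  simp [encodeRat, numWord, denWord, encodeBits]

theorem comma_notMem_map_bit (l : List Bool) : Γ'.comma ∉ l.map Γ'.bit := by simp

theorem comma_notMem_numWord (q : ℚ) : Γ'.comma ∉ numWord q := by simp [numWord]

theorem comma_notMem_denWord (q : ℚ) : Γ'.comma ∉ denWord q := by simp [denWord]

theorem ket_notMem_encodeRat (q : ℚ) : Γ'.ket ∉ encodeRat q := by simp [encodeRat, encodeBits]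

theorem ket_notMem_encodeUnary (n : ℕ) : Γ'.ket ∉ encodeUnary n := by
  simp [encodeUnary, encodeBits]

theorem blk_flatMap_two {Y β : Type} [DecidableEq β] (c : β) (f g : Y → List β)
    (hf : ∀ y, c ∉ f y) (hg : ∀ y, c ∉ g y) (l : List Y) (i : ℕ) (hi : i < l.length) :
    blk c (l.flatMap fun y => f y ++ [c] ++ (g y ++ [c])) (2 * i) = f l[i] ∧
      blk c (l.flatMap fun y => f y ++ [c] ++ (g y ++ [c])) (2 * i + 1) = g l[i] := by
  induction l generalizing i with
  | nil => simp at hi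
  | cons y l ih =>
    simp only [List.flatMap_cons, List.append_assoc, List.cons_append, List.nil_append]
    cases i with
    | zero =>
      exact ⟨blk_append_zero c (hf y) _, by
        rw [blk_append_succ c (hf y), blk_append_zero c (hg y)]; rfl⟩
    | succ i =>
      have := ih i (by simpa using hi)
      simp only [List.append_assoc, List.cons_append, List.nil_append] at this
      rw [show 2 * (i + 1) = 2 * i + 1 + 1 by ring, blk_append_succ c (hf y),
        blk_append_succ c (hg y), blk_append_succ c (hf y), blk_append_succ c (hg y)]
      exact this

/-- The row of the payoff table for a profile, without the end marker. -/
def Game.rowWord (Γ : Game) (a : Γ.Profile) : List Γ' :=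
  (List.finRange Γ.N).flatMap (fun i => encodeUnary (a i)) ++
    (List.finRange Γ.N).flatMap (fun i => encodeRat (Γ.u i a))

theorem Game.encode_eq (Γ : Game) : Γ.encode = (List.ofFn Γ.m).flatMap encodeUnary ++
    Γ'.ket :: ((profiles Γ.N Γ.m).flatMap fun a => Γ.rowWord a ++ [Γ'.ket]) := by
  simp [Game.encode, Game.rowWord]
  rfl

theorem ket_notMem_sizes (l : List ℕ) : Γ'.ket ∉ l.flatMap encodeUnary := by
  simp [ket_notMem_encodeUnary]

theorem Game.ket_notMem_rowWord (Γ : Game) (a : Γ.Profile) : Γ'.ket ∉ Γ.rowWord a := by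
  simp [Game.rowWord, ket_notMem_encodeUnary, ket_notMem_encodeRat]

theorem profiles_nodup : ∀ (N : ℕ) (m : Fin N → ℕ), (profiles N m).Nodup
  | 0, _ => by simp [profiles]
  | N + 1, m => by
    rw [profiles, List.nodup_flatMap]
    refine ⟨fun a _ => (profiles_nodup N _).map fun b b' h => ?_, ?_⟩
    · exact (Fin.cons_injective2 h).2
    · refine (List.nodup_finRange _).imp fun {a b} hab => ?_
      simp only [Function.onFun, List.disjoint_left, List.mem_map, not_exists, not_and]
      rintro _ ⟨c, -, rfl⟩ d - h
      exact hab (Fin.cons_injective2 h).1.symm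

variable (w : List Γ')

/-- The number of players, read off the code of a game. -/
def wordN : ℕ := symCount Γ'.comma (blk Γ'.ket w 0)

/-- The number of action profiles, read off the code of a game. -/
def wordR : ℕ := symCount Γ'.ket w - 1

/-- The number of actions of a player, read off the code of a game. -/
def wordM (i : ℕ) : ℕ := (blk Γ'.comma (blk Γ'.ket w 0) i).length

/-- The action of player `i` in row `r`, read off the code of a game. -/
def wordAct (r i : ℕ) : ℕ := (blk Γ'.comma (blk Γ'.ket w (r + 1)) i).length

/-- The numerator of the payoff of player `i` in row `r`, read off the code of a game. -/
def wordNum (r i : ℕ) : List Γ' := blk Γ'.comma (blk Γ'.ket w (r + 1)) (wordN w + 2 * i)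

/-- The denominator of the payoff of player `i` in row `r`, read off the code of a game. -/
def wordDen (r i : ℕ) : List Γ' := blk Γ'.comma (blk Γ'.ket w (r + 1)) (wordN w + (2 * i + 1))

variable (Γ : Game)

theorem blk_encode_zero : blk Γ'.ket Γ.encode 0 = (List.ofFn Γ.m).flatMap encodeUnary := by
  rw [Game.encode_eq, blk_append_zero _ (ket_notMem_sizes _)]

theorem blk_encode_succ {r : ℕ} (hr : r < (profiles Γ.N Γ.m).length) :
    blk Γ'.ket Γ.encode (r + 1) = Γ.rowWord (profiles Γ.N Γ.m)[r] := by
  rw [Game.encode_eq, blk_append_succ _ (ket_notMem_sizes _)]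
  have := blk_flatMap Γ'.ket Γ.rowWord Γ.ket_notMem_rowWord (profiles Γ.N Γ.m) [] r
  rwa [List.append_nil, dif_pos hr] at this

theorem count_encodeUnary (n : ℕ) : (encodeUnary n).count Γ'.comma = 1 := by
  simp [encodeUnary, encodeBits, List.count_eq_zero]

theorem wordN_encode : wordN Γ.encode = Γ.N := by
  rw [wordN, blk_encode_zero, symCount_eq, List.count_flatMap]
  simp [Function.comp_def, count_encodeUnary]

theorem wordR_encode : wordR Γ.encode = (profiles Γ.N Γ.m).length := by
  have : ∀ a, (Γ.rowWord a).count Γ'.ket = 0 := fun a =>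
    List.count_eq_zero_of_not_mem (Γ.ket_notMem_rowWord a)
  rw [wordR, Game.encode_eq, symCount_eq, List.count_append,
    List.count_eq_zero_of_not_mem (ket_notMem_sizes _), List.count_cons, List.count_flatMap]
  simp [Function.comp_def, this]

theorem wordM_encode (i : Fin Γ.N) : wordM Γ.encode i = Γ.m i := by
  have := blk_flatMap Γ'.comma (fun n : ℕ => (List.replicate n true).map Γ'.bit)
    (fun n => comma_notMem_map_bit _) (List.ofFn Γ.m) [] i
  rw [List.append_nil, dif_pos (by simp)] at this
  rw [wordM, blk_encode_zero]
  refine (congrArg List.length this).trans ?_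
  simp

theorem wordAct_encode {r : ℕ} (hr : r < (profiles Γ.N Γ.m).length) (i : Fin Γ.N) :
    wordAct Γ.encode r i = (profiles Γ.N Γ.m)[r] i := by
  have := blk_flatMap Γ'.comma
    (fun j : Fin Γ.N => (List.replicate ((profiles Γ.N Γ.m)[r] j).val true).map Γ'.bit)
    (fun n => comma_notMem_map_bit _) (List.finRange Γ.N)
    ((List.finRange Γ.N).flatMap fun i => encodeRat (Γ.u i (profiles Γ.N Γ.m)[r])) i
  rw [dif_pos (by simp)] at this
  rw [wordAct, blk_encode_succ Γ hr]
  refine (congrArg List.length this).trans ?_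
  rw [List.length_map, List.length_replicate]
  exact congrArg (fun j => ((profiles Γ.N Γ.m)[r] j).val) (by simp)

/-- The first `N` comma-separated fields of a row are the actions; payoffs start after them, with
two fields each. -/
theorem blk_rowWord (a : Γ.Profile) (x : ℕ) : blk Γ'.comma (Γ.rowWord a) (Γ.N + x) =
    blk Γ'.comma ((List.finRange Γ.N).flatMap fun i => encodeRat (Γ.u i a)) x := by
  have := blk_flatMap Γ'.comma (fun j : Fin Γ.N => (List.replicate (a j).val true).map Γ'.bit)
    (fun n => comma_notMem_map_bit _) (List.finRange Γ.N)
    ((List.finRange Γ.N).flatMap fun i => encodeRat (Γ.u i a)) (Γ.N + x)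
  rw [dif_neg (by simp), List.length_finRange, Nat.add_sub_cancel_left] at this
  exact this

theorem blk_payoffs (a : Γ.Profile) (i : Fin Γ.N) :
    blk Γ'.comma ((List.finRange Γ.N).flatMap fun i => encodeRat (Γ.u i a)) (2 * i) =
      numWord (Γ.u i a) ∧
    blk Γ'.comma ((List.finRange Γ.N).flatMap fun i => encodeRat (Γ.u i a)) (2 * i + 1) =
      denWord (Γ.u i a) := by
  simp only [encodeRat_eq]
  have := blk_flatMap_two Γ'.comma (fun i : Fin Γ.N => numWord (Γ.u i a))
    (fun i => denWord (Γ.u i a)) (fun i => comma_notMem_numWord _) (fun i => comma_notMem_denWord _)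
    (List.finRange Γ.N) i (by simp)
  simpa using this

theorem wordNum_encode {r : ℕ} (hr : r < (profiles Γ.N Γ.m).length) (i : Fin Γ.N) :
    wordNum Γ.encode r i = numWord (Γ.u i (profiles Γ.N Γ.m)[r]) := by
  rw [wordNum, blk_encode_succ Γ hr, wordN_encode, blk_rowWord, (blk_payoffs Γ _ i).1]

theorem wordDen_encode {r : ℕ} (hr : r < (profiles Γ.N Γ.m).length) (i : Fin Γ.N) :
    wordDen Γ.encode r i = denWord (Γ.u i (profiles Γ.N Γ.m)[r]) := by
  rw [wordDen, blk_encode_succ Γ hr, wordN_encode, blk_rowWord, (blk_payoffs Γ _ i).2]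

theorem blk_length_le {β : Type} [DecidableEq β] (c : β) (l : List β) (i : ℕ) :
    (blk c l i).length ≤ l.length := by
  rw [blk_length]
  refine (Finset.sum_le_sum (g := fun _ => 1) fun q _ => ?_).trans (by simp)
  split_ifs <;> omega

theorem wordN_le : wordN w ≤ w.length := by
  rw [wordN, symCount_eq]
  exact List.count_le_length.trans (blk_length_le _ _ _)

theorem wordR_le : wordR w ≤ w.length := by
  rw [wordR, symCount_eq]
  exact (Nat.sub_le _ _).trans List.count_le_length

theorem wordM_le (i : ℕ) : wordM w i ≤ w.length :=
  (blk_length_le _ _ _).trans (blk_length_le _ _ _)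

/-- The labels of an entry that describe the words `n` and `d` for the numerator and the
denominator of a payoff. -/
def wordLabel (T : ℕ) (n d : List Γ') (c : ℕ) : Prop :=
  ∃ t < T, (c = 4 * t ∧ n[t]? = some (Γ'.bit true)) ∨ (c = 4 * t + 1 ∧ n[t]? = some (Γ'.bit false)) ∨
    (c = 4 * t + 2 ∧ d[t]? = some (Γ'.bit true)) ∨ (c = 4 * t + 3 ∧ d[t]? = some (Γ'.bit false))

theorem wordLabel_iff {T t : ℕ} (ht : t < T) (n d : List Γ') :
    (wordLabel T n d (4 * t) ↔ n[t]? = some (Γ'.bit true)) ∧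
    (wordLabel T n d (4 * t + 1) ↔ n[t]? = some (Γ'.bit false)) ∧
    (wordLabel T n d (4 * t + 2) ↔ d[t]? = some (Γ'.bit true)) ∧
    (wordLabel T n d (4 * t + 3) ↔ d[t]? = some (Γ'.bit false)) := by
  refine ⟨⟨?_, fun h => ⟨t, ht, .inl ⟨rfl, h⟩⟩⟩, ⟨?_, fun h => ⟨t, ht, .inr (.inl ⟨rfl, h⟩)⟩⟩,
    ⟨?_, fun h => ⟨t, ht, .inr (.inr (.inl ⟨rfl, h⟩))⟩⟩,
    ⟨?_, fun h => ⟨t, ht, .inr (.inr (.inr ⟨rfl, h⟩))⟩⟩⟩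
  all_goals
    rintro ⟨t', -, ⟨h, h'⟩ | ⟨h, h'⟩ | ⟨h, h'⟩ | ⟨h, h'⟩⟩
    all_goals first
      | omega
      | (obtain rfl : t' = t := by omega
         exact h')

theorem eq_of_getElem?_bit {T : ℕ} {l l' : List Bool} (hl : l.length ≤ T) (hl' : l'.length ≤ T)
    (h : ∀ t < T, ∀ b, (l.map Γ'.bit)[t]? = some (Γ'.bit b) ↔
      (l'.map Γ'.bit)[t]? = some (Γ'.bit b)) : l = l' := by
  refine List.ext_getElem? fun t => ?_
  by_cases ht : t < T
  · refine Option.ext fun b => ?_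
    simpa using h t ht b
  · rw [List.getElem?_eq_none (by omega), List.getElem?_eq_none (by omega)]

/-- Ones and zeros have separate labels, so the absence of both marks the end of a word and the
labels recover the two words completely, provided that `T` bounds their lengths. -/
theorem wordLabel_rat_iff {T : ℕ} {q q' : ℚ} (h1 : (numWord q).length ≤ T)
    (h2 : (denWord q).length ≤ T) (h1' : (numWord q').length ≤ T) (h2' : (denWord q').length ≤ T) :
    (∀ c < 4 * T, wordLabel T (numWord q) (denWord q) c ↔
      wordLabel T (numWord q') (denWord q') c) ↔ q = q' := by
  refine ⟨fun h => encodeRat_prefix.injective ?_, fun h _ _ => by rw [h]⟩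
  have key : ∀ t < T, ∀ b, ((numWord q)[t]? = some (Γ'.bit b) ↔ (numWord q')[t]? = some (Γ'.bit b))
      ∧ ((denWord q)[t]? = some (Γ'.bit b) ↔ (denWord q')[t]? = some (Γ'.bit b)) := by
    intro t ht b
    obtain ⟨a1, a2, a3, a4⟩ := wordLabel_iff ht (numWord q) (denWord q)
    obtain ⟨b1, b2, b3, b4⟩ := wordLabel_iff ht (numWord q') (denWord q')
    cases b
    · exact ⟨by rw [← a2, h _ (by omega), b2], by rw [← a4, h _ (by omega), b4]⟩
    · exact ⟨by rw [← a1, h _ (by omega), b1], by rw [← a3, h _ (by omega), b3]⟩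
  have hd : encodeNat q.den = encodeNat q'.den :=
    eq_of_getElem?_bit (by simpa [denWord] using h2) (by simpa [denWord] using h2')
      fun t ht b => (key t ht b).2
  have hn : decide (q.num < 0) :: encodeNat q.num.natAbs =
      decide (q'.num < 0) :: encodeNat q'.num.natAbs :=
    eq_of_getElem?_bit (by simpa [numWord] using h1) (by simpa [numWord] using h1')
      fun t ht b => by simpa only [List.map_cons, numWord] using (key t ht b).1
  have hn' : numWord q = numWord q' := congrArg (List.map Γ'.bit) hn
  have hd' : denWord q = denWord q' := congrArg (List.map Γ'.bit) hd
  rw [encodeRat_eq, encodeRat_eq, hn', hd']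

end GameWords

end GameSym

namespace GameSym

open Computability Turing

/-! ### Vertices as 6-tuples: kind, level and sides, then data of the base vertex -/

section Codes

variable (w : List Γ') (v v' : Fin 6 → ℕ) (ε c : ℕ)

/-- The adjacency relation of the graph of a game, on codes. -/
def gameRelC : Prop :=
  ((v 0 = 1 ∧ v' 0 = 1) ∧ v 4 = v' 4 ∧ v 5 ≠ v' 5) ∨
  ((v 0 = 2 ∧ v' 0 = 2) ∧ v 4 = v' 4 ∧ v 5 ≠ v' 5) ∨
  ((v 0 = 1 ∧ v' 0 = 2) ∧ v 4 = v' 5 ∧ v 5 = wordAct w (v' 4) (v' 5)) ∨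
  ((v 0 = 2 ∧ v' 0 = 1) ∧ v' 4 = v 5 ∧ v' 5 = wordAct w (v 4) (v 5))

/-- The edges of the ladder in one direction, on codes. -/
def ladderRelC : Prop :=
  ((v 0 = 0 ∧ (v' 0 = 1 ∨ v' 0 = 2)) ∧
    ((v 1 = v' 1 ∧ v 2 = v' 2) ∨ (v 1 = v' 1 + 1 ∧ v 2 = v' 3))) ∨
  ((v 1 = v' 1 ∧ v 2 = v' 2 ∧ v 3 = v' 3) ∧ gameRelC w v v')

/-- Inequality of codes. -/
def neC : Prop :=
  ¬(v 0 = v' 0 ∧ v 1 = v' 1 ∧ v 2 = v' 2 ∧ v 3 = v' 3 ∧ v 4 = v' 4 ∧ v 5 = v' 5)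

/-- The marks of the ladder, on codes. -/
def markC : Prop :=
  v 0 = 1 ∧ ((v 2 = v 3 ∧ ∃ j < wordN w, v 1 = v 4 * wordN w + j) ∨
    (v 2 ≠ v 3 ∧ ∃ i < wordN w, v 1 = i * wordN w + v 4 ∧ i ≠ v 4))

/-- The payoff labels, on codes. -/
def payoffC : Prop :=
  ∃ t < w.length,
    (c = 7 + wordN w * wordN w + 1 + 4 * t ∧
      (wordNum w (v 4) (v 5))[t]? = some (Γ'.bit true)) ∨
    (c = 7 + wordN w * wordN w + 1 + 4 * t + 1 ∧
      (wordNum w (v 4) (v 5))[t]? = some (Γ'.bit false)) ∨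
    (c = 7 + wordN w * wordN w + 1 + 4 * t + 2 ∧
      (wordDen w (v 4) (v 5))[t]? = some (Γ'.bit true)) ∨
    (c = 7 + wordN w * wordN w + 1 + 4 * t + 3 ∧
      (wordDen w (v 4) (v 5))[t]? = some (Γ'.bit false))

/-- The labels of the ladder, on codes. -/
def labelC : Prop :=
  (v 0 = 0 ∧ (c = 0 ∨ c = 1 ∨ c = 2 ∨ (c = 3 ∧ v 1 = 0 ∧ v 2 = 0) ∨
    (c = 4 ∧ v 1 = wordN w * wordN w ∧ v 2 = ε) ∨ c = 6 + v 1)) ∨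
  ((v 0 = 1 ∨ v 0 = 2) ∧ (c = 0 ∨ c = 1 ∨ (c = 5 ∧ markC w v) ∨ c = 6 + v 1 ∨
    (v 0 = 1 ∧ c = 7 + wordN w * wordN w) ∨ (v 0 = 2 ∧ payoffC w v c)))

/-- The edges of the hub graph in one direction, on codes. -/
def hubRelC : Prop :=
  ((v 0 < 3 ∧ v' 0 < 3) ∧ neC v v' ∧ (ladderRelC w v v' ∨ ladderRelC w v' v)) ∨
  ((v 0 < 3 ∧ v' 0 = 3) ∧ labelC w v ε (v' 1)) ∨
  ((v 0 = 3 ∧ v' 0 = 4) ∧ v 1 = v' 1)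

/-- The adjacency relation of the hub graph, on codes. -/
def adjC : Prop := neC v v' ∧ (hubRelC w v v' ε ∨ hubRelC w v' v ε)

/-- The codes of the vertices of the ladder. -/
def validLadderC : Prop :=
  ((v 0 = 0 ∧ v 3 = 0 ∧ v 4 = 0 ∧ v 5 = 0) ∧ v 1 < wordN w * wordN w + 1 ∧ v 2 < 2) ∨
  (v 0 = 1 ∧ (v 1 < wordN w * wordN w ∧ v 2 < 2 ∧ v 3 < 2) ∧ v 4 < wordN w ∧
    v 5 < wordM w (v 4)) ∨
  (v 0 = 2 ∧ (v 1 < wordN w * wordN w ∧ v 2 < 2 ∧ v 3 < 2) ∧ v 4 < wordR w ∧ v 5 < wordN w)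

/-- The codes of the vertices of the hub graph. -/
def validC (C D : ℕ) : Prop :=
  validLadderC w v ∨
  ((v 0 = 3 ∧ v 2 = 0 ∧ v 3 = 0 ∧ v 4 = 0 ∧ v 5 = 0) ∧ v 1 < C) ∨
  ((v 0 = 4 ∧ v 3 = 0 ∧ v 4 = 0 ∧ v 5 = 0) ∧ v 1 < C ∧ v 2 < (v 1 + 1) * D)

end Codes

/-! ### Correctness of the relations on codes -/

section VertexCodes

variable {Γ : Game} {C D : ℕ}

/-- The number of a profile. -/
def Game.rowIndex (Γ : Game) (a : Γ.Profile) : ℕ := (profiles Γ.N Γ.m).idxOf a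

theorem Game.rowIndex_lt (a : Γ.Profile) : Γ.rowIndex a < (profiles Γ.N Γ.m).length :=
  List.idxOf_lt_length_iff.2 (mem_profiles _ _ a)

theorem Game.getElem_rowIndex (a : Γ.Profile) :
    (profiles Γ.N Γ.m)[Γ.rowIndex a]'(Game.rowIndex_lt a) = a :=
  List.getElem_idxOf _

theorem Game.rowIndex_getElem {r : ℕ} (hr : r < (profiles Γ.N Γ.m).length) :
    Γ.rowIndex (profiles Γ.N Γ.m)[r] = r :=
  (profiles_nodup _ _).idxOf_getElem _ _

theorem Game.rowIndex_inj {a b : Γ.Profile} : Γ.rowIndex a = Γ.rowIndex b ↔ a = b := by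
  refine ⟨fun h => ?_, fun h => by rw [h]⟩
  rw [← Game.getElem_rowIndex a, ← Game.getElem_rowIndex b]
  simp only [h]

theorem wordAct_rowIndex (a : Γ.Profile) (i : Fin Γ.N) :
    wordAct Γ.encode (Γ.rowIndex a) i = a i := by
  rw [wordAct_encode Γ (Game.rowIndex_lt a), Game.getElem_rowIndex]

theorem wordNum_rowIndex (a : Γ.Profile) (i : Fin Γ.N) :
    wordNum Γ.encode (Γ.rowIndex a) i = numWord (Γ.u i a) := by
  rw [wordNum_encode Γ (Game.rowIndex_lt a), Game.getElem_rowIndex]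

theorem wordDen_rowIndex (a : Γ.Profile) (i : Fin Γ.N) :
    wordDen Γ.encode (Γ.rowIndex a) i = denWord (Γ.u i a) := by
  rw [wordDen_encode Γ (Game.rowIndex_lt a), Game.getElem_rowIndex]

/-- The code of a vertex of the ladder. -/
def ladderCode : LadderVertex (Γ.N * Γ.N) Γ.Vertex → Fin 6 → ℕ
  | .inl (k, s) => ![0, k, s.toNat, 0, 0, 0]
  | .inr (k, s, t, .inl a) => ![1, k, s.toNat, t.toNat, a.1, a.2]
  | .inr (k, s, t, .inr (r, i)) => ![2, k, s.toNat, t.toNat, Γ.rowIndex r, i]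

/-- The code of a vertex of the hub graph. -/
def hubCode : HubVertex (LadderVertex (Γ.N * Γ.N) Γ.Vertex) C D → Fin 6 → ℕ
  | .inl v => ladderCode v
  | .inr (.inl c) => ![3, c, 0, 0, 0, 0]
  | .inr (.inr ⟨c, t⟩) => ![4, c, t, 0, 0, 0]

theorem code_eq_iff {v v' : Fin 6 → ℕ} : v = v' ↔
    v 0 = v' 0 ∧ v 1 = v' 1 ∧ v 2 = v' 2 ∧ v 3 = v' 3 ∧ v 4 = v' 4 ∧ v 5 = v' 5 := by
  simp [funext_iff, Fin.forall_fin_succ]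

theorem neC_iff {v v' : Fin 6 → ℕ} : neC v v' ↔ v ≠ v' := by rw [neC, ← code_eq_iff, Ne]

theorem toNat_inj {s t : Bool} : s.toNat = t.toNat ↔ s = t := by cases s <;> cases t <;> simp

theorem sigma_fin_eq_iff {N : ℕ} {m : Fin N → ℕ} {x y : Σ i, Fin (m i)} :
    x = y ↔ x.1.val = y.1.val ∧ x.2.val = y.2.val := by
  refine ⟨fun h => by rw [h]; exact ⟨rfl, rfl⟩, ?_⟩
  obtain ⟨i, a⟩ := x
  obtain ⟨j, b⟩ := y
  rintro ⟨h, h'⟩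
  obtain rfl := Fin.ext h
  obtain rfl := Fin.ext h'
  rfl

theorem ladderCode_injective : Function.Injective (ladderCode (Γ := Γ)) := by
  rintro (⟨k, s⟩ | ⟨k, s, t, a | ⟨r, i⟩⟩) (⟨k', s'⟩ | ⟨k', s', t', a' | ⟨r', i'⟩⟩) h <;>
    rw [code_eq_iff] at h <;>
    simp [ladderCode, toNat_inj, Game.rowIndex_inj, Fin.val_inj] at h
  · simp [h]
  · obtain ⟨rfl, rfl, rfl, h⟩ := h
    have : a = a' := sigma_fin_eq_iff.2 ⟨by rw [h.1], h.2⟩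
    simp [this]
  · simp [h]

theorem ladderCode_lt (v : LadderVertex (Γ.N * Γ.N) Γ.Vertex) : ladderCode v 0 < 3 := by
  obtain ⟨k, s⟩ | ⟨k, s, t, a | ⟨r, i⟩⟩ := v <;> simp [ladderCode]

theorem hubCode_injective : Function.Injective (hubCode (Γ := Γ) (C := C) (D := D)) := by
  rintro (v | c | ⟨c, t⟩) (v' | c' | ⟨c', t'⟩) h
  · rw [ladderCode_injective h]
  iterate 2
    · have := ladderCode_lt v
      rw [show ladderCode v 0 = _ from congrFun h 0] at this
      simp [hubCode] at this
  · have := ladderCode_lt v'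
    rw [show ladderCode v' 0 = _ from (congrFun h 0).symm] at this
    simp [hubCode] at this
  · simp [hubCode, Fin.val_inj] at h
    rw [h]
  · simp [hubCode] at h
  · have := ladderCode_lt v'
    rw [show ladderCode v' 0 = _ from (congrFun h 0).symm] at this
    simp [hubCode] at this
  · simp [hubCode] at h
  · simp [hubCode, Fin.val_inj] at h
    obtain ⟨rfl, h⟩ := h
    obtain rfl := Fin.ext h
    rfl

theorem gameRelC_ladderCode {k k' : Fin (Γ.N * Γ.N)} {s t s' t' : Bool} {x x' : Γ.Vertex} :
    gameRelC Γ.encode (ladderCode (.inr (k, s, t, x))) (ladderCode (.inr (k', s', t', x'))) ↔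
      Γ.graph.Adj x x' := by
  obtain a | ⟨r, i⟩ := x <;> obtain a' | ⟨r', i'⟩ := x'
  · change _ ↔ a.1 = a'.1 ∧ a ≠ a'
    simp [gameRelC, ladderCode, sigma_fin_eq_iff, Fin.val_inj]
    tauto
  · change _ ↔ a = ⟨i', r' i'⟩
    simp [gameRelC, ladderCode, sigma_fin_eq_iff, Fin.val_inj, wordAct_rowIndex]
  · change _ ↔ a' = ⟨i, r i⟩
    simp [gameRelC, ladderCode, sigma_fin_eq_iff, Fin.val_inj, wordAct_rowIndex]
  · change _ ↔ r = r' ∧ i ≠ i'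
    simp [gameRelC, ladderCode, Fin.val_inj, Game.rowIndex_inj]

theorem ladderCode_inr {k : Fin (Γ.N * Γ.N)} {s t : Bool} {x : Γ.Vertex} :
    (ladderCode (.inr (k, s, t, x)) 0 = 1 ∨ ladderCode (.inr (k, s, t, x)) 0 = 2) ∧
      ladderCode (.inr (k, s, t, x)) 1 = k ∧ ladderCode (.inr (k, s, t, x)) 2 = s.toNat ∧
      ladderCode (.inr (k, s, t, x)) 3 = t.toNat := by
  obtain a | ⟨r, i⟩ := x <;> simp [ladderCode]

theorem ladderCode_inl {k : Fin (Γ.N * Γ.N + 1)} {s : Bool} :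
    ladderCode (Γ := Γ) (.inl (k, s)) 0 = 0 ∧ ladderCode (Γ := Γ) (.inl (k, s)) 1 = k ∧
      ladderCode (Γ := Γ) (.inl (k, s)) 2 = s.toNat := by
  simp [ladderCode]

theorem ladderRelC_ladderCode (u v : LadderVertex (Γ.N * Γ.N) Γ.Vertex) :
    ladderRelC Γ.encode (ladderCode u) (ladderCode v) ↔ ladderRel Γ.graph u v := by
  obtain ⟨k, s⟩ | ⟨k, s, t, x⟩ := u <;> obtain ⟨k', s'⟩ | ⟨k', s', t', x'⟩ := v
  · simp [ladderRelC, gameRelC, ladderRel, ladderCode]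
  · obtain ⟨e0, e1, e2, e3⟩ := ladderCode_inr (k := k') (s := s') (t := t') (x := x')
    obtain ⟨f0, f1, f2⟩ := ladderCode_inl (Γ := Γ) (k := k) (s := s)
    have e0' : ladderCode (.inr (k', s', t', x')) 0 ≠ 0 := by omega
    simp only [ladderRelC, gameRelC, ladderRel, e0, e1, e2, e3, f0, f1, f2, toNat_inj]
    simp
  · obtain ⟨e0, e1, e2, e3⟩ := ladderCode_inr (k := k) (s := s) (t := t) (x := x)
    obtain ⟨f0, f1, f2⟩ := ladderCode_inl (Γ := Γ) (k := k') (s := s')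
    simp only [ladderRelC, gameRelC, ladderRel, f0]
    simp
  · obtain ⟨e0, e1, e2, e3⟩ := ladderCode_inr (k := k) (s := s) (t := t) (x := x)
    obtain ⟨f0, f1, f2, f3⟩ := ladderCode_inr (k := k') (s := s') (t := t') (x := x')
    have e0' : ladderCode (.inr (k, s, t, x)) 0 ≠ 0 := by omega
    simp only [ladderRelC, ladderRel, gameRelC_ladderCode, e0', e1, e2, e3, f1, f2, f3, toNat_inj,
      Fin.val_inj]
    tauto

/-- The payoff labels of a game. -/
def Game.payoffLabel (Γ : Game) (e : Γ.Profile × Fin Γ.N) (c : ℕ) : Prop :=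
  wordLabel Γ.encode.length (numWord (Γ.u e.2 e.1)) (denWord (Γ.u e.2 e.1)) c

theorem markC_ladderCode {k : Fin (Γ.N * Γ.N)} {s t : Bool} {x : Γ.Vertex} :
    markC Γ.encode (ladderCode (.inr (k, s, t, x))) ↔ Game.mark k (s != t) x := by
  obtain a | ⟨r, i⟩ := x
  · simp only [markC, wordN_encode, ladderCode]
    cases s <;> cases t <;> simp [Game.mark]
  · simp only [markC, ladderCode]
    cases s <;> cases t <;> simp [Game.mark]

theorem labelC_ladderCode (ε : Bool) (v : LadderVertex (Γ.N * Γ.N) Γ.Vertex) (c : ℕ) :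
    labelC Γ.encode (ladderCode v) ε.toNat c ↔
      ladderLab (Γ.N * Γ.N) Game.mark (Game.label Γ.payoffLabel) ε v c := by
  obtain ⟨k, s⟩ | ⟨k, s, t, x⟩ := v
  · obtain ⟨f0, f1, f2⟩ := ladderCode_inl (Γ := Γ) (k := k) (s := s)
    have : s.toNat = 0 ↔ s = false := by cases s <;> simp
    simp only [labelC, f0, f1, f2, ladderLab, wordN_encode, toNat_inj, this]
    simp
  · obtain ⟨e0, e1, e2, e3⟩ := ladderCode_inr (k := k) (s := s) (t := t) (x := x)
    have e0' : ladderCode (.inr (k, s, t, x)) 0 ≠ 0 := by omega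
    simp only [labelC, markC_ladderCode, e0, e0', e1, ladderLab, wordN_encode, false_and, false_or,
      true_and]
    refine or_congr_right (or_congr_right (or_congr_right (or_congr_right ?_)))
    obtain a | ⟨r, i⟩ := x
    · simp [ladderCode, Game.label]
    · simp only [ladderCode, Game.label, Game.payoffLabel, wordLabel, payoffC, wordN_encode]
      simp [wordNum_rowIndex, wordDen_rowIndex]
      -- Payoff labels are shifted by one inside `Game.label`, since label 0 there means an action;
      -- this is the `+ 1` in `payoffC`.
      constructor
      · rintro ⟨t, ht, ⟨rfl, h⟩ | ⟨rfl, h⟩ | ⟨rfl, h⟩ | ⟨rfl, h⟩⟩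
        · exact ⟨4 * t, by omega, t, ht, .inl ⟨rfl, h⟩⟩
        · exact ⟨4 * t + 1, by omega, t, ht, .inr (.inl ⟨rfl, h⟩)⟩
        · exact ⟨4 * t + 2, by omega, t, ht, .inr (.inr (.inl ⟨rfl, h⟩))⟩
        · exact ⟨4 * t + 3, by omega, t, ht, .inr (.inr (.inr ⟨rfl, h⟩))⟩
      · rintro ⟨_, rfl, t, ht, ⟨rfl, h⟩ | ⟨rfl, h⟩ | ⟨rfl, h⟩ | ⟨rfl, h⟩⟩
        · exact ⟨t, ht, .inl ⟨by omega, h⟩⟩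
        · exact ⟨t, ht, .inr (.inl ⟨by omega, h⟩)⟩
        · exact ⟨t, ht, .inr (.inr (.inl ⟨by omega, h⟩))⟩
        · exact ⟨t, ht, .inr (.inr (.inr ⟨by omega, h⟩))⟩

/-- The graph that represents a game; `ε` is the side of the last node of the ladder. -/
def Game.hubGraph (Γ : Game) (C D : ℕ) (ε : Bool) :
    SimpleGraph (HubVertex (LadderVertex (Γ.N * Γ.N) Γ.Vertex) C D) :=
  GameSym.hubGraph C D (ladderGraph (Γ.N * Γ.N) Γ.graph)
    (ladderLab (Γ.N * Γ.N) Game.mark (Game.label Γ.payoffLabel) ε)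

theorem hubRelC_hubCode (ε : Bool) (x y : HubVertex (LadderVertex (Γ.N * Γ.N) Γ.Vertex) C D) :
    hubRelC Γ.encode (hubCode x) (hubCode y) ε.toNat ↔
      hubRel (ladderGraph (Γ.N * Γ.N) Γ.graph)
        (ladderLab (Γ.N * Γ.N) Game.mark (Game.label Γ.payoffLabel) ε) x y := by
  obtain v | c | ⟨c, t⟩ := x <;> obtain v' | c' | ⟨c', t'⟩ := y
  · have h := ladderCode_lt v
    have h' := ladderCode_lt v'
    have h3 : ladderCode v' 0 ≠ 3 := by omega
    have h3' : ladderCode v 0 ≠ 3 := by omega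
    simp only [hubRelC, hubCode, h, h', h3, h3', neC_iff, ladderRelC_ladderCode, hubRel,
      ladderGraph, SimpleGraph.fromRel_adj, ladderCode_injective.ne_iff]
    simp
  · have h := ladderCode_lt v
    have h3' : ladderCode v 0 ≠ 3 := by omega
    simp [hubRelC, hubCode, h, h3', hubRel, labelC_ladderCode]
  · have h3' : ladderCode v 0 ≠ 3 := by have := ladderCode_lt v; omega
    simp [hubRelC, hubCode, h3', hubRel]
  · simp [hubRelC, hubCode, hubRel]
    have := ladderCode_lt v'
    omega
  · simp [hubRelC, hubCode, hubRel]
  · simp [hubRelC, hubCode, hubRel, Fin.val_inj]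
  · simp [hubRelC, hubCode, hubRel]
  · simp [hubRelC, hubCode, hubRel]
  · simp [hubRelC, hubCode, hubRel]

theorem adjC_hubCode (ε : Bool) (x y : HubVertex (LadderVertex (Γ.N * Γ.N) Γ.Vertex) C D) :
    adjC Γ.encode (hubCode x) (hubCode y) ε.toNat ↔ (Γ.hubGraph C D ε).Adj x y := by
  simp only [adjC, neC_iff, hubRelC_hubCode, Game.hubGraph, hubGraph, SimpleGraph.fromRel_adj,
    hubCode_injective.ne_iff]

theorem validLadderC_iff (v : Fin 6 → ℕ) :
    validLadderC Γ.encode v ↔ ∃ x : LadderVertex (Γ.N * Γ.N) Γ.Vertex, ladderCode x = v := by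
  constructor
  · have hbool : ∀ n < 2, ∃ s : Bool, s.toNat = n := by
      intro n hn
      interval_cases n
      · exact ⟨false, rfl⟩
      · exact ⟨true, rfl⟩
    rintro (⟨⟨h0, h3, h4, h5⟩, h1, h2⟩ | ⟨h0, ⟨h1, h2, h3⟩, h4, h5⟩ | ⟨h0, ⟨h1, h2, h3⟩, h4, h5⟩)
    · rw [wordN_encode] at h1
      obtain ⟨s, hs⟩ := hbool _ h2
      exact ⟨.inl (⟨v 1, h1⟩, s), code_eq_iff.2 (by simp [ladderCode, h0, h3, h4, h5, hs])⟩
    · rw [wordN_encode] at h1 h4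
      obtain ⟨s, hs⟩ := hbool _ h2
      obtain ⟨t, ht⟩ := hbool _ h3
      rw [show v 4 = (⟨v 4, h4⟩ : Fin Γ.N).val from rfl, wordM_encode] at h5
      exact ⟨.inr (⟨v 1, h1⟩, s, t, .inl ⟨⟨v 4, h4⟩, ⟨v 5, h5⟩⟩),
        code_eq_iff.2 (by simp [ladderCode, h0, hs, ht])⟩
    · rw [wordN_encode] at h1 h5
      rw [wordR_encode] at h4
      obtain ⟨s, hs⟩ := hbool _ h2
      obtain ⟨t, ht⟩ := hbool _ h3
      exact ⟨.inr (⟨v 1, h1⟩, s, t, .inr ((profiles Γ.N Γ.m)[v 4], ⟨v 5, h5⟩)),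
        code_eq_iff.2 (by simp [ladderCode, h0, hs, ht, Game.rowIndex_getElem])⟩
  · rintro ⟨⟨k, s⟩ | ⟨k, s, t, a | ⟨r, i⟩⟩, rfl⟩
    · have := Bool.toNat_lt s
      have := k.2
      simp [validLadderC, ladderCode, wordN_encode, *]
    · have := Bool.toNat_lt s
      have := Bool.toNat_lt t
      simp [validLadderC, ladderCode, wordN_encode, wordM_encode, *]
    · have := Bool.toNat_lt s
      have := Bool.toNat_lt t
      simp [validLadderC, ladderCode, wordN_encode, wordR_encode, Game.rowIndex_lt, *]

theorem validC_iff (v : Fin 6 → ℕ) : validC Γ.encode v C D ↔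
    ∃ x : HubVertex (LadderVertex (Γ.N * Γ.N) Γ.Vertex) C D, hubCode x = v := by
  rw [validC, validLadderC_iff]
  constructor
  · rintro (⟨x, rfl⟩ | ⟨⟨h0, h2, h3, h4, h5⟩, h1⟩ | ⟨⟨h0, h3, h4, h5⟩, h1, h2⟩)
    · exact ⟨.inl x, rfl⟩
    · exact ⟨.inr (.inl ⟨v 1, h1⟩), code_eq_iff.2 (by simp [hubCode, h0, h2, h3, h4, h5])⟩
    · exact ⟨.inr (.inr ⟨⟨v 1, h1⟩, ⟨v 2, h2⟩⟩),
        code_eq_iff.2 (by simp [hubCode, h0, h3, h4, h5])⟩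
  · rintro ⟨x | c | ⟨c, t⟩, rfl⟩
    · exact .inl ⟨x, rfl⟩
    · right; left
      simp [hubCode]
    · right; right
      simp [hubCode]

end VertexCodes

end GameSym

namespace GameSym

open Computability Turing

/-! ### Bounds on codes, and the two graphs of a game -/

section Sizes

/-- A bound for the entries of the codes of the vertices of the ladder. -/
def ladderBound (w : List Γ') : ℕ := wordN w * wordN w + w.length + 6

/-- The number of labels. -/
def labelCount (w : List Γ') : ℕ := 7 + wordN w * wordN w + (4 * w.length + 1)

/-- The unit for the numbers of leaves at the hubs. -/
def hubUnit (w : List Γ') : ℕ :=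
  ladderBound w * ladderBound w * ladderBound w * ladderBound w * ladderBound w * ladderBound w +
    labelCount w + 1

/-- A bound for the entries of the codes of the vertices of the hub graph. -/
def hubBound (w : List Γ') : ℕ := labelCount w * hubUnit w + ladderBound w

theorem validLadderC.lt {w : List Γ'} {v : Fin 6 → ℕ} (h : validLadderC w v) (i : Fin 6) :
    v i < ladderBound w := by
  have hN := wordN_le w
  have hR := wordR_le w
  have hM := wordM_le w (v 4)
  unfold ladderBound
  revert i
  simp only [Fin.forall_fin_succ]
  unfold validLadderC at h
  -- The product becomes an atom, so that the bounds are linear.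
  generalize wordN w * wordN w = K at *
  refine ⟨?_, ?_, ?_, ?_, ?_, ?_, fun i => i.elim0⟩
  · change v 0 < _
    omega
  · change v 1 < _
    omega
  · change v 2 < _
    omega
  · change v 3 < _
    omega
  · change v 4 < _
    omega
  · change v 5 < _
    omega

/-- Ensures that enumerating all tuples below `hubBound` misses no vertex. -/
theorem validC.lt {w : List Γ'} {v : Fin 6 → ℕ} (h : validC w v (labelCount w) (hubUnit w))
    (i : Fin 6) : v i < hubBound w := by
  obtain h | ⟨⟨h0, h2, h3, h4, h5⟩, h1⟩ | ⟨⟨h0, h3, h4, h5⟩, h1, h2⟩ := h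
  · exact (h.lt i).trans_le (Nat.le_add_left _ _)
  all_goals
    have hb : 6 ≤ ladderBound w := Nat.le_add_left _ _
    have hC : labelCount w ≤ labelCount w * hubUnit w :=
      Nat.le_mul_of_pos_right _ (Nat.succ_pos _)
    have hD : (v 1 + 1) * hubUnit w ≤ labelCount w * hubUnit w := Nat.mul_le_mul_right _ h1
    unfold hubBound
    revert i
    simp only [Fin.forall_fin_succ]
    refine ⟨?_, ?_, ?_, ?_, ?_, ?_, fun i => i.elim0⟩
    · change v 0 < _
      omega
    · change v 1 < _
      omega
    · change v 2 < _
      omega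
    · change v 3 < _
      omega
    · change v 4 < _
      omega
    · change v 5 < _
      omega

variable (Γ : Game)

/-- Codes embed the vertices into the 6-tuples below `ladderBound`, so the sixth power bounds their
number. This explains `hubUnit`: a crude bound computable from the word replaces the exact count. -/
theorem card_ladder_lt :
    Nat.card (LadderVertex (Γ.N * Γ.N) Γ.Vertex) + labelCount Γ.encode < hubUnit Γ.encode := by
  have h : Nat.card (LadderVertex (Γ.N * Γ.N) Γ.Vertex) ≤
      Nat.card (Fin 6 → Fin (ladderBound Γ.encode)) := by
    refine Nat.card_le_card_of_injective (fun x i =>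
      ⟨ladderCode x i, ((validLadderC_iff _).2 ⟨x, rfl⟩).lt i⟩) fun x y hxy => ?_
    refine ladderCode_injective (funext fun i => ?_)
    simpa using congrFun hxy i
  rw [Nat.card_fun, Nat.card_fin, Nat.card_fin] at h
  have e : ∀ b : ℕ, b ^ 6 = b * b * b * b * b * b := fun b => by ring
  rw [e] at h
  unfold hubUnit
  omega

/-- Numerator and denominator words are blocks of the code, so its length is a valid bound for both.
-/
theorem payoffLabel_iff (e e' : Γ.Profile × Fin Γ.N) :
    (∀ q < 4 * Γ.encode.length, Γ.payoffLabel e q ↔ Γ.payoffLabel e' q) ↔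
      Γ.u e.2 e.1 = Γ.u e'.2 e'.1 := by
  have h1 : ∀ (i : Fin Γ.N) a, (numWord (Γ.u i a)).length ≤ Γ.encode.length := fun i a => by
    rw [← wordNum_rowIndex]
    exact (blk_length_le _ _ _).trans (blk_length_le _ _ _)
  have h2 : ∀ (i : Fin Γ.N) a, (denWord (Γ.u i a)).length ≤ Γ.encode.length := fun i a => by
    rw [← wordDen_rowIndex]
    exact (blk_length_le _ _ _).trans (blk_length_le _ _ _)
  exact wordLabel_rat_iff (h1 _ _) (h2 _ _) (h1 _ _) (h2 _ _)

/-- The two graphs of a game are isomorphic if and only if the game has a symmetry that is not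
player-separable. -/
theorem game_hubGraph_iso_iff :
    Nonempty (Γ.hubGraph (labelCount Γ.encode) (hubUnit Γ.encode) false ≃g
      Γ.hubGraph (labelCount Γ.encode) (hubUnit Γ.encode) true) ↔
      ∃ S : Γ.Symmetry, ¬S.PlayerSeparable := by
  have h0 : ∀ ε, ∀ v : LadderVertex (Γ.N * Γ.N) Γ.Vertex,
      ladderLab (Γ.N * Γ.N) Game.mark (Game.label Γ.payoffLabel) ε v 0 ∧
      ladderLab (Γ.N * Γ.N) Game.mark (Game.label Γ.payoffLabel) ε v 1 := by
    rintro ε (v | v) <;> exact ⟨.inl rfl, .inr (.inl rfl)⟩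
  have hC : labelCount Γ.encode = 7 + Γ.N * Γ.N + (4 * Γ.encode.length + 1) := by
    rw [labelCount, wordN_encode]
  rw [Game.hubGraph, Game.hubGraph, hubGraph_iso_iff (by omega) (card_ladder_lt Γ)
    (fun v => (h0 _ v).1) (fun v => (h0 _ v).2), hC]
  constructor
  · rintro ⟨σ, hσ⟩
    obtain ⟨k, hk, τ, h1, h2⟩ := exists_of_ladder_iso σ hσ
    exact exists_symmetry_of_graph_iso (payoffLabel_iff Γ) hk τ h1 h2
  · rintro ⟨S, hS⟩
    obtain ⟨k, hk, τ, h1, h2⟩ := exists_graph_iso_of_symmetry (payoffLabel_iff Γ) S hS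
    exact exists_ladder_iso hk τ h1 h2

end Sizes

/-! ### Printing adjacency matrices over enumerated codes -/

section GraphWords

/-- All tuples of length `n` with entries less than `B`. -/
def tuples (n B : ℕ) : List (Fin n → ℕ) := (profiles n fun _ => B).map fun v i => (v i).val

theorem tuples_zero_flatMap {β : Type} (B : ℕ) (g : (Fin 0 → ℕ) → List β) :
    (tuples 0 B).flatMap g = g ![] := by
  simp only [tuples, profiles, List.map_cons, List.map_nil, List.flatMap_cons, List.flatMap_nil,
    List.append_nil]
  exact congrArg g (Subsingleton.elim _ _)

/-- Unfolds the enumeration of tuples into nested loops over ranges, the form that programs can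
execute. -/
theorem tuples_succ_flatMap {β : Type} (n B : ℕ) (g : (Fin (n + 1) → ℕ) → List β) :
    (tuples (n + 1) B).flatMap g =
      (List.range B).flatMap fun a => (tuples n B).flatMap fun v => g (Matrix.vecCons a v) := by
  rw [← flatMap_finRange, tuples, List.flatMap_map, profiles, List.flatMap_assoc]
  refine congrArg (fun f => (List.finRange B).flatMap f) (funext fun a => ?_)
  rw [List.flatMap_map, tuples, List.flatMap_map]
  refine congrArg (fun f => (profiles n fun _ => B).flatMap f) (funext fun v => congrArg g ?_)
  funext i
  refine Fin.cases ?_ (fun i => ?_) i <;> simp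

theorem mem_tuples {n B : ℕ} {v : Fin n → ℕ} : v ∈ tuples n B ↔ ∀ i, v i < B := by
  rw [tuples, List.mem_map]
  constructor
  · rintro ⟨a, -, rfl⟩ i
    exact (a i).2
  · intro h
    exact ⟨fun i => ⟨v i, h i⟩, mem_profiles _ _ _, rfl⟩

theorem tuples_nodup (n B : ℕ) : (tuples n B).Nodup :=
  (profiles_nodup _ _).map fun _ _ h => funext fun i => Fin.ext (congrFun h i)

open Classical in
/-- The adjacency matrix of a relation on a list. -/
noncomputable def relWord {A : Type} (L : List A) (adj : A → A → Prop) : List Γ' :=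
  L.flatMap fun v => (L.flatMap fun v' =>
    if adj v v' then [Γ'.bit true] else [Γ'.bit false]) ++ [Γ'.comma]

/-- Vertices are numbered by the positions of their codes in the list, and the graph is pulled back
along this numbering. -/
theorem exists_finGraph {W A : Type} (H : SimpleGraph W) (c : W → A) (hc : Function.Injective c)
    (L : List A) (hL : L.Nodup) (hmem : ∀ v, v ∈ L ↔ ∃ x, c x = v) (adj : A → A → Prop)
    (hadj : ∀ x y, adj (c x) (c y) ↔ H.Adj x y) :
    ∃ G : FinGraph, Nonempty (G.graph ≃g H) ∧ G.encode = relWord L adj := by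
  have hx : ∀ i : Fin L.length, ∃ x, c x = L.get i := fun i => (hmem _).1 (L.get_mem i)
  choose x hx using hx
  have hbij : Function.Bijective x := by
    constructor
    · intro i j h
      refine hL.injective_get ?_
      rw [← hx, ← hx, h]
    · intro y
      obtain ⟨i, hi⟩ := List.mem_iff_get.1 ((hmem (c y)).2 ⟨y, rfl⟩)
      exact ⟨i, hc (by rw [hx, hi])⟩
  refine ⟨⟨L.length, H.comap x⟩, ⟨⟨Equiv.ofBijective x hbij, Iff.rfl⟩⟩, ?_⟩
  have hmap : (List.finRange L.length).map L.get = L := by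
    apply List.ext_getElem <;> simp
  have hfin : ∀ g : A → List Γ', L.flatMap g =
      (List.finRange L.length).flatMap fun i => g (L.get i) := fun g => by
    conv_lhs => rw [← hmap, List.flatMap_map]
  rw [relWord, hfin, FinGraph.encode]
  refine congrArg (fun f => (List.finRange L.length).flatMap f) (funext fun i => ?_)
  rw [hfin, encodeBits, List.map_map, List.map_eq_flatMap]
  refine congrArg (fun f => (List.finRange L.length).flatMap f ++ [Γ'.comma]) (funext fun j => ?_)
  have : adj (L.get i) (L.get j) ↔ H.Adj (x i) (x j) := by rw [← hx, ← hx, hadj]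
  by_cases h : H.Adj (x i) (x j)
  · rw [if_pos (this.2 h)]
    simp [h]
  · rw [if_neg (this.not.2 h)]
    simp [h]

open Classical in
/-- The valid tuples. -/
noncomputable def codeList (n B : ℕ) (valid : (Fin n → ℕ) → Prop) : List (Fin n → ℕ) :=
  (tuples n B).filter fun v => valid v

theorem codeList_nodup (n B : ℕ) (valid : (Fin n → ℕ) → Prop) : (codeList n B valid).Nodup :=
  (tuples_nodup n B).filter _

theorem mem_codeList {n B : ℕ} {valid : (Fin n → ℕ) → Prop} {v : Fin n → ℕ} :
    v ∈ codeList n B valid ↔ (∀ i, v i < B) ∧ valid v := by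
  simp only [codeList, List.mem_filter, mem_tuples, decide_eq_true_eq]

open Classical in
theorem codeList_flatMap {β : Type} (n B : ℕ) (valid : (Fin n → ℕ) → Prop)
    (g : (Fin n → ℕ) → List β) : (codeList n B valid).flatMap g =
      (tuples n B).flatMap fun v => if valid v then g v else [] := by
  rw [codeList]
  induction tuples n B with
  | nil => rfl
  | cons v l ih =>
    by_cases h : valid v <;> simp [h, ih]

/-- The list of the codes of the vertices of the graphs of a game. -/
noncomputable def vertexList (w : List Γ') : List (Fin 6 → ℕ) :=
  codeList 6 (hubBound w) fun v => validC w v (labelCount w) (hubUnit w)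

/-- The code of a graph of a game, obtained from the code of the game. -/
noncomputable def graphWord (ε : ℕ) (w : List Γ') : List Γ' :=
  relWord (vertexList w) fun v v' => adjC w v v' ε

theorem exists_finGraph_game (Γ : Game) (ε : Bool) :
    ∃ G : FinGraph, Nonempty (G.graph ≃g
        Γ.hubGraph (labelCount Γ.encode) (hubUnit Γ.encode) ε) ∧
      G.encode = graphWord ε.toNat Γ.encode := by
  refine exists_finGraph _ hubCode hubCode_injective _ (codeList_nodup _ _ _) (fun v => ?_) _
    (adjC_hubCode ε)
  rw [mem_codeList, ← validC_iff]
  exact ⟨fun h => h.2, fun h => ⟨h.lt, h⟩⟩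

end GraphWords

/-! ### Definability of the relations on codes and of the reduction -/

section Definability

open Ctx (inp)

variable {X β : Type} [Ctx Γ' X]

theorem PF.wordN : PF fun x : X => wordN (inp x) :=
  PF.symCount (PL.inp.blk _ (PF.const 0)) _

theorem PF.wordR : PF fun x : X => wordR (inp x) := (PF.symCount PL.inp _).sub (PF.const 1)

theorem PF.wordM {i : X → ℕ} (hi : PF i) : PF fun x => wordM (inp x) (i x) :=
  ((PL.inp.blk _ (PF.const 0)).blk _ hi).length

theorem PL.row {r : X → ℕ} (hr : PF r) : PL fun x => GameSym.blk Γ'.ket (Ctx.inp x) (r x + 1) :=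
  PL.inp.blk _ (hr.add (PF.const 1))

theorem PF.wordAct {r i : X → ℕ} (hr : PF r) (hi : PF i) :
    PF fun x => wordAct (inp x) (r x) (i x) :=
  ((PL.row hr).blk _ hi).length

theorem PL.wordNum {r i : X → ℕ} (hr : PF r) (hi : PF i) :
    PL fun x => wordNum (Ctx.inp x) (r x) (i x) :=
  (PL.row hr).blk _ (PF.wordN.add ((PF.const 2).mul hi))

theorem PL.wordDen {r i : X → ℕ} (hr : PF r) (hi : PF i) :
    PL fun x => wordDen (Ctx.inp x) (r x) (i x) :=
  (PL.row hr).blk _ (PF.wordN.add (((PF.const 2).mul hi).add (PF.const 1)))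

theorem PF.inp_length : PF fun x : X => (inp x).length := PL.inp.length

theorem PF.ladderBound : PF fun x : X => ladderBound (inp x) :=
  ((PF.wordN.mul PF.wordN).add PF.inp_length).add (PF.const 6)

theorem PF.labelCount : PF fun x : X => labelCount (inp x) :=
  ((PF.const 7).add (PF.wordN.mul PF.wordN)).add (((PF.const 4).mul PF.inp_length).add (PF.const 1))

theorem PF.hubUnit : PF fun x : X => hubUnit (inp x) := by
  have h : PF fun x : X => GameSym.ladderBound (inp x) := PF.ladderBound
  exact ((((((h.mul h).mul h).mul h).mul h).mul h).add PF.labelCount).add (PF.const 1)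

theorem PF.hubBound : PF fun x : X => hubBound (inp x) :=
  (PF.labelCount.mul PF.hubUnit).add PF.ladderBound

variable {v v' : X → Fin 6 → ℕ} {c : X → ℕ}

theorem PP.neC (hv : ∀ i, PF fun x => v x i) (hv' : ∀ i, PF fun x => v' x i) :
    PP fun x => neC (v x) (v' x) := by
  have h := fun i => PP.eq (hv i) (hv' i)
  exact PP.not (PP.and (h 0) (PP.and (h 1) (PP.and (h 2) (PP.and (h 3) (PP.and (h 4) (h 5))))))

theorem PP.gameRelC (hv : ∀ i, PF fun x => v x i) (hv' : ∀ i, PF fun x => v' x i) :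
    PP fun x => gameRelC (inp x) (v x) (v' x) := by
  have k := fun i n => PP.eq (hv i) (PF.const n)
  have k' := fun i n => PP.eq (hv' i) (PF.const n)
  have h := fun i => PP.eq (hv i) (hv' i)
  have h5 := PP.ne (hv 5) (hv' 5)
  unfold GameSym.gameRelC
  refine PP.or (PP.and (PP.and (k 0 1) (k' 0 1)) (PP.and (h 4) h5))
    (PP.or (PP.and (PP.and (k 0 2) (k' 0 2)) (PP.and (h 4) h5))
    (PP.or (PP.and (PP.and (k 0 1) (k' 0 2)) (PP.and ?_ ?_))
      (PP.and (PP.and (k 0 2) (k' 0 1)) (PP.and ?_ ?_))))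
  · exact PP.eq (hv 4) (hv' 5)
  · exact PP.eq (hv 5) (PF.wordAct (hv' 4) (hv' 5))
  · exact PP.eq (hv' 4) (hv 5)
  · exact PP.eq (hv' 5) (PF.wordAct (hv 4) (hv 5))

theorem PP.ladderRelC (hv : ∀ i, PF fun x => v x i) (hv' : ∀ i, PF fun x => v' x i) :
    PP fun x => ladderRelC (inp x) (v x) (v' x) := by
  have k := fun i n => PP.eq (hv i) (PF.const n)
  have k' := fun i n => PP.eq (hv' i) (PF.const n)
  have h := fun i => PP.eq (hv i) (hv' i)
  unfold GameSym.ladderRelC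
  refine PP.or (PP.and (PP.and (k 0 0) (PP.or (k' 0 1) (k' 0 2)))
    (PP.or (PP.and (h 1) (h 2)) (PP.and ?_ ?_)))
    (PP.and (PP.and (h 1) (PP.and (h 2) (h 3))) (PP.gameRelC hv hv'))
  · exact PP.eq (hv 1) ((hv' 1).add (PF.const 1))
  · exact PP.eq (hv 2) (hv' 3)

theorem PP.markC (hv : ∀ i, PF fun x => v x i) : PP fun x => markC (inp x) (v x) := by
  have hN : PF fun x : X => GameSym.wordN (inp x) := PF.wordN
  unfold GameSym.markC
  refine PP.and (PP.eq (hv 0) (PF.const 1)) (PP.or (PP.and (PP.eq (hv 2) (hv 3)) ?_)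
    (PP.and (PP.ne (hv 2) (hv 3)) ?_))
  · refine PP.ex hN ?_
    exact PP.eq (hv 1).fst (((hv 4).fst.mul hN.fst).add PF.snd)
  · refine PP.ex hN (PP.and ?_ ?_)
    · exact PP.eq (hv 1).fst ((PF.snd.mul hN.fst).add (hv 4).fst)
    · exact PP.ne PF.snd (hv 4).fst

theorem PP.payoffC (hv : ∀ i, PF fun x => v x i) (hc : PF c) :
    PP fun x => payoffC (inp x) (v x) (c x) := by
  have hK : PF fun y : X × ℕ => 7 + GameSym.wordN (inp y) * GameSym.wordN (inp y) + 1 + 4 * y.2 :=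
    (((PF.const 7).add (PF.wordN.mul PF.wordN)).add (PF.const 1)).add ((PF.const 4).mul PF.snd)
  have hn : PL fun y : X × ℕ => GameSym.wordNum (inp y) (v y.1 4) (v y.1 5) :=
    PL.wordNum (hv 4).fst (hv 5).fst
  have hd : PL fun y : X × ℕ => GameSym.wordDen (inp y) (v y.1 4) (v y.1 5) :=
    PL.wordDen (hv 4).fst (hv 5).fst
  unfold GameSym.payoffC
  refine PP.ex PF.inp_length (PP.or (PP.and ?_ ?_) (PP.or (PP.and ?_ ?_) (PP.or (PP.and ?_ ?_)
    (PP.and ?_ ?_))))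
  · exact PP.eq hc.fst hK
  · exact hn.get PF.snd _
  · exact PP.eq hc.fst (hK.add (PF.const 1))
  · exact hn.get PF.snd _
  · exact PP.eq hc.fst (hK.add (PF.const 2))
  · exact hd.get PF.snd _
  · exact PP.eq hc.fst (hK.add (PF.const 3))
  · exact hd.get PF.snd _

theorem PP.labelC (ε : ℕ) (hv : ∀ i, PF fun x => v x i) (hc : PF c) :
    PP fun x => labelC (inp x) (v x) ε (c x) := by
  have hK : PF fun x : X => GameSym.wordN (inp x) * GameSym.wordN (inp x) := PF.wordN.mul PF.wordN
  have k := fun i n => PP.eq (hv i) (PF.const n)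
  have e := fun n => PP.eq hc (PF.const n)
  have h6 := PP.eq hc ((PF.const 6).add (hv 1))
  unfold GameSym.labelC
  refine PP.or (PP.and (k 0 0) (PP.or (e 0) (PP.or (e 1) (PP.or (e 2)
    (PP.or (PP.and (e 3) (PP.and (k 1 0) (k 2 0)))
    (PP.or (PP.and (e 4) (PP.and ?_ (k 2 ε))) h6))))))
    (PP.and (PP.or (k 0 1) (k 0 2)) (PP.or (e 0) (PP.or (e 1)
    (PP.or (PP.and (e 5) (PP.markC hv)) (PP.or h6 (PP.or (PP.and (k 0 1) ?_)
    (PP.and (k 0 2) (PP.payoffC hv hc))))))))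
  · exact PP.eq (hv 1) hK
  · exact PP.eq hc ((PF.const 7).add hK)

theorem PP.hubRelC (ε : ℕ) (hv : ∀ i, PF fun x => v x i) (hv' : ∀ i, PF fun x => v' x i) :
    PP fun x => hubRelC (inp x) (v x) (v' x) ε := by
  have k := PP.eq (hv 0) (PF.const 3)
  have k' := fun n => PP.eq (hv' 0) (PF.const n)
  have l := PP.lt (hv 0) (PF.const 3)
  have l' := PP.lt (hv' 0) (PF.const 3)
  unfold GameSym.hubRelC
  exact PP.or (PP.and (PP.and l l') (PP.and (PP.neC hv hv') (PP.or (PP.ladderRelC hv hv')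
    (PP.ladderRelC hv' hv)))) (PP.or (PP.and (PP.and l (k' 3)) (PP.labelC ε hv (hv' 1)))
    (PP.and (PP.and k (k' 4)) (PP.eq (hv 1) (hv' 1))))

theorem PP.adjC (ε : ℕ) (hv : ∀ i, PF fun x => v x i) (hv' : ∀ i, PF fun x => v' x i) :
    PP fun x => adjC (inp x) (v x) (v' x) ε :=
  PP.and (PP.neC hv hv') (PP.or (PP.hubRelC ε hv hv') (PP.hubRelC ε hv' hv))

theorem PP.validC (hv : ∀ i, PF fun x => v x i) :
    PP fun x => validC (inp x) (v x) (labelCount (inp x)) (hubUnit (inp x)) := by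
  have hN : PF fun x : X => GameSym.wordN (inp x) := PF.wordN
  have hC : PF fun x : X => GameSym.labelCount (inp x) := PF.labelCount
  have hD : PF fun x : X => GameSym.hubUnit (inp x) := PF.hubUnit
  have k := fun i n => PP.eq (hv i) (PF.const n)
  have l := fun i => PP.lt (hv i) (PF.const 2)
  have lK := PP.lt (hv 1) (hN.mul hN)
  have lN := fun i => PP.lt (hv i) hN
  have lC := PP.lt (hv 1) hC
  unfold GameSym.validC validLadderC
  refine PP.or (PP.or (PP.and (PP.and (k 0 0) (PP.and (k 3 0) (PP.and (k 4 0) (k 5 0))))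
      (PP.and ?_ (l 2)))
    (PP.or (PP.and (k 0 1) (PP.and (PP.and lK (PP.and (l 2) (l 3))) (PP.and (lN 4) ?_)))
      (PP.and (k 0 2) (PP.and (PP.and lK (PP.and (l 2) (l 3))) (PP.and ?_ (lN 5))))))
    (PP.or (PP.and (PP.and (k 0 3) (PP.and (k 2 0) (PP.and (k 3 0) (PP.and (k 4 0) (k 5 0))))) lC)
      (PP.and (PP.and (k 0 4) (PP.and (k 3 0) (PP.and (k 4 0) (k 5 0)))) (PP.and lC ?_)))
  · exact PP.lt (hv 1) ((hN.mul hN).add (PF.const 1))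
  · exact PP.lt (hv 5) (PF.wordM (hv 4))
  · exact PP.lt (hv 4) PF.wordR
  · exact PP.lt (hv 2) (((hv 1).add (PF.const 1)).mul hD)

/-- A context with six more numbers. -/
abbrev Six (X : Type) : Type := (((((X × ℕ) × ℕ) × ℕ) × ℕ) × ℕ) × ℕ

/-- The six last numbers of a context. -/
def Six.tuple (y : Six X) : Fin 6 → ℕ :=
  ![y.1.1.1.1.1.2, y.1.1.1.1.2, y.1.1.1.2, y.1.1.2, y.1.2, y.2]

theorem Six.definable : ∀ i, PF fun y : Six X => y.tuple i := by
  simp only [Fin.forall_fin_succ]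
  refine ⟨?_, ?_, ?_, ?_, ?_, ?_, fun i => i.elim0⟩
  · exact PF.snd.fst.fst.fst.fst.fst
  · exact PF.snd.fst.fst.fst.fst
  · exact PF.snd.fst.fst.fst
  · exact PF.snd.fst.fst
  · exact PF.snd.fst
  · exact PF.snd

/-- The enumeration is six nested loops over ranges whose body is emitted only for valid tuples. -/
theorem PG.vertexList {g : X → (Fin 6 → ℕ) → List β}
    (hg : PG fun y : Six X => g y.1.1.1.1.1.1 y.tuple) :
    PG fun x => (vertexList (inp x)).flatMap (g x) := by
  classical
  have hB : PF fun x : X => GameSym.hubBound (inp x) := PF.hubBound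
  have hbody : PG fun y : Six X =>
      if GameSym.validC (inp y) y.tuple (GameSym.labelCount (inp y)) (GameSym.hubUnit (inp y))
      then g y.1.1.1.1.1.1 y.tuple else [] :=
    PG.ite (PP.validC Six.definable) hg PG.nil
  have e : ∀ x, (GameSym.vertexList (inp x)).flatMap (g x) =
      (List.range (GameSym.hubBound (inp x))).flatMap fun a =>
      (List.range (GameSym.hubBound (inp x))).flatMap fun b =>
      (List.range (GameSym.hubBound (inp x))).flatMap fun c =>
      (List.range (GameSym.hubBound (inp x))).flatMap fun d =>
      (List.range (GameSym.hubBound (inp x))).flatMap fun e =>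
      (List.range (GameSym.hubBound (inp x))).flatMap fun f =>
        if GameSym.validC (inp x) ![a, b, c, d, e, f] (GameSym.labelCount (inp x))
          (GameSym.hubUnit (inp x)) then g x ![a, b, c, d, e, f] else [] := by
    intro x
    rw [GameSym.vertexList, codeList_flatMap]
    simp only [tuples_succ_flatMap, tuples_zero_flatMap]
  refine PG.congr ?_ e
  refine PG.flatMap hB ?_
  refine PG.flatMap hB.fst ?_
  refine PG.flatMap hB.fst.fst ?_
  refine PG.flatMap hB.fst.fst.fst ?_
  refine PG.flatMap hB.fst.fst.fst.fst ?_
  refine PG.flatMap hB.fst.fst.fst.fst.fst ?_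
  exact hbody

theorem PG.graphWord (ε : ℕ) : PG (graphWord ε) := by
  classical
  have h : PG fun w : List Γ' => (GameSym.vertexList (inp w)).flatMap fun v =>
      ((GameSym.vertexList (inp w)).flatMap fun v' =>
        if GameSym.adjC (inp w) v v' ε then [Γ'.bit true] else [Γ'.bit false]) ++ [Γ'.comma] := by
    refine PG.vertexList (PG.append ?_ (PG.const _))
    -- The inner enumeration runs in a context already extended by the first tuple, so the
    -- coordinates of that tuple are weakened six times.
    refine PG.vertexList (X := Six (List Γ'))
      (g := fun y v' => if GameSym.adjC (inp y) y.tuple v' ε then [Γ'.bit true]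
        else [Γ'.bit false]) ?_
    refine PG.ite ?_ (PG.const _) (PG.const _)
    exact PP.adjC ε (fun i => (Six.definable i).fst.fst.fst.fst.fst.fst) Six.definable
  refine h.congr fun w => ?_
  unfold GameSym.graphWord relWord
  congr!

/-- Deciding whether a game has a symmetry that is not player-separable reduces to graph
isomorphism. -/
theorem nonPlayerSeparableSymmetry_inGI : nonPlayerSeparableSymmetry.InGI := by
  -- The graphs are chosen arbitrarily; only their codes matter for the program, and these are fixed
  -- by `graphWord`.
  choose G hG hcode using exists_finGraph_game
  refine ⟨fun Γ => (G Γ false, G Γ true), ?_, fun Γ => ?_⟩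
  · refine (((PG.graphWord 0).map Sum.inl).append ((PG.graphWord 1).map Sum.inr)).computable
      _ _ _ fun Γ => ?_
    exact (congrArg₂ (fun a b => a.map Sum.inl ++ b.map Sum.inr) (hcode Γ false)
      (hcode Γ true)).symm
  · refine (game_hubGraph_iso_iff Γ).symm.trans ?_
    obtain ⟨e⟩ := hG Γ false
    obtain ⟨e'⟩ := hG Γ true
    exact ⟨fun ⟨f⟩ => ⟨(e.trans f).trans e'.symm⟩, fun ⟨f⟩ => ⟨(e.symm.trans f).trans e'⟩⟩

end Definability

end GameSym

/-- Deciding whether a game has a symmetry that is not player-separable is GI-complete, and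
GI-hardness holds already for two-player zero-sum games. -/
theorem mainTheorem4 :
    GameSym.nonPlayerSeparableSymmetry.GIComplete ∧
      (GameSym.nonPlayerSeparableSymmetry.restrict
        GameSym.Game.IsTwoPlayerZeroSum).GIHard :=
  ⟨⟨GameSym.nonPlayerSeparableSymmetry_inGI, GameSym.nonPlayerSeparableSymmetry_GIHard⟩,
    GameSym.zeroSum_GIHard⟩
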